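/- **Setup.** Let $O=(Y,D,E,T,X)\sim P$ be one observation of pooled repeated cross-sections: outcome $Y\in\mathbb R$ with $E[Y^2]<\infty$, treatment $D\in\{0,1\}$, exposure cohort $E\in\mathbb N\cup\{\infty\}$, sampling period $T\in\mathbb N$, covariates $X$ in a measurable space, where $(E,X)$ is independent of $T$. Fix a cohort $e\ge 2$ and a period $t\ge e$ with $\lambda_s:=P(T=s)>0$ for $s\in\{e-1,t\}$. Let $E_e=\mathbf 1\{E=e\}$ and let $C$ be the never-exposed indicator $\mathbf 1\{E=\infty\}$ or the not-yet-exposed indicator $\mathbf 1\{E\ne e,\,E>t\}$. For $s\in\{e-1,t\}$ put $$p(X)=P(E_e=1\mid X,E_e+C=1),\quad m^{trt}_s(X)=E[Y\mid X,E_e=1,T=s],\quad m^{c}_s(X)=E[Y\mid X,C=1,T=s],$$ let $g^{trt}_s,g^c_s$ be the same with $D$ in place of $Y$, and let $r=p/(1-p)$. Assume overlap: for some $c>0$, $P(E_e=1)>c$ and $p(X)<1-c$ almost surely given $E_e+C=1$. The target is the identified ratio $$\tau_0=\tau^{rc}_{e,t}=\frac{E[m^{trt}_t(X)-m^{trt}_{e-1}(X)-\{m^c_t(X)-m^c_{e-1}(X)\}\mid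 E_e=1]}{E[g^{trt}_t(X)-g^{trt}_{e-1}(X)-\{g^c_t(X)-g^c_{e-1}(X)\}\mid E_e=1]},$$ whose denominator is assumed to be nonzero. **Score.** With $w^{trt}_s=E_e\mathbf 1\{T=s\}/E[E_e\mathbf 1\{T=s\}]$, $w^c_s=C\mathbf 1\{T=s\}r(X)/E[C\mathbf 1\{T=s\}r(X)]$, $w^{trt}=w^{trt}_t-w^{trt}_{e-1}$, $w^c=w^c_t-w^c_{e-1}$, $\rho=E[E_e]$, let $$\psi_b=w^{trt}\{Y-m^{trt}_Y\}-w^c\{Y-m^c_Y\}+\frac{E_e}{\rho}\{m^{trt}_t(X)-m^{trt}_{e-1}(X)-[m^c_t(X)-m^c_{e-1}(X)]\},$$ where $m^{a}_Y=\mathbf 1\{T=e-1\}m^a_{e-1}(X)+\mathbf 1\{T=t\}m^a_t(X)$ for $a\in\{trt,c\}$; let $\psi_a$ be the same with $(D,g)$ in place of $(Y,m)$, and let $\psi(O;\tau,\eta)=\psi_b(O;\eta)-\tau\,\psi_a(O;\eta)$. Denote by $\eta_0$ the true nuisances. **Estimator.** Let $O_1,O_2,\dots$ be i.i.d. from $P$,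 let $K\ge2$ be fixed, and let $n=Kb$ observations be partitioned into $K$ folds of equal size $b$; $P_n^k$ is the empirical mean over fold $k$. For each $k$ let $\hat p,\hat m^{trt}_s,\hat m^c_s,\hat g^{trt}_s,\hat g^c_s$ (jointly forming $\hat\eta^{-k}$) be measurable functions of the observations outside fold $k$ and of $x$. In the $k$-th estimated score these replace the true functions, and the denominators of the weights are replaced by $\hat\rho=P_n^k[E_e]$, $\hat\rho^{trt}_s=P_n^k[E_e\mathbf 1\{T=s\}]$ and $P_n^k[C\mathbf 1\{T=s\}\hat r(X)]$ with $\hat r=\hat p/(1-\hat p)$. The DML estimator is $$\hat\tau=\frac{K^{-1}\sum_kP_n^k[\psi_b(O;\hat\eta^{-k})]}{\hat J_0},\qquad \hat J_0=K^{-1}\sum_kP_n^k[\psi_a(O;\hat\eta^{-k})].$$ **Conditions.** Let $\|\cdot\|_2$ be the $L^2$ norm for the law of $X$ given $E_e+C=1$. For every fold $k$ and $s\in\{e-1,t\}$, as $b\to\infty$: 1. $\|m^{trt}_s-\hat m^{trt}_s\|_2=o_P(1)$ and $\|g^{trt}_s-\hat g^{trt}_s\|_2=o_P(1)$; 2. $|\lambda_s/\hat\rho^{trt}_s-1/\hat\rho|=O_P(n^{-1/2})$;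 3. $\|r-\hat r\|_2\,\|m^c_s-\hat m^c_s\|_2=o_P(n^{-1/2})$ and $\|r-\hat r\|_2\,\|g^c_s-\hat g^c_s\|_2=o_P(n^{-1/2})$; 4. $\|r-\hat r\|_2$, $\|m^c_s-\hat m^c_s\|_2$ and $\|g^c_s-\hat g^c_s\|_2$ are $o_P(1)$, and with probability tending to one $\hat p<1-c$ almost everywhere for the law of $X$ given $E_e+C=1$. **Conclusion.** Then $J_0:=E[\psi_a(O;\eta_0)]\neq0$, $E[\psi(O;\tau_0,\eta_0)^2]<\infty$, and $$\sqrt n(\hat\tau-\tau_0)\overset{d}{\to}N(0,\sigma^2),\qquad \sigma^2=J_0^{-2}E[\psi(O;\tau_0,\eta_0)^2].$$ Moreover the variance estimator $$\hat\sigma^2=\hat J_0^{-2}K^{-1}\sum_kP_n^k[\psi(O;\hat\tau,\hat\eta^{-k})^2]$$ converges in probability to $\sigma^2$, and if $\sigma^2>0$, then for every $\alpha\in(0,1)$ the interval $[\hat\tau\pm\Phi^{-1}(1-\alpha/2)\,\hat\sigma/\sqrt n]$ contains $\tau_0$ with probability tending to $1-\alpha$, where $\Phi^{-1}$ is the standard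 normal quantile function. -/

import Mathlib

open MeasureTheory ProbabilityTheory Filter Topology
open scoped ENNReal NNReal

namespace IDiD

noncomputable section

/-! ### Observations, cohorts, control groups -/

/-- One observation `(Y, D, E, T, X)` of the pooled repeated cross-sections: outcome, treatment,
exposure cohort (`⊤` means never exposed), sampling period, covariates. -/
abbrev Obs (𝒳 : Type*) := ℝ × ℝ × ℕ∞ × ℕ × 𝒳

section Basic

variable {𝒳 : Type*}

abbrev obsY (o : Obs 𝒳) : ℝ := o.1
abbrev obsD (o : Obs 𝒳) : ℝ := o.2.1
abbrev obsE (o : Obs 𝒳) : ℕ∞ := o.2.2.1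
abbrev obsT (o : Obs 𝒳) : ℕ := o.2.2.2.1
abbrev obsX (o : Obs 𝒳) : 𝒳 := o.2.2.2.2

/-- The event `{E = e}`. -/
def exposed (e : ℕ) : Set (Obs 𝒳) := {o | obsE o = (e : ℕ∞)}

/-- The event `{T = s}`. -/
def period (s : ℕ) : Set (Obs 𝒳) := {o | obsT o = s}

/-- The two admissible kinds of control group. -/
inductive ControlGroup
  | neverExposed
  | notYetExposed

/-- The event `{C = 1}`: `E = ∞` for never-exposed controls; `E ≠ e` and `E > t` (not exposed up to
and including period `t`) for not-yet-exposed controls. -/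
def control (g : ControlGroup) (e t : ℕ) : Set (Obs 𝒳) :=
  match g with
  | .neverExposed => {o | obsE o = ⊤}
  | .notYetExposed => {o | obsE o ≠ (e : ℕ∞) ∧ (t : ℕ∞) < obsE o}

/-- The `2 × 2` comparison slice `{E_e + C = 1}`. -/
def slice (g : ControlGroup) (e t : ℕ) : Set (Obs 𝒳) := exposed e ∪ control g e t

/-- `0/1`-valued indicator of an event. -/
def ind (A : Set (Obs 𝒳)) (o : Obs 𝒳) : ℝ := A.indicator (fun _ => (1 : ℝ)) o

/-! ### Nuisance functions and normalizing constants -/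

/-- The nuisance functions: the propensity score and, for every period, the regression functions
of `Y` and `D` among the exposed and among the controls (only periods `e - 1` and `t` are used). -/
structure Nuisance (𝒳 : Type*) where
  p : 𝒳 → ℝ
  mTrt : ℕ → 𝒳 → ℝ
  mCtl : ℕ → 𝒳 → ℝ
  gTrt : ℕ → 𝒳 → ℝ
  gCtl : ℕ → 𝒳 → ℝ

/-- The propensity odds `p / (1 - p)`. -/
def Nuisance.odds (η : Nuisance 𝒳) (x : 𝒳) : ℝ := η.p x / (1 - η.p x)

/-- The denominators of the weights. -/
structure Normalizers where
  rho : ℝ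
  rhoTrt : ℕ → ℝ
  rhoCtl : ℕ → ℝ

/-- The denominators of the weights computed with a mean functional `M`
(a population expectation or an empirical mean): `M[E_e]`, `M[E_e 1{T = s}]` and
`M[C 1{T = s} p(X) / (1 - p(X))]`. -/
def normalizers (M : (Obs 𝒳 → ℝ) → ℝ) (g : ControlGroup) (e t : ℕ) (η : Nuisance 𝒳) :
    Normalizers where
  rho := M (ind (exposed e))
  rhoTrt s := M (fun o => ind (exposed e) o * ind (period s) o)
  rhoCtl s := M (fun o => ind (control g e t) o * ind (period s) o * η.odds (obsX o))

/-! ### The score -/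

/-- `w^trt_{e,s}`. -/
def wTrtAt (N : Normalizers) (e s : ℕ) (o : Obs 𝒳) : ℝ :=
  ind (exposed e) o * ind (period s) o / N.rhoTrt s

/-- `w^c_{e,t,s}`. -/
def wCtlAt (N : Normalizers) (g : ControlGroup) (e t : ℕ) (η : Nuisance 𝒳) (s : ℕ)
    (o : Obs 𝒳) : ℝ :=
  ind (control g e t) o * ind (period s) o * η.odds (obsX o) / N.rhoCtl s

/-- `w^trt_e = w^trt_{e,t} - w^trt_{e,e-1}`. -/
def wTrt (N : Normalizers) (e t : ℕ) (o : Obs 𝒳) : ℝ :=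
  wTrtAt N e t o - wTrtAt N e (e - 1) o

/-- `w^c_e = w^c_{e,t,t} - w^c_{e,t,e-1}`. -/
def wCtl (N : Normalizers) (g : ControlGroup) (e t : ℕ) (η : Nuisance 𝒳) (o : Obs 𝒳) : ℝ :=
  wCtlAt N g e t η t o - wCtlAt N g e t η (e - 1) o

/-- `1{T = e-1} μ_{e-1}(X) + 1{T = t} μ_t(X)`. -/
def joined (e t : ℕ) (μ : ℕ → 𝒳 → ℝ) (o : Obs 𝒳) : ℝ :=
  ind (period (e - 1)) o * μ (e - 1) (obsX o) + ind (period t) o * μ t (obsX o)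

/-- `μ^trt_t(x) - μ^trt_{e-1}(x) - [μ^c_t(x) - μ^c_{e-1}(x)]`. -/
def didContrast (e t : ℕ) (μTrt μCtl : ℕ → 𝒳 → ℝ) (x : 𝒳) : ℝ :=
  μTrt t x - μTrt (e - 1) x - (μCtl t x - μCtl (e - 1) x)

/-- The common form of both score components, for a variable `V` (either `Y` or `D`) with
regression functions `μTrt`, `μCtl`. -/
def scorePart (N : Normalizers) (g : ControlGroup) (e t : ℕ) (η : Nuisance 𝒳)
    (V : Obs 𝒳 → ℝ) (μTrt μCtl : ℕ → 𝒳 → ℝ) (o : Obs 𝒳) : ℝ :=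
  wTrt N e t o * (V o - joined e t μTrt o)
    - wCtl N g e t η o * (V o - joined e t μCtl o)
    + ind (exposed e) o / N.rho * didContrast e t μTrt μCtl (obsX o)

/-- `ψ_b`. -/
def psiB (N : Normalizers) (g : ControlGroup) (e t : ℕ) (η : Nuisance 𝒳) (o : Obs 𝒳) : ℝ :=
  scorePart N g e t η obsY η.mTrt η.mCtl o

/-- `ψ_a`. -/
def psiA (N : Normalizers) (g : ControlGroup) (e t : ℕ) (η : Nuisance 𝒳) (o : Obs 𝒳) : ℝ :=
  scorePart N g e t η obsD η.gTrt η.gCtl o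

/-- The score `ψ = ψ_b - τ ψ_a`. -/
def psi (N : Normalizers) (g : ControlGroup) (e t : ℕ) (η : Nuisance 𝒳) (τ : ℝ)
    (o : Obs 𝒳) : ℝ :=
  psiB N g e t η o - τ * psiA N g e t η o

end Basic

/-! ### Population quantities -/

section Population

variable {𝒳 : Type*} [MeasurableSpace 𝒳]

/-- `m` is a version of the regression function `x ↦ E[V | X = x, A]`, i.e. `m(X)` is the
conditional expectation of `V` given `X` under the conditional law `P(· | A)`. -/
def IsRegression (P : Measure (Obs 𝒳)) (V : Obs 𝒳 → ℝ) (A : Set (Obs 𝒳)) (m : 𝒳 → ℝ) : Prop :=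
  Measurable m ∧
    (fun o => m (obsX o)) =ᵐ[ProbabilityTheory.cond P A]
      MeasureTheory.condExp (MeasurableSpace.comap (obsX (𝒳 := 𝒳)) inferInstance)
        (ProbabilityTheory.cond P A) V

/-- `η` consists of (versions of) the true nuisance functions:
`p = P(E_e = 1 | X, E_e + C = 1)`, and for `s ∈ {e - 1, t}`
`m^trt_s = E[Y | X, E_e = 1, T = s]`, `m^c_s = E[Y | X, C = 1, T = s]`,
`g^trt_s = E[D | X, E_e = 1, T = s]`, `g^c_s = E[D | X, C = 1, T = s]`. -/
structure IsTrueNuisance (P : Measure (Obs 𝒳)) (g : ControlGroup) (e t : ℕ)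
    (η : Nuisance 𝒳) : Prop where
  propensity : IsRegression P (ind (exposed e)) (slice g e t) η.p
  mTrt : ∀ s, s = e - 1 ∨ s = t → IsRegression P obsY (exposed e ∩ period s) (η.mTrt s)
  mCtl : ∀ s, s = e - 1 ∨ s = t → IsRegression P obsY (control g e t ∩ period s) (η.mCtl s)
  gTrt : ∀ s, s = e - 1 ∨ s = t → IsRegression P obsD (exposed e ∩ period s) (η.gTrt s)
  gCtl : ∀ s, s = e - 1 ∨ s = t → IsRegression P obsD (control g e t ∩ period s) (η.gCtl s)

/-- Numerator `E[m^trt_t - m^trt_{e-1} - (m^c_t - m^c_{e-1}) | E_e = 1]`. -/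
def tauNum (P : Measure (Obs 𝒳)) (e t : ℕ) (η : Nuisance 𝒳) : ℝ :=
  ∫ o, didContrast e t η.mTrt η.mCtl (obsX o) ∂(ProbabilityTheory.cond P (exposed e))

/-- Denominator `E[g^trt_t - g^trt_{e-1} - (g^c_t - g^c_{e-1}) | E_e = 1]`. -/
def tauDen (P : Measure (Obs 𝒳)) (e t : ℕ) (η : Nuisance 𝒳) : ℝ :=
  ∫ o, didContrast e t η.gTrt η.gCtl (obsX o) ∂(ProbabilityTheory.cond P (exposed e))

/-- The target parameter `τ^rc_{e,t}`. -/
def tau (P : Measure (Obs 𝒳)) (e t : ℕ) (η : Nuisance 𝒳) : ℝ :=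
  tauNum P e t η / tauDen P e t η

/-- The population denominators of the weights. -/
def popNormalizers (P : Measure (Obs 𝒳)) (g : ControlGroup) (e t : ℕ) (η : Nuisance 𝒳) :
    Normalizers :=
  normalizers (fun f => ∫ o, f o ∂P) g e t η

/-- The score at the truth, `ψ(· ; τ₀, η₀)`. -/
def psiTrue (P : Measure (Obs 𝒳)) (g : ControlGroup) (e t : ℕ) (η : Nuisance 𝒳)
    (o : Obs 𝒳) : ℝ :=
  psi (popNormalizers P g e t η) g e t η (tau P e t η) o

/-- `J₀ = E[ψ_a(O; η₀)]`. -/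
def J0 (P : Measure (Obs 𝒳)) (g : ControlGroup) (e t : ℕ) (η : Nuisance 𝒳) : ℝ :=
  ∫ o, psiA (popNormalizers P g e t η) g e t η o ∂P

/-- `σ² = J₀⁻² E[ψ(O; τ₀, η₀)²]`. -/
def sigmaSq (P : Measure (Obs 𝒳)) (g : ControlGroup) (e t : ℕ) (η : Nuisance 𝒳) : ℝ :=
  ((J0 P g e t η) ^ 2)⁻¹ * ∫ o, (psiTrue P g e t η o) ^ 2 ∂P

/-- The distribution of the covariates in the comparison slice `{E_e + C = 1}`. -/
def covLaw (P : Measure (Obs 𝒳)) (g : ControlGroup) (e t : ℕ) : Measure 𝒳 :=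
  (ProbabilityTheory.cond P (slice g e t)).map obsX

/-- The `L²` distance `‖f - h‖_{2,P}` of two functions of the covariates. -/
def l2dist (P : Measure (Obs 𝒳)) (g : ControlGroup) (e t : ℕ) (f h : 𝒳 → ℝ) : ℝ≥0∞ :=
  eLpNorm (fun x => f x - h x) 2 (covLaw P g e t)

/-- A nuisance estimator is a function of its training data; all its components are jointly
measurable in the data and the covariate value. -/
structure IsMeasurableLearner {ι : Type*} (L : (ι → Obs 𝒳) → Nuisance 𝒳) : Prop where
  p : Measurable fun q : (ι → Obs 𝒳) × 𝒳 => (L q.1).p q.2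
  mTrt : ∀ s, Measurable fun q : (ι → Obs 𝒳) × 𝒳 => (L q.1).mTrt s q.2
  mCtl : ∀ s, Measurable fun q : (ι → Obs 𝒳) × 𝒳 => (L q.1).mCtl s q.2
  gTrt : ∀ s, Measurable fun q : (ι → Obs 𝒳) × 𝒳 => (L q.1).gTrt s q.2
  gCtl : ∀ s, Measurable fun q : (ι → Obs 𝒳) × 𝒳 => (L q.1).gCtl s q.2

end Population

/-! ### Stochastic orders -/

section Orders

variable {Ω : Type*} [MeasurableSpace Ω]

/-- `Z_b = o_P(a_b)` for `[0, ∞]`-valued `Z_b`. -/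
def IsLittleOP (Pr : Measure Ω) (Z : ℕ → Ω → ℝ≥0∞) (a : ℕ → ℝ) : Prop :=
  ∀ ε : ℝ, 0 < ε →
    Tendsto (fun b => Pr {ω | ENNReal.ofReal (ε * a b) ≤ Z b ω}) atTop (𝓝 0)

/-- `Z_b = O_P(a_b)` for real-valued `Z_b`. -/
def IsBigOP (Pr : Measure Ω) (Z : ℕ → Ω → ℝ) (a : ℕ → ℝ) : Prop :=
  ∀ ε : ℝ, 0 < ε → ∃ M : ℝ, ∀ᶠ b in atTop,
    Pr {ω | M * a b < |Z b ω|} ≤ ENNReal.ofReal ε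

end Orders

/-! ### Cross-fitting

The sample size is `n = K * b`, and `fold i` is the fold (of size `b`) containing observation `i`. -/

section CrossFit

variable {𝒳 : Type*} {K b : ℕ}

/-- The empirical mean over fold `k`, `P_n^k[f]`. -/
def foldMean (fold : Fin (K * b) → Fin K) (o : Fin (K * b) → Obs 𝒳) (k : Fin K)
    (f : Obs 𝒳 → ℝ) : ℝ :=
  (b : ℝ)⁻¹ * ∑ i : Fin (K * b) with fold i = k, f (o i)

/-- `K⁻¹ ∑ₖ P_n^k[f_k]`. -/
def crossMean (fold : Fin (K * b) → Fin K) (o : Fin (K * b) → Obs 𝒳)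
    (f : Fin K → Obs 𝒳 → ℝ) : ℝ :=
  (K : ℝ)⁻¹ * ∑ k, foldMean fold o k (f k)

/-- A nuisance learner: for every fold `k`, nuisance functions computed from the observations
outside fold `k` only. -/
abbrev Learner (𝒳 : Type*) {K b : ℕ} (fold : Fin (K * b) → Fin K) :=
  (k : Fin K) → ({i : Fin (K * b) // fold i ≠ k} → Obs 𝒳) → Nuisance 𝒳

/-- `η̂^{-k}`: the learner applied to the observations outside fold `k`. -/
def fit (fold : Fin (K * b) → Fin K) (L : Learner 𝒳 fold) (o : Fin (K * b) → Obs 𝒳)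
    (k : Fin K) : Nuisance 𝒳 :=
  L k fun i => o i.1

/-- The estimated weight denominators for fold `k`: the weights, built from `η̂^{-k}`, are
normalized to have mean one under `P_n^k`. -/
def fitNormalizers (fold : Fin (K * b) → Fin K) (L : Learner 𝒳 fold) (g : ControlGroup)
    (e t : ℕ) (o : Fin (K * b) → Obs 𝒳) (k : Fin K) : Normalizers :=
  normalizers (foldMean fold o k) g e t (fit fold L o k)

/-- `Ĵ₀ = K⁻¹ ∑ₖ P_n^k[ψ_a(O; η̂^{-k})]`. -/
def Jhat (fold : Fin (K * b) → Fin K) (L : Learner 𝒳 fold) (g : ControlGroup)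
    (e t : ℕ) (o : Fin (K * b) → Obs 𝒳) : ℝ :=
  crossMean fold o fun k => psiA (fitNormalizers fold L g e t o k) g e t (fit fold L o k)

/-- The DML estimator, i.e. the solution `τ` of `K⁻¹ ∑ₖ P_n^k[ψ(O; τ, η̂^{-k})] = 0`:
the ratio of `K⁻¹ ∑ₖ P_n^k[ψ_b(O; η̂^{-k})]` and `K⁻¹ ∑ₖ P_n^k[ψ_a(O; η̂^{-k})]`. -/
def tauHat (fold : Fin (K * b) → Fin K) (L : Learner 𝒳 fold) (g : ControlGroup)
    (e t : ℕ) (o : Fin (K * b) → Obs 𝒳) : ℝ :=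
  (crossMean fold o fun k => psiB (fitNormalizers fold L g e t o k) g e t (fit fold L o k))
    / Jhat fold L g e t o

/-- `σ̂² = Ĵ₀⁻² K⁻¹ ∑ₖ P_n^k[ψ(O; τ̂, η̂^{-k})²]`. -/
def sigmaSqHat (fold : Fin (K * b) → Fin K) (L : Learner 𝒳 fold) (g : ControlGroup)
    (e t : ℕ) (o : Fin (K * b) → Obs 𝒳) : ℝ :=
  ((Jhat fold L g e t o) ^ 2)⁻¹ *
    crossMean fold o fun k o' =>
      (psi (fitNormalizers fold L g e t o k) g e t (fit fold L o k)
        (tauHat fold L g e t o) o') ^ 2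

/-- The quantile function `Φ⁻¹` of the standard normal distribution. -/
def stdNormalQuantile (q : ℝ) : ℝ := sInf {x : ℝ | q ≤ cdf (gaussianReal 0 1) x}

/-- The confidence interval `[τ̂ ± Φ⁻¹(1 - α/2) σ̂ / √n]`. -/
def confInterval (fold : Fin (K * b) → Fin K) (L : Learner 𝒳 fold) (g : ControlGroup)
    (e t : ℕ) (α : ℝ) (o : Fin (K * b) → Obs 𝒳) : Set ℝ :=
  let h := stdNormalQuantile (1 - α / 2) * √(sigmaSqHat fold L g e t o) / √((K * b : ℕ) : ℝ)
  Set.Icc (tauHat fold L g e t o - h) (tauHat fold L g e t o + h)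

end CrossFit

/-! ### Conditions on the nuisance estimators -/

section Conditions

variable {𝒳 Ω : Type*} [MeasurableSpace 𝒳] [MeasurableSpace Ω] {K : ℕ}

/-- The first `K * b` observations. -/
def sample (K b : ℕ) (O : ℕ → Ω → Obs 𝒳) (ω : Ω) (i : Fin (K * b)) : Obs 𝒳 := O i ω

/-- `n^{-1/2}` with `n = K * b`. -/
def rootRate (K b : ℕ) : ℝ := (√((K * b : ℕ) : ℝ))⁻¹

/-- Conditions on the estimated nuisances, for every fold `k` and both periods `s ∈ {e - 1, t}`;
`η` are the true nuisance functions and `ηh b ω k` stands for `η̂^{-k}` at sample size `K * b`. -/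
structure NuisanceConditions (Pr : Measure Ω) (P : Measure (Obs 𝒳)) (g : ControlGroup)
    (e t : ℕ) (c : ℝ) (η : Nuisance 𝒳) (ηh : (b : ℕ) → Ω → Fin K → Nuisance 𝒳)
    (Nh : (b : ℕ) → Ω → Fin K → Normalizers) : Prop where
  /-- Treated nuisance consistency. -/
  mTrt_consistent : ∀ k s, s = e - 1 ∨ s = t →
    IsLittleOP Pr (fun b ω => l2dist P g e t (η.mTrt s) ((ηh b ω k).mTrt s)) (fun _ => 1)
  gTrt_consistent : ∀ k s, s = e - 1 ∨ s = t →
    IsLittleOP Pr (fun b ω => l2dist P g e t (η.gTrt s) ((ηh b ω k).gTrt s)) (fun _ => 1)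
  /-- Weight fluctuations. -/
  weights : ∀ k s, s = e - 1 ∨ s = t →
    IsBigOP Pr (fun b ω => P.real (period s) / (Nh b ω k).rhoTrt s - 1 / (Nh b ω k).rho)
      (rootRate K)
  /-- Second-order rate condition. -/
  rate_m : ∀ k s, s = e - 1 ∨ s = t →
    IsLittleOP Pr (fun b ω => l2dist P g e t η.odds (ηh b ω k).odds
      * l2dist P g e t (η.mCtl s) ((ηh b ω k).mCtl s)) (rootRate K)
  rate_g : ∀ k s, s = e - 1 ∨ s = t →
    IsLittleOP Pr (fun b ω => l2dist P g e t η.odds (ηh b ω k).odds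
      * l2dist P g e t (η.gCtl s) ((ηh b ω k).gCtl s)) (rootRate K)
  /-- Consistency (without a rate) of the control-group nuisances, needed for the empirical
  process term. -/
  odds_consistent : ∀ k,
    IsLittleOP Pr (fun b ω => l2dist P g e t η.odds (ηh b ω k).odds) (fun _ => 1)
  mCtl_consistent : ∀ k s, s = e - 1 ∨ s = t →
    IsLittleOP Pr (fun b ω => l2dist P g e t (η.mCtl s) ((ηh b ω k).mCtl s)) (fun _ => 1)
  gCtl_consistent : ∀ k s, s = e - 1 ∨ s = t →
    IsLittleOP Pr (fun b ω => l2dist P g e t (η.gCtl s) ((ηh b ω k).gCtl s)) (fun _ => 1)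
  /-- Overlap for the estimated propensity score, with probability tending to one. -/
  overlap : ∀ k,
    Tendsto (fun b => Pr {ω | ¬ ∀ᵐ x ∂(covLaw P g e t), (ηh b ω k).p x < 1 - c}) atTop (𝓝 0)

end Conditions

end

end IDiD

set_option linter.unusedSectionVars false

/-! The score is Neyman orthogonal: replacing the true nuisances by cross-fitted ones changes its
mean at `τ₀` only by `o_P(n^{-1/2})`. What remains is an average of i.i.d. mean-zero true scores, to
which the central limit theorem and Slutsky's theorem apply.

By linearity `ψ_b`, `ψ_a` and `ψ` are the scores of `αY + βD` with `(α, β)` equal to `(1, 0)`, `(0,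
1)` and `(1, -τ)`. Since `e - 1 ≠ t`, each is a difference of two one-period terms `scoreAt`
(`mixScore_eq`), so the analysis takes place in one period `s` and one fold
(`LearnedSlice.negligible_expansion`). There are four kinds of error.

Empirical fluctuations: given the training data a learned function is fixed, so its centred mean
over the fold, times `√b`, has conditional second moment at most that of the function. Consistency
in `L²` therefore makes it vanish (`FoldedSample.negligible_fluctuation`).

Treated regression: its error `u(X)` enters through `E_e 1{T = s} u` and `E_e u`. As `T` is
independent of `(E, X)`, the function `E_e (1{T = s} - λ_s) u` has mean zero. What is left is
`λ_s/ρ̂^trt_s - 1/ρ̂ = O_P(n^{-1/2})` times an `o_P(1)` mean, so consistency without a rate is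
enough.

Control regression: the odds `r` are the density of the exposed covariate measure with respect to
the control one (`OverlapDesign.covMeasure_exposed_eq_withDensity_odds`). Hence the first-order
effects of the error on the reweighted controls and on the exposed cancel. Only products of an odds
error and a regression error survive, and Cauchy–Schwarz with the rate condition controls them
(`LearnedSlice.negligible_ctl_remainder`).

Normalizer of the last term: `1/ρ̂ - 1/ρ` multiplies the mean of the contrast of `Y - τ₀ D` over the
exposed, whose expectation is zero by the definition of `τ₀`
(`StudyDesign.integral_exposedContrast`).

The same decomposition, without the scaling by `√b`, shows that the estimated score is close to the
true one in empirical `L²`. This gives the consistency of `Ĵ₀` and `σ̂²`, and then the coverage. -/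

namespace IDiD

/-! ### A calculus of stochastic orders

All notions are phrased with the outer measure of events, so that no measurability is needed. -/

section StochasticOrder

variable {Ω : Type*} [MeasurableSpace Ω] {Pr : Measure Ω}

/-- Events whose probability tends to one. -/
def HighProb (Pr : Measure Ω) (G : ℕ → Ω → Prop) : Prop :=
  Tendsto (fun b => Pr {ω | ¬ G b ω}) atTop (𝓝 0)

/-- `Z_b = o_P(1)`. -/
def Negligible (Pr : Measure Ω) (Z : ℕ → Ω → ℝ) : Prop :=
  ∀ ε : ℝ, 0 < ε → HighProb Pr fun b ω => |Z b ω| < ε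

/-- `Z_b = O_P(1)`. -/
def Tight (Pr : Measure Ω) (Z : ℕ → Ω → ℝ) : Prop :=
  ∀ δ : ℝ≥0∞, 0 < δ → ∃ M : ℝ, 0 < M ∧ ∀ᶠ b in atTop, Pr {ω | ¬ |Z b ω| ≤ M} ≤ δ

theorem HighProb.mono {G H : ℕ → Ω → Prop} (hG : HighProb Pr G)
    (h : ∀ᶠ b in atTop, ∀ ω, G b ω → H b ω) : HighProb Pr H := by
  refine tendsto_of_tendsto_of_tendsto_of_le_of_le' tendsto_const_nhds hG
    (Eventually.of_forall fun _ => zero_le) ?_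
  filter_upwards [h] with b hb
  exact measure_mono fun ω hω hGω => hω (hb ω hGω)

theorem HighProb.and {G H : ℕ → Ω → Prop} (hG : HighProb Pr G) (hH : HighProb Pr H) :
    HighProb Pr fun b ω => G b ω ∧ H b ω := by
  have hsum := Tendsto.add hG hH
  rw [add_zero] at hsum
  refine tendsto_of_tendsto_of_tendsto_of_le_of_le tendsto_const_nhds hsum
    (fun _ => zero_le) fun b => ?_
  refine (measure_mono fun ω hω => ?_).trans (measure_union_le _ _)
  by_cases h : G b ω
  · exact Or.inr fun h' => hω ⟨h, h'⟩
  · exact Or.inl h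

theorem HighProb.of_forall {G : ℕ → Ω → Prop} (h : ∀ b ω, G b ω) : HighProb Pr G := by
  simp [HighProb, h]

theorem HighProb.of_eventually {G : ℕ → Ω → Prop} (h : ∀ᶠ b in atTop, ∀ ω, G b ω) :
    HighProb Pr G :=
  (HighProb.of_forall (G := fun _ _ => True) fun _ _ => trivial).mono
    (h.mono fun _ hb ω _ => hb ω)

theorem Negligible.of_le {Z W : ℕ → Ω → ℝ} (hW : Negligible Pr W)
    (h : HighProb Pr fun b ω => |Z b ω| ≤ |W b ω|) : Negligible Pr Z := fun ε hε =>
  ((hW ε hε).and h).mono (Eventually.of_forall fun _ _ hb => hb.2.trans_lt hb.1)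

theorem Negligible.congr {Z W : ℕ → Ω → ℝ} (hW : Negligible Pr W)
    (h : HighProb Pr fun b ω => Z b ω = W b ω) : Negligible Pr Z :=
  hW.of_le (h.mono (Eventually.of_forall fun _ _ hb => by rw [hb]))

theorem Negligible.add {Z W : ℕ → Ω → ℝ} (hZ : Negligible Pr Z) (hW : Negligible Pr W) :
    Negligible Pr fun b ω => Z b ω + W b ω := fun ε hε =>
  ((hZ (ε / 2) (by positivity)).and (hW (ε / 2) (by positivity))).mono
    (Eventually.of_forall fun b ω hb => by
      have := abs_add_le (Z b ω) (W b ω)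
      linarith [hb.1, hb.2])

theorem Negligible.neg {Z : ℕ → Ω → ℝ} (hZ : Negligible Pr Z) :
    Negligible Pr fun b ω => -Z b ω :=
  hZ.of_le (HighProb.of_forall fun _ _ => by rw [abs_neg])

theorem Negligible.sub {Z W : ℕ → Ω → ℝ} (hZ : Negligible Pr Z) (hW : Negligible Pr W) :
    Negligible Pr fun b ω => Z b ω - W b ω := by
  simpa only [sub_eq_add_neg] using hZ.add hW.neg

theorem Negligible.zero : Negligible Pr fun _ _ => (0 : ℝ) := fun ε hε =>
  HighProb.of_forall fun _ _ => by simpa using hε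

theorem Negligible.sum {ι : Type*} (s : Finset ι) {Z : ι → ℕ → Ω → ℝ}
    (h : ∀ i ∈ s, Negligible Pr (Z i)) : Negligible Pr fun b ω => ∑ i ∈ s, Z i b ω := by
  classical
  induction s using Finset.induction_on with
  | empty => simpa using Negligible.zero
  | insert i s hi ih =>
    simp only [Finset.sum_insert hi]
    exact (h i (Finset.mem_insert_self i s)).add
      (ih fun j hj => h j (Finset.mem_insert_of_mem hj))

theorem Tight.of_le {Z W : ℕ → Ω → ℝ} (hW : Tight Pr W)
    (h : HighProb Pr fun b ω => |Z b ω| ≤ |W b ω|) : Tight Pr Z := by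
  intro δ hδ
  obtain ⟨M, hM0, hM⟩ := hW (δ / 2) (ENNReal.half_pos hδ.ne')
  refine ⟨M, hM0, ?_⟩
  filter_upwards [hM, ENNReal.tendsto_nhds_zero.1 h _ (ENNReal.half_pos hδ.ne')] with b h1 h2
  refine (measure_mono fun ω hω => ?_).trans
    ((measure_union_le _ _).trans ((add_le_add h1 h2).trans (ENNReal.add_halves δ).le))
  by_cases hle : |Z b ω| ≤ |W b ω|
  · exact Or.inl fun hw => hω (hle.trans hw)
  · exact Or.inr hle

theorem Tight.const (x : ℝ) : Tight Pr fun _ _ => x := fun δ _ =>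
  ⟨|x| + 1, by positivity, Eventually.of_forall fun _ => by simp⟩

theorem Negligible.tight {Z : ℕ → Ω → ℝ} (hZ : Negligible Pr Z) : Tight Pr Z := by
  intro δ hδ
  refine ⟨1, one_pos, ?_⟩
  filter_upwards [ENNReal.tendsto_nhds_zero.1 (hZ 1 one_pos) δ hδ] with b hb
  exact (measure_mono fun ω (hω : ¬ |Z b ω| ≤ 1) hlt => hω (le_of_lt hlt)).trans hb

theorem Tight.add {Z W : ℕ → Ω → ℝ} (hZ : Tight Pr Z) (hW : Tight Pr W) :
    Tight Pr fun b ω => Z b ω + W b ω := by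
  intro δ hδ
  obtain ⟨M, hM0, hM⟩ := hZ (δ / 2) (ENNReal.half_pos hδ.ne')
  obtain ⟨N, hN0, hN⟩ := hW (δ / 2) (ENNReal.half_pos hδ.ne')
  refine ⟨M + N, by positivity, ?_⟩
  filter_upwards [hM, hN] with b h1 h2
  refine (measure_mono fun ω hω => ?_).trans
    ((measure_union_le _ _).trans ((add_le_add h1 h2).trans (ENNReal.add_halves δ).le))
  by_contra hcon
  simp only [Set.mem_union, Set.mem_ofPred_eq, not_or, not_not] at hcon
  exact hω ((abs_add_le _ _).trans (add_le_add hcon.1 hcon.2))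

theorem Tight.mul {Z W : ℕ → Ω → ℝ} (hZ : Tight Pr Z) (hW : Tight Pr W) :
    Tight Pr fun b ω => Z b ω * W b ω := by
  intro δ hδ
  obtain ⟨M, hM0, hM⟩ := hZ (δ / 2) (ENNReal.half_pos hδ.ne')
  obtain ⟨N, hN0, hN⟩ := hW (δ / 2) (ENNReal.half_pos hδ.ne')
  refine ⟨M * N, by positivity, ?_⟩
  filter_upwards [hM, hN] with b h1 h2
  refine (measure_mono fun ω hω => ?_).trans
    ((measure_union_le _ _).trans ((add_le_add h1 h2).trans (ENNReal.add_halves δ).le))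
  by_contra hcon
  simp only [Set.mem_union, Set.mem_ofPred_eq, not_or, not_not] at hcon
  refine hω ?_
  rw [abs_mul]
  exact mul_le_mul hcon.1 hcon.2 (abs_nonneg _) hM0.le

theorem Negligible.mul_tight {Z W : ℕ → Ω → ℝ} (hZ : Negligible Pr Z) (hW : Tight Pr W) :
    Negligible Pr fun b ω => Z b ω * W b ω := by
  intro ε hε
  refine ENNReal.tendsto_nhds_zero.2 fun δ hδ => ?_
  obtain ⟨M, hM0, hM⟩ := hW (δ / 2) (ENNReal.half_pos hδ.ne')
  filter_upwards [hM, ENNReal.tendsto_nhds_zero.1 (hZ (ε / M) (by positivity)) _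
    (ENNReal.half_pos hδ.ne')] with b h1 h2
  refine (measure_mono fun ω hω => ?_).trans
    ((measure_union_le _ _).trans ((add_le_add h1 h2).trans (ENNReal.add_halves δ).le))
  by_contra hcon
  simp only [Set.mem_union, Set.mem_ofPred_eq, not_or, not_not] at hcon
  refine hω ?_
  rw [abs_mul]
  calc |Z b ω| * |W b ω| ≤ |Z b ω| * M := by gcongr; exact hcon.1
    _ < ε / M * M := by gcongr; exact hcon.2
    _ = ε := by field_simp

theorem Tight.mul_negligible {Z W : ℕ → Ω → ℝ} (hZ : Tight Pr Z) (hW : Negligible Pr W) :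
    Negligible Pr fun b ω => Z b ω * W b ω := by
  simpa only [mul_comm] using hW.mul_tight hZ

theorem Negligible.const_mul {Z : ℕ → Ω → ℝ} (x : ℝ) (hZ : Negligible Pr Z) :
    Negligible Pr fun b ω => x * Z b ω :=
  (Tight.const x).mul_negligible hZ

theorem Negligible.of_tendsto {z : ℕ → ℝ} (h : Tendsto z atTop (𝓝 0)) :
    Negligible Pr fun b _ => z b := fun ε hε =>
  HighProb.of_eventually (((tendsto_order.1 (tendsto_zero_iff_abs_tendsto_zero _ |>.1 h)).2 ε
    hε).mono fun _ hb _ => hb)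

/-- Continuous mapping for convergence in probability to a constant. -/
theorem Negligible.comp_continuousAt {Z : ℕ → Ω → ℝ} {z : ℝ} {f : ℝ → ℝ}
    (hZ : Negligible Pr fun b ω => Z b ω - z) (hf : ContinuousAt f z) :
    Negligible Pr fun b ω => f (Z b ω) - f z := by
  intro ε hε
  obtain ⟨δ, hδ, h⟩ := Metric.continuousAt_iff.1 hf ε hε
  exact (hZ δ hδ).mono (Eventually.of_forall fun b ω hb => h hb)

theorem Negligible.inv_sub_inv {Z : ℕ → Ω → ℝ} {z : ℝ}
    (hZ : Negligible Pr fun b ω => Z b ω - z) (hz : z ≠ 0) :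
    Negligible Pr fun b ω => (Z b ω)⁻¹ - z⁻¹ :=
  hZ.comp_continuousAt (f := fun x => x⁻¹) (continuousAt_inv₀ hz)

theorem Negligible.tight_of_sub {Z : ℕ → Ω → ℝ} {z : ℝ}
    (hZ : Negligible Pr fun b ω => Z b ω - z) : Tight Pr Z := by
  simpa using hZ.tight.add (Tight.const z)

theorem Negligible.highProb_ne_zero {Z : ℕ → Ω → ℝ} {z : ℝ}
    (hZ : Negligible Pr fun b ω => Z b ω - z) (hz : z ≠ 0) :
    HighProb Pr fun b ω => Z b ω ≠ 0 :=
  (hZ |z| (abs_pos.2 hz)).mono (Eventually.of_forall fun b ω hb h0 => by simp [h0] at hb)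

theorem Negligible.of_sq {Z : ℕ → Ω → ℝ} (hZ : Negligible Pr fun b ω => Z b ω ^ 2) :
    Negligible Pr Z := fun ε hε =>
  (hZ (ε ^ 2) (by positivity)).mono (Eventually.of_forall fun b ω hb => by
    rw [abs_of_nonneg (sq_nonneg _)] at hb
    exact abs_lt_of_sq_lt_sq hb hε.le)

theorem Negligible.sq {Z : ℕ → Ω → ℝ} (hZ : Negligible Pr Z) :
    Negligible Pr fun b ω => Z b ω ^ 2 := by
  simpa only [pow_two] using hZ.mul_tight hZ.tight

theorem Tight.sq {Z : ℕ → Ω → ℝ} (hZ : Tight Pr Z) :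
    Tight Pr fun b ω => Z b ω ^ 2 := by
  simpa only [pow_two] using hZ.mul hZ

theorem Tight.of_sq {Z : ℕ → Ω → ℝ} (hZ : Tight Pr fun b ω => Z b ω ^ 2) : Tight Pr Z := by
  intro δ hδ
  obtain ⟨M, hM0, hM⟩ := hZ δ hδ
  -- `M ≤ (M + 1)²`, so `M + 1` bounds `|Z|` without taking a square root.
  refine ⟨M + 1, by positivity, ?_⟩
  filter_upwards [hM] with b hb
  refine le_trans (measure_mono ?_) hb
  intro ω hω h
  refine hω ?_
  rw [abs_of_nonneg (sq_nonneg _)] at h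
  refine abs_le_of_sq_le_sq (h.trans ?_) (by positivity)
  nlinarith

/-- Bridge from the order calculus to the convergence mode used in the statement and in the
Slutsky-type results. -/
theorem negligible_iff_tendstoInMeasure {Z : ℕ → Ω → ℝ} {z : ℝ} :
    (Negligible Pr fun b ω => Z b ω - z) ↔ TendstoInMeasure Pr Z atTop fun _ => z := by
  rw [tendstoInMeasure_iff_norm]
  simp only [Negligible, HighProb, not_lt, Real.norm_eq_abs]

theorem IsLittleOP.negligible_toReal {Z : ℕ → Ω → ℝ≥0∞} (h : IsLittleOP Pr Z fun _ => 1) :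
    Negligible Pr fun b ω => (Z b ω).toReal := by
  intro ε hε
  refine tendsto_of_tendsto_of_tendsto_of_le_of_le tendsto_const_nhds (h ε hε)
    (fun _ => zero_le) fun b => measure_mono fun ω hω => ?_
  simp only [Set.mem_ofPred_eq, not_lt, abs_of_nonneg ENNReal.toReal_nonneg, mul_one] at hω ⊢
  exact (ENNReal.ofReal_le_ofReal hω).trans ENNReal.ofReal_toReal_le

theorem IsLittleOP.highProb_lt {Z : ℕ → Ω → ℝ≥0∞} (h : IsLittleOP Pr Z fun _ => 1)
    {ε : ℝ} (hε : 0 < ε) : HighProb Pr fun b ω => Z b ω < ENNReal.ofReal ε := by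
  simpa [HighProb, IsLittleOP] using h ε hε

theorem IsLittleOP.of_highProb {Z : ℕ → Ω → ℝ≥0∞}
    (h : ∀ ε : ℝ, 0 < ε → HighProb Pr fun b ω => Z b ω < ENNReal.ofReal ε) :
    IsLittleOP Pr Z fun _ => 1 := by
  simpa [HighProb, IsLittleOP] using h

/-- The `L²` distances may be infinite, and `ENNReal.toReal` would turn `∞` into `0`. Real-valued
bounds are valid on this event. -/
theorem IsLittleOP.highProb_ne_top {Z : ℕ → Ω → ℝ≥0∞} (h : IsLittleOP Pr Z fun _ => 1) :
    HighProb Pr fun b ω => Z b ω ≠ ∞ :=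
  (h.highProb_lt one_pos).mono (Eventually.of_forall fun _ _ hb => (hb.trans ENNReal.ofReal_lt_top).ne)

end StochasticOrder

/-! ### Cross-fitted empirical means -/

section ConditionalMarkov

variable {Ω α β : Type*} [MeasurableSpace Ω] [MeasurableSpace α] [MeasurableSpace β]
  {Pr : Measure Ω} [IsProbabilityMeasure Pr]

/-- Markov's inequality conditionally on `A`, for independent `A` and `B`. -/
theorem measure_le_add_of_indepFun {A : Ω → α} {B : Ω → β} (hA : Measurable A) (hB : Measurable B)
    (hAB : IndepFun A B Pr) {F : α → β → ℝ≥0∞} (hF : Measurable (Function.uncurry F))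
    {ε δ : ℝ≥0∞} (hε : ε ≠ 0) (hε' : ε ≠ ∞) :
    Pr {ω | ε ≤ F (A ω) (B ω)} ≤ δ + Pr {ω | δ * ε ≤ ∫⁻ ω', F (A ω) (B ω') ∂Pr} := by
  have : IsProbabilityMeasure (Pr.map B) := Measure.isProbabilityMeasure_map hB.aemeasurable
  have : IsProbabilityMeasure (Pr.map A) := Measure.isProbabilityMeasure_map hA.aemeasurable
  have hmap := (indepFun_iff_map_prod_eq_prod_map_map hA.aemeasurable hB.aemeasurable).1 hAB
  have hset : MeasurableSet {q : α × β | ε ≤ Function.uncurry F q} :=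
    measurableSet_le measurable_const hF
  have hGm : Measurable fun a => ∫⁻ y, F a y ∂(Pr.map B) := hF.lintegral_prod_right'
  have hG : ∀ a, ∫⁻ ω', F a (B ω') ∂Pr = ∫⁻ y, F a y ∂(Pr.map B) := fun a =>
    (lintegral_map (hF.of_uncurry_left) hB).symm
  have hset2 : MeasurableSet {a : α | δ * ε ≤ ∫⁻ y, F a y ∂(Pr.map B)} :=
    measurableSet_le measurable_const hGm
  have h1 : Pr {ω | ε ≤ F (A ω) (B ω)}
      = ∫⁻ a, (Pr.map B) {y | ε ≤ F a y} ∂(Pr.map A) := by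
    rw [show {ω | ε ≤ F (A ω) (B ω)}
        = (fun ω => (A ω, B ω)) ⁻¹' {q : α × β | ε ≤ Function.uncurry F q} from rfl,
      ← Measure.map_apply (hA.prodMk hB) hset, hmap, Measure.prod_apply hset]
    rfl
  have h2 : Pr {ω | δ * ε ≤ ∫⁻ ω', F (A ω) (B ω') ∂Pr}
      = (Pr.map A) {a | δ * ε ≤ ∫⁻ y, F a y ∂(Pr.map B)} := by
    rw [Measure.map_apply hA hset2]
    simp only [hG]
    rfl
  rw [h1, h2]
  -- `T` collects the values of `A` with a large conditional mean. On `T` the conditional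
  -- probability is bounded by one, off `T` Markov's inequality bounds it by `δ`.
  set T : Set α := {a | δ * ε ≤ ∫⁻ y, F a y ∂(Pr.map B)} with hT
  calc ∫⁻ a, (Pr.map B) {y | ε ≤ F a y} ∂(Pr.map A)
      ≤ ∫⁻ a, (δ + T.indicator 1 a) ∂(Pr.map A) := by
        refine lintegral_mono fun a => ?_
        by_cases ha : a ∈ T
        · rw [Set.indicator_of_mem ha]
          exact prob_le_one.trans (by simp)
        · rw [Set.indicator_of_notMem ha, add_zero]
          have := mul_meas_ge_le_lintegral (μ := Pr.map B) (hF.of_uncurry_left (x := a)) ε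
          have h3 := this.trans (not_le.1 (by simpa [hT] using ha)).le
          rw [mul_comm] at h3
          exact (ENNReal.mul_le_mul_iff_left hε hε').1 h3
    _ = δ + (Pr.map A) T := by
        rw [lintegral_add_left measurable_const, lintegral_const, measure_univ, mul_one,
          lintegral_indicator_one hset2]

end ConditionalMarkov

section SecondMoment

variable {α : Type*} [MeasurableSpace α] {μ : Measure α} {f : α → ℝ}

theorem enorm_sq_eq_ofReal_sq (x : ℝ) : ‖x‖ₑ ^ 2 = ENNReal.ofReal (x ^ 2) := by
  rw [← sq_abs, ENNReal.ofReal_pow (abs_nonneg _), Real.enorm_eq_ofReal_abs]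

theorem eLpNorm_two_sq (f : α → ℝ) (μ : Measure α) :
    eLpNorm f 2 μ ^ 2 = ∫⁻ x, ‖f x‖ₑ ^ 2 ∂μ := by
  have h := eLpNorm_nnreal_pow_eq_lintegral (f := f) (μ := μ) (p := 2) (by norm_num)
  simpa using h

theorem memLp_two_iff_lintegral (hf : AEStronglyMeasurable f μ) :
    MemLp f 2 μ ↔ ∫⁻ x, ‖f x‖ₑ ^ 2 ∂μ ≠ ∞ := by
  rw [← eLpNorm_two_sq, MemLp, and_iff_right hf, lt_top_iff_ne_top, ne_eq, ne_eq,
    ENNReal.pow_eq_top_iff]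
  simp

end SecondMoment

/-! ### Algebra of fold means. -/

section FoldMean

variable {𝒳 : Type*} {K b : ℕ} (fold : Fin (K * b) → Fin K) (o : Fin (K * b) → Obs 𝒳) (k : Fin K)

theorem foldMean_add (f h : Obs 𝒳 → ℝ) :
    foldMean fold o k (fun x => f x + h x) = foldMean fold o k f + foldMean fold o k h := by
  simp only [foldMean, Finset.sum_add_distrib, mul_add]

theorem foldMean_sub (f h : Obs 𝒳 → ℝ) :
    foldMean fold o k (fun x => f x - h x) = foldMean fold o k f - foldMean fold o k h := by
  simp only [foldMean, Finset.sum_sub_distrib, mul_sub]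

theorem foldMean_const_mul (x : ℝ) (f : Obs 𝒳 → ℝ) :
    foldMean fold o k (fun y => x * f y) = x * foldMean fold o k f := by
  simp only [foldMean, ← Finset.mul_sum]
  ring

theorem foldMean_nonneg {f : Obs 𝒳 → ℝ} (hf : ∀ x, 0 ≤ f x) : 0 ≤ foldMean fold o k f :=
  mul_nonneg (by positivity) (Finset.sum_nonneg fun _ _ => hf _)

theorem foldMean_mono {f h : Obs 𝒳 → ℝ} (hfh : ∀ x, f x ≤ h x) :
    foldMean fold o k f ≤ foldMean fold o k h :=
  mul_le_mul_of_nonneg_left (Finset.sum_le_sum fun _ _ => hfh _) (by positivity)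

theorem foldMean_mul_sq_le (f h : Obs 𝒳 → ℝ) :
    foldMean fold o k (fun x => f x * h x) ^ 2
      ≤ foldMean fold o k (fun x => f x ^ 2) * foldMean fold o k (fun x => h x ^ 2) := by
  simp only [foldMean, mul_pow]
  have := Finset.sum_mul_sq_le_sq_mul_sq (Finset.univ.filter fun i => fold i = k)
    (fun i => f (o i)) (fun i => h (o i))
  calc _ ≤ ((b : ℝ)⁻¹) ^ 2 * _ := mul_le_mul_of_nonneg_left this (by positivity)
    _ = _ := by ring

theorem foldMean_sq_le (hcard : (Finset.univ.filter fun i => fold i = k).card = b)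
    (f : Obs 𝒳 → ℝ) :
    foldMean fold o k f ^ 2 ≤ foldMean fold o k (fun x => f x ^ 2) := by
  have h := foldMean_mul_sq_le fold o k (fun _ => 1) f
  simp only [one_mul, one_pow] at h
  refine h.trans ?_
  -- Only an inequality: for `b = 0` the mean of the constant one is zero.
  have hone : foldMean fold o k (fun _ => 1) ≤ 1 := by
    simp only [foldMean, Finset.sum_const, hcard, nsmul_eq_mul, mul_one]
    exact inv_mul_le_one
  calc _ ≤ 1 * foldMean fold o k (fun x => f x ^ 2) :=
        mul_le_mul_of_nonneg_right hone (foldMean_nonneg _ _ _ fun _ => sq_nonneg _)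
    _ = _ := one_mul _

theorem crossMean_add (f h : Fin K → Obs 𝒳 → ℝ) :
    crossMean fold o (fun k x => f k x + h k x) = crossMean fold o f + crossMean fold o h := by
  simp only [crossMean, foldMean_add, Finset.sum_add_distrib, mul_add]

theorem crossMean_const_mul (x : ℝ) (f : Fin K → Obs 𝒳 → ℝ) :
    crossMean fold o (fun k y => x * f k y) = x * crossMean fold o f := by
  simp only [crossMean, foldMean_const_mul, ← Finset.mul_sum]
  ring

/-- Every observation lies in exactly one fold and all folds carry the weight `1/b`. For a function
common to all folds the partition therefore disappears, which opens the way to the limit theorems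
for the whole sample. -/
theorem crossMean_fixed (f : Obs 𝒳 → ℝ) :
    crossMean fold o (fun _ => f) = (K : ℝ)⁻¹ * (b : ℝ)⁻¹ * ∑ i, f (o i) := by
  simp only [crossMean, foldMean, ← Finset.mul_sum]
  rw [← mul_assoc, Finset.sum_fiberwise]

end FoldMean

/-! ### Empirical means of functions learned outside the fold. -/

section Design

variable {𝒳 Ω : Type*} [MeasurableSpace 𝒳] [MeasurableSpace Ω]

/-- An i.i.d. sequence of observations with law `P`, partitioned into `K` folds of size `b`. -/
structure FoldedSample (P : Measure (Obs 𝒳)) (Pr : Measure Ω) (O : ℕ → Ω → Obs 𝒳) (K : ℕ)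
    (fold : (b : ℕ) → Fin (K * b) → Fin K) : Prop where
  meas : ∀ i, Measurable (O i)
  law : ∀ i, Pr.map (O i) = P
  indep : iIndepFun O Pr
  card : ∀ b k, (Finset.univ.filter fun i => fold b i = k).card = b

/-- The observations outside fold `k`. -/
def train {K b : ℕ} (fold : Fin (K * b) → Fin K) (O : ℕ → Ω → Obs 𝒳) (k : Fin K) (ω : Ω) :
    {i : Fin (K * b) // fold i ≠ k} → Obs 𝒳 :=
  fun i => O i.1 ω

variable {P : Measure (Obs 𝒳)} {Pr : Measure Ω}
  {O : ℕ → Ω → Obs 𝒳} {K : ℕ} {fold : (b : ℕ) → Fin (K * b) → Fin K}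

theorem FoldedSample.measurable_train (hS : FoldedSample P Pr O K fold) (b : ℕ) (k : Fin K) :
    Measurable (train (fold b) O k) :=
  measurable_pi_lambda _ fun _ => hS.meas _

/-- Disjoint blocks of an independent family are independent; the final `comp` only changes the
index types. -/
theorem FoldedSample.indepFun_train (hS : FoldedSample P Pr O K fold) (b : ℕ) (k : Fin K) :
    IndepFun (train (fold b) O k)
      (fun ω (i : {i : Fin (K * b) // fold b i = k}) => O i.1 ω) Pr := by
  classical
  have hprec : iIndepFun (fun (i : Fin (K * b)) => O i) Pr := hS.indep.precomp Fin.val_injective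
  have h := hprec.indepFun_finset (Finset.univ.filter fun i => fold b i ≠ k)
    (Finset.univ.filter fun i => fold b i = k)
    (Finset.disjoint_left.2 fun i hi hi' => (Finset.mem_filter.1 hi).2 (Finset.mem_filter.1 hi').2)
    (fun i => hS.meas i)
  exact h.comp
    (φ := fun y (i : {i : Fin (K * b) // fold b i ≠ k}) => y ⟨i.1, by simpa using i.2⟩)
    (ψ := fun y (i : {i : Fin (K * b) // fold b i = k}) => y ⟨i.1, by simpa using i.2⟩)
    (measurable_pi_lambda _ fun _ => measurable_pi_apply _)
    (measurable_pi_lambda _ fun _ => measurable_pi_apply _)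

theorem FoldedSample.measurePreserving (hS : FoldedSample P Pr O K fold) (i : ℕ) :
    MeasurePreserving (O i) Pr P := ⟨hS.meas i, hS.law i⟩

theorem FoldedSample.lintegral_foldMean_sq_le (hS : FoldedSample P Pr O K fold) (b : ℕ)
    (k : Fin K) {f : Obs 𝒳 → ℝ} (hf : Measurable f) :
    ∫⁻ ω, ENNReal.ofReal (foldMean (fold b) (sample K b O ω) k fun o => f o ^ 2) ∂Pr
      ≤ ∫⁻ o, ‖f o‖ₑ ^ 2 ∂P := by
  have hlaw : ∀ i : ℕ, ∫⁻ ω, ENNReal.ofReal (f (O i ω) ^ 2) ∂Pr = ∫⁻ o, ‖f o‖ₑ ^ 2 ∂P := fun i => by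
    simp only [enorm_sq_eq_ofReal_sq]
    exact (hS.measurePreserving i).lintegral_comp (f := fun o => ENNReal.ofReal (f o ^ 2))
      (by fun_prop)
  simp only [foldMean, sample]
  have hm : ∀ i : ℕ, Measurable fun ω => ENNReal.ofReal (f (O i ω) ^ 2) := fun i =>
    ((hf.comp (hS.meas i)).pow_const 2).ennreal_ofReal
  simp only [ENNReal.ofReal_mul (show (0 : ℝ) ≤ (b : ℝ)⁻¹ by positivity),
    ENNReal.ofReal_sum_of_nonneg fun i (_ : i ∈ _) => sq_nonneg (f (O _ _))]
  rw [lintegral_const_mul _ (Finset.measurable_fun_sum _ fun i _ => hm _),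
    lintegral_finsetSum _ fun i _ => hm _]
  simp only [hlaw, Finset.sum_const, hS.card, nsmul_eq_mul]
  rw [← mul_assoc]
  refine mul_le_of_le_one_left zero_le ?_
  rw [← ENNReal.ofReal_natCast, ← ENNReal.ofReal_mul (by positivity)]
  exact ENNReal.ofReal_le_one.2 inv_mul_le_one

variable [IsProbabilityMeasure P] [IsProbabilityMeasure Pr]

/-- The variance of a sum of `b` independent copies is `b` times one variance, which is at most the
second moment. The right side may be infinite, so the bound applies to every realisation of a
learned function. -/
theorem FoldedSample.lintegral_fluctuation_le (hS : FoldedSample P Pr O K fold) (b : ℕ)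
    (k : Fin K) {f : Obs 𝒳 → ℝ} (hf : Measurable f) :
    ∫⁻ ω, ENNReal.ofReal ((√b * (foldMean (fold b) (sample K b O ω) k f - ∫ o, f o ∂P)) ^ 2) ∂Pr
      ≤ ∫⁻ o, ‖f o‖ₑ ^ 2 ∂P := by
  rcases Nat.eq_zero_or_pos b with rfl | hb
  · simp
  rcases eq_or_ne (∫⁻ o, ‖f o‖ₑ ^ 2 ∂P) ∞ with htop | hfin
  · rw [htop]; exact le_top
  have hL2 : MemLp f 2 P := (memLp_two_iff_lintegral hf.aestronglyMeasurable).2 hfin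
  have hbR : (0 : ℝ) < b := by exact_mod_cast hb
  set S := Finset.univ.filter fun i => fold b i = k with hSdef
  set Z : Fin (K * b) → Ω → ℝ := fun i ω => f (O i ω) with hZ
  have hZL2 : ∀ i, MemLp (Z i) 2 Pr := fun i => hL2.comp_measurePreserving (hS.measurePreserving i)
  have hvar : Var[∑ i ∈ S, Z i; Pr] = b * Var[f; P] := by
    rw [IndepFun.variance_sum (fun i _ => hZL2 i)]
    · have : ∀ i ∈ S, Var[Z i; Pr] = Var[f; P] := fun i _ => by
        have h := variance_map (X := f) (Y := O i) (μ := Pr)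
          (by rw [hS.law]; exact hf.aemeasurable) (hS.meas i).aemeasurable
        rw [hS.law] at h
        exact h.symm
      rw [Finset.sum_congr rfl this, Finset.sum_const, hSdef, hS.card, nsmul_eq_mul]
    · intro i _ j _ hij
      exact (hS.indep.indepFun (fun h => hij (Fin.ext h))).comp hf hf
  have hmean : ∫ ω, (∑ i ∈ S, Z i) ω ∂Pr = b * ∫ o, f o ∂P := by
    simp only [Finset.sum_apply]
    rw [integral_finsetSum _ fun i _ => (hZL2 i).integrable (by norm_num)]
    have : ∀ i ∈ S, ∫ ω, Z i ω ∂Pr = ∫ o, f o ∂P := fun i _ => by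
      have h := integral_map (μ := Pr) (φ := O i) (hS.meas i).aemeasurable (f := f)
        hf.aestronglyMeasurable
      rw [hS.law] at h
      exact h.symm
    rw [Finset.sum_congr rfl this, Finset.sum_const, hSdef, hS.card, nsmul_eq_mul]
  have hsumL2 : MemLp (∑ i ∈ S, Z i) 2 Pr := memLp_finsetSum' _ fun i _ => hZL2 i
  have hpt : ∀ ω, (√b * (foldMean (fold b) (sample K b O ω) k f - ∫ o, f o ∂P)) ^ 2
      = (b : ℝ)⁻¹ * ((∑ i ∈ S, Z i) ω - ∫ ω, (∑ i ∈ S, Z i) ω ∂Pr) ^ 2 := fun ω => by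
    rw [hmean, mul_pow, Real.sq_sqrt hbR.le]
    simp only [foldMean, Finset.sum_apply, hZ, sample, hSdef]
    field_simp
  simp only [hpt, ENNReal.ofReal_mul (show (0 : ℝ) ≤ (b : ℝ)⁻¹ by positivity)]
  rw [lintegral_const_mul' _ _ ENNReal.ofReal_ne_top, ← evariance_eq_lintegral_ofReal,
    ← hsumL2.ofReal_variance_eq, ← ENNReal.ofReal_mul (by positivity), hvar, ← mul_assoc,
    inv_mul_cancel₀ hbR.ne', one_mul]
  refine (ENNReal.ofReal_le_ofReal (variance_le_expectation_sq hf.aestronglyMeasurable)).trans ?_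
  simp only [Pi.pow_apply, enorm_sq_eq_ofReal_sq]
  exact (ofReal_integral_eq_lintegral_ofReal hL2.integrable_sq
    (Eventually.of_forall fun o => sq_nonneg _)).le

/-- Conditional Markov inequality for statistics of the training data and of fold `k`. -/
theorem FoldedSample.negligible_of_lintegral (hS : FoldedSample P Pr O K fold) (k : Fin K)
    {F : (b : ℕ) → ({i : Fin (K * b) // fold b i ≠ k} → Obs 𝒳) →
      ({i : Fin (K * b) // fold b i = k} → Obs 𝒳) → ℝ}
    (hF : ∀ b, Measurable (Function.uncurry (F b)))
    (hsmall : IsLittleOP Pr (fun b ω => ∫⁻ ω', ENNReal.ofReal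
      (F b (train (fold b) O k ω) (fun i => O i.1 ω')) ∂Pr) fun _ => 1)
    (hnn : ∀ b x y, 0 ≤ F b x y) :
    Negligible Pr fun b ω => F b (train (fold b) O k ω) (fun i => O i.1 ω) := by
  intro ε hε
  refine ENNReal.tendsto_nhds_zero.2 fun δ hδ => ?_
  obtain ⟨δ', hδ'0, hδ'⟩ : ∃ δ' : ℝ, 0 < δ' ∧ ENNReal.ofReal δ' ≤ δ / 2 := by
    rcases eq_or_ne δ ∞ with rfl | hfin
    · exact ⟨1, one_pos, by simp [ENNReal.top_div_of_ne_top]⟩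
    · exact ⟨(δ / 2).toReal, ENNReal.toReal_pos (ENNReal.half_pos hδ.ne').ne'
        (ENNReal.div_ne_top hfin two_ne_zero), ENNReal.ofReal_toReal_le⟩
  filter_upwards [ENNReal.tendsto_nhds_zero.1 (hsmall (δ' * ε) (by positivity)) _
    (ENNReal.half_pos hδ.ne')] with b hb
  have h := measure_le_add_of_indepFun (hS.measurable_train b k)
    (measurable_pi_lambda _ fun i : {i : Fin (K * b) // fold b i = k} => hS.meas i.1)
    (hS.indepFun_train b k) (F := fun x y => ENNReal.ofReal (F b x y)) (hF b).ennreal_ofReal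
    (ε := ENNReal.ofReal ε) (δ := ENNReal.ofReal δ') (by simpa using hε) ENNReal.ofReal_ne_top
  refine le_trans (measure_mono ?_) (h.trans ((add_le_add hδ' ?_).trans (ENNReal.add_halves δ).le))
  · intro ω hω
    simp only [Set.mem_ofPred_eq, not_lt, abs_of_nonneg (hnn _ _ _)] at hω ⊢
    exact ENNReal.ofReal_le_ofReal hω
  · simpa only [mul_one, ENNReal.ofReal_mul hδ'0.le] using hb

/-- Displays the fold mean as a function of the observations of fold `k` alone, the form in which
independence from the training data can be used. -/
theorem foldMean_eq_sum_subtype {K b : ℕ} (fold : Fin (K * b) → Fin K) (k : Fin K)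
    (O : ℕ → Ω → Obs 𝒳) (ω : Ω) (f : Obs 𝒳 → ℝ) :
    foldMean fold (sample K b O ω) k f
      = (b : ℝ)⁻¹ * ∑ i : {i : Fin (K * b) // fold i = k}, f (O i.1 ω) := by
  rw [foldMean, Finset.sum_subtype (p := fun i => fold i = k)
    (Finset.univ.filter fun i => fold i = k) (by simp) fun i => f (sample K b O ω i)]
  rfl

section Learned

variable {k : Fin K} {h : (b : ℕ) → ({i : Fin (K * b) // fold b i ≠ k} → Obs 𝒳) → Obs 𝒳 → ℝ}

/-- A cross-fitted function with vanishing second moment has negligible scaled fluctuations. -/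
theorem FoldedSample.negligible_fluctuation (hS : FoldedSample P Pr O K fold)
    (hm : ∀ b, Measurable (Function.uncurry (h b)))
    (hsmall : IsLittleOP Pr (fun b ω => ∫⁻ o, ‖h b (train (fold b) O k ω) o‖ₑ ^ 2 ∂P)
      fun _ => 1) :
    Negligible Pr fun b ω => √b * (foldMean (fold b) (sample K b O ω) k
      (h b (train (fold b) O k ω)) - ∫ o, h b (train (fold b) O k ω) o ∂P) := by
  refine Negligible.of_sq ?_
  have key := hS.negligible_of_lintegral k
    (F := fun b x y => (√b * ((b : ℝ)⁻¹ * ∑ i, h b x (y i) - ∫ o, h b x o ∂P)) ^ 2)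
    (fun b => ?_) ?_ fun _ _ _ => sq_nonneg _
  · exact key.congr (HighProb.of_forall fun b ω => by rw [foldMean_eq_sum_subtype])
  · refine Measurable.pow_const (Measurable.const_mul (Measurable.sub (Measurable.const_mul
      (Finset.measurable_fun_sum _ fun i _ => ?_) _) ?_) _) 2
    · exact (hm b).comp (measurable_fst.prodMk ((measurable_pi_apply i).comp measurable_snd))
    · exact ((hm b).stronglyMeasurable.integral_prod_right (f := h b)).measurable.comp
        measurable_fst
  · intro ε hε
    refine tendsto_of_tendsto_of_tendsto_of_le_of_le tendsto_const_nhds (hsmall ε hε)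
      (fun _ => zero_le) fun b => measure_mono fun ω hω => ?_
    refine (Set.mem_ofPred_eq ▸ hω :).trans ?_
    -- The training data are frozen at `ω` and only the fold is integrated over `ω'`, so the
    -- variance bound for a fixed function applies.
    refine le_trans (le_of_eq ?_)
      (hS.lintegral_fluctuation_le b k ((hm b).of_uncurry_left (x := train (fold b) O k ω)))
    simp only [foldMean_eq_sum_subtype]

/-- A cross-fitted function with vanishing second moment is small in empirical `L²`. -/
theorem FoldedSample.negligible_foldMean_sq (hS : FoldedSample P Pr O K fold)
    (hm : ∀ b, Measurable (Function.uncurry (h b)))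
    (hsmall : IsLittleOP Pr (fun b ω => ∫⁻ o, ‖h b (train (fold b) O k ω) o‖ₑ ^ 2 ∂P)
      fun _ => 1) :
    Negligible Pr fun b ω => foldMean (fold b) (sample K b O ω) k
      fun o => h b (train (fold b) O k ω) o ^ 2 := by
  have key := hS.negligible_of_lintegral k
    (F := fun b x y => (b : ℝ)⁻¹ * ∑ i, h b x (y i) ^ 2)
    (fun b => ?_) ?_ fun _ _ _ => mul_nonneg (by positivity)
      (Finset.sum_nonneg fun _ _ => sq_nonneg _)
  · exact key.congr (HighProb.of_forall fun b ω => by rw [foldMean_eq_sum_subtype])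
  · refine Measurable.const_mul (Finset.measurable_fun_sum _ fun i _ => Measurable.pow_const ?_ 2) _
    exact (hm b).comp (measurable_fst.prodMk ((measurable_pi_apply i).comp measurable_snd))
  · intro ε hε
    refine tendsto_of_tendsto_of_tendsto_of_le_of_le tendsto_const_nhds (hsmall ε hε)
      (fun _ => zero_le) fun b => measure_mono fun ω hω => ?_
    refine (Set.mem_ofPred_eq ▸ hω :).trans ?_
    refine le_trans (le_of_eq ?_)
      (hS.lintegral_foldMean_sq_le b k ((hm b).of_uncurry_left (x := train (fold b) O k ω)))
    simp only [foldMean_eq_sum_subtype]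

end Learned

/-- Markov's inequality. -/
theorem tight_of_lintegral_le {Z : ℕ → Ω → ℝ} (hZ : ∀ b, Measurable (Z b)) {C : ℝ≥0∞}
    (hC : C ≠ ∞) (h : ∀ b, ∫⁻ ω, ENNReal.ofReal (Z b ω) ∂Pr ≤ C) (hnn : ∀ b ω, 0 ≤ Z b ω) :
    Tight Pr Z := by
  intro δ hδ
  rcases eq_or_ne δ ∞ with rfl | hδtop
  · exact ⟨1, one_pos, by simp⟩
  -- Markov's inequality requires `M ≥ C/δ`; the added one keeps `M` positive when `C = 0`.
  have hM : 0 < C.toReal / δ.toReal + 1 := by positivity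
  refine ⟨_, hM, Eventually.of_forall fun b => ?_⟩
  have hmk := mul_meas_ge_le_lintegral (μ := Pr) (hZ b).ennreal_ofReal
    (ENNReal.ofReal (C.toReal / δ.toReal + 1))
  have hδ0 : 0 < δ.toReal := ENNReal.toReal_pos hδ.ne' hδtop
  have hsub : Pr {ω | ¬ |Z b ω| ≤ C.toReal / δ.toReal + 1}
      ≤ Pr {ω | ENNReal.ofReal (C.toReal / δ.toReal + 1) ≤ ENNReal.ofReal (Z b ω)} := by
    refine measure_mono fun ω hω => ?_
    simp only [Set.mem_ofPred_eq, not_le, abs_of_nonneg (hnn _ _)] at hω ⊢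
    exact ENNReal.ofReal_le_ofReal hω.le
  refine hsub.trans ?_
  have h1 := hmk.trans (h b)
  have h2 : C ≤ ENNReal.ofReal (C.toReal / δ.toReal + 1) * δ := by
    conv_lhs => rw [← ENNReal.ofReal_toReal hC]
    conv_rhs => rw [← ENNReal.ofReal_toReal hδtop, ← ENNReal.ofReal_mul (by positivity)]
    refine ENNReal.ofReal_le_ofReal ?_
    simp only [ENNReal.ofReal_toReal hδtop]
    rw [add_mul, div_mul_cancel₀ _ hδ0.ne']
    linarith
  exact (ENNReal.mul_le_mul_iff_right (by simpa using hM) ENNReal.ofReal_ne_top).1 (h1.trans h2)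

section Fixed

variable {f : Obs 𝒳 → ℝ} (k : Fin K)

theorem FoldedSample.measurable_foldMean (hS : FoldedSample P Pr O K fold) (hf : Measurable f)
    (b : ℕ) : Measurable fun ω => foldMean (fold b) (sample K b O ω) k f := by
  unfold foldMean
  refine Measurable.const_mul (Finset.measurable_fun_sum _ fun i _ => ?_) _
  exact hf.comp (hS.meas i)

theorem FoldedSample.tight_fluctuation (hS : FoldedSample P Pr O K fold) (hf : Measurable f)
    (hL2 : MemLp f 2 P) :
    Tight Pr fun b ω => √b * (foldMean (fold b) (sample K b O ω) k f - ∫ o, f o ∂P) := by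
  refine Tight.of_sq (tight_of_lintegral_le (fun b => ?_)
    ((memLp_two_iff_lintegral hL2.1).1 hL2) (fun b => hS.lintegral_fluctuation_le b k hf)
    fun _ _ => sq_nonneg _)
  have := hS.measurable_foldMean k hf b
  fun_prop

theorem FoldedSample.negligible_foldMean_sub (hS : FoldedSample P Pr O K fold) (hf : Measurable f)
    (hL2 : MemLp f 2 P) :
    Negligible Pr fun b ω => foldMean (fold b) (sample K b O ω) k f - ∫ o, f o ∂P := by
  have hrate : Tendsto (fun b : ℕ => (√(b : ℝ))⁻¹) atTop (𝓝 0) :=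
    (Real.tendsto_sqrt_atTop.comp tendsto_natCast_atTop_atTop).inv_tendsto_atTop
  refine ((Negligible.of_tendsto (Pr := Pr) hrate).mul_tight (hS.tight_fluctuation k hf hL2)).congr
    (HighProb.of_eventually ?_)
  filter_upwards [eventually_gt_atTop 0] with b hb ω
  rw [inv_mul_cancel_left₀ (by positivity)]

theorem FoldedSample.tight_foldMean_sq (hS : FoldedSample P Pr O K fold) (hf : Measurable f)
    (hL2 : MemLp f 2 P) :
    Tight Pr fun b ω => foldMean (fold b) (sample K b O ω) k fun o => f o ^ 2 :=
  tight_of_lintegral_le (hS.measurable_foldMean k (hf.pow_const 2))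
    ((memLp_two_iff_lintegral hL2.1).1 hL2) (fun b => hS.lintegral_foldMean_sq_le b k hf)
    fun _ _ => foldMean_nonneg _ _ _ fun _ => sq_nonneg _

end Fixed

end Design

/-! ### Population identities -/

section Indicators

variable {𝒳 : Type*}

theorem ind_of_mem {A : Set (Obs 𝒳)} {o : Obs 𝒳} (h : o ∈ A) : ind A o = 1 := by
  simp [ind, h]

theorem ind_of_notMem {A : Set (Obs 𝒳)} {o : Obs 𝒳} (h : o ∉ A) : ind A o = 0 := by
  simp [ind, h]

theorem ind_mul_ind (A B : Set (Obs 𝒳)) (o : Obs 𝒳) : ind A o * ind B o = ind (A ∩ B) o := by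
  classical
  simp only [ind, Set.indicator, Set.mem_inter_iff]
  split_ifs <;> simp_all

theorem ind_mul (A : Set (Obs 𝒳)) (f : Obs 𝒳 → ℝ) :
    (fun o => ind A o * f o) = A.indicator f := by
  ext o
  by_cases h : o ∈ A <;> simp [ind, h]

theorem abs_ind_le_one (A : Set (Obs 𝒳)) (o : Obs 𝒳) : |ind A o| ≤ 1 := by
  by_cases h : o ∈ A <;> simp [ind, h]

theorem disjoint_exposed_control (g : ControlGroup) (e t : ℕ) :
    Disjoint (exposed (𝒳 := 𝒳) e) (control g e t) := by
  refine Set.disjoint_left.2 fun o ho hc => ?_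
  cases g with
  | neverExposed =>
    simp only [exposed, control, Set.mem_ofPred_eq] at ho hc
    rw [hc] at ho
    exact ENat.top_ne_natCast e ho
  | notYetExposed => exact hc.1 ho

variable [MeasurableSpace 𝒳]

/-- The cohorts belonging to the control group. -/
def controlCohorts (g : ControlGroup) (e t : ℕ) : Set ℕ∞ :=
  match g with
  | .neverExposed => {⊤}
  | .notYetExposed => {x | x ≠ (e : ℕ∞) ∧ (t : ℕ∞) < x}

/-- Both kinds of control group depend on the cohort only, hence are covered by the independence of
`T` and `(E, X)`. -/
theorem control_eq_preimage (g : ControlGroup) (e t : ℕ) :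
    control (𝒳 := 𝒳) g e t = obsE ⁻¹' controlCohorts g e t := by
  cases g <;> rfl

theorem exposed_eq_preimage (e : ℕ) : exposed (𝒳 := 𝒳) e = obsE ⁻¹' {(e : ℕ∞)} := rfl

theorem measurable_obsY : Measurable (obsY (𝒳 := 𝒳)) := measurable_fst
theorem measurable_obsD : Measurable (obsD (𝒳 := 𝒳)) := measurable_snd.fst
theorem measurable_obsE : Measurable (obsE (𝒳 := 𝒳)) := measurable_snd.snd.fst
theorem measurable_obsT : Measurable (obsT (𝒳 := 𝒳)) := measurable_snd.snd.snd.fst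
theorem measurable_obsX : Measurable (obsX (𝒳 := 𝒳)) := measurable_snd.snd.snd.snd

theorem measurableSet_cohorts (A : Set ℕ∞) : MeasurableSet (obsE (𝒳 := 𝒳) ⁻¹' A) :=
  measurable_obsE (MeasurableSet.of_discrete)

theorem measurableSet_exposed (e : ℕ) : MeasurableSet (exposed (𝒳 := 𝒳) e) := by
  rw [exposed_eq_preimage]; exact measurableSet_cohorts _

theorem measurableSet_control (g : ControlGroup) (e t : ℕ) :
    MeasurableSet (control (𝒳 := 𝒳) g e t) := by
  rw [control_eq_preimage]; exact measurableSet_cohorts _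

theorem measurableSet_slice (g : ControlGroup) (e t : ℕ) :
    MeasurableSet (slice (𝒳 := 𝒳) g e t) :=
  (measurableSet_exposed e).union (measurableSet_control g e t)

theorem measurableSet_period (s : ℕ) : MeasurableSet (period (𝒳 := 𝒳) s) :=
  measurable_obsT (MeasurableSet.of_discrete (s := {s}))

theorem measurable_ind {A : Set (Obs 𝒳)} (hA : MeasurableSet A) : Measurable (ind A) :=
  measurable_const.indicator hA

end Indicators

/-! ### Covariate measures of the exposed, the controls and the slice. -/

section CovariateMeasures

variable {𝒳 : Type*} [MeasurableSpace 𝒳] {P : Measure (Obs 𝒳)} [IsProbabilityMeasure P]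

/-- The image of `P` restricted to `A` under the covariates. -/
noncomputable def covMeasure (P : Measure (Obs 𝒳)) (A : Set (Obs 𝒳)) : Measure 𝒳 := (P.restrict A).map obsX

instance (A : Set (Obs 𝒳)) : IsFiniteMeasure (covMeasure P A) := by
  unfold covMeasure; infer_instance

theorem covMeasure_apply {A : Set (Obs 𝒳)} {B : Set 𝒳} (hB : MeasurableSet B) :
    covMeasure P A B = P (obsX ⁻¹' B ∩ A) := by
  rw [covMeasure, Measure.map_apply measurable_obsX hB,
    Measure.restrict_apply (measurable_obsX hB)]

theorem lintegral_covMeasure (A : Set (Obs 𝒳)) {f : 𝒳 → ℝ≥0∞} (hf : Measurable f) :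
    ∫⁻ x, f x ∂(covMeasure P A) = ∫⁻ o in A, f (obsX o) ∂P :=
  lintegral_map hf measurable_obsX

theorem integral_covMeasure {A : Set (Obs 𝒳)} (hA : MeasurableSet A) {f : 𝒳 → ℝ}
    (hf : Measurable f) :
    ∫ o, ind A o * f (obsX o) ∂P = ∫ x, f x ∂(covMeasure P A) := by
  rw [ind_mul, integral_indicator hA, covMeasure,
    integral_map measurable_obsX.aemeasurable hf.aestronglyMeasurable]

theorem ae_covMeasure_iff {A : Set (Obs 𝒳)} {p : 𝒳 → Prop} (hp : MeasurableSet {x | p x}) :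
    (∀ᵐ x ∂(covMeasure P A), p x) ↔ ∀ᵐ o ∂(P.restrict A), p (obsX o) :=
  ae_map_iff measurable_obsX.aemeasurable hp

/-- All uses of the independence of the sampling period go through this identity: restricting a
group defined by cohorts to one period only rescales its covariate measure by `λ_s`. -/
theorem covMeasure_inter_period
    (hT : IndepFun (fun o : Obs 𝒳 => obsT o) (fun o : Obs 𝒳 => (obsE o, obsX o)) P)
    (A : Set ℕ∞) (s : ℕ) :
    covMeasure P (obsE ⁻¹' A ∩ period s) = P (period s) • covMeasure P (obsE ⁻¹' A) := by
  ext B hB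
  rw [Measure.smul_apply, covMeasure_apply hB, covMeasure_apply hB, smul_eq_mul]
  have h := hT.measure_inter_preimage_eq_mul {s} (A ×ˢ B) MeasurableSet.of_discrete
    ((MeasurableSet.of_discrete).prod hB)
  have h1 : (fun o : Obs 𝒳 => obsT o) ⁻¹' {s} = period s := rfl
  have h2 : (fun o : Obs 𝒳 => (obsE o, obsX o)) ⁻¹' (A ×ˢ B) = obsX ⁻¹' B ∩ obsE ⁻¹' A := by
    ext o; simp [and_comm]
  rw [h1, h2] at h
  rw [← h]
  congr 1
  ext o
  simp only [Set.mem_inter_iff]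
  tauto

theorem covMeasure_slice (g : ControlGroup) (e t : ℕ) :
    covMeasure P (slice g e t) = covMeasure P (exposed e) + covMeasure P (control g e t) := by
  rw [covMeasure, slice, Measure.restrict_union (disjoint_exposed_control g e t)
    (measurableSet_control g e t), Measure.map_add _ _ measurable_obsX]
  rfl

theorem covLaw_eq (g : ControlGroup) (e t : ℕ) :
    covLaw P g e t = (P (slice g e t))⁻¹ • covMeasure P (slice g e t) := by
  rw [covLaw, ProbabilityTheory.cond, Measure.map_smul]
  rfl

/-- Conditioning divides by a probability, hence by a number at most one. The norms in the nuisance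
conditions therefore dominate the norms on each group, without constants. -/
theorem covMeasure_slice_le (g : ControlGroup) (e t : ℕ) :
    covMeasure P (slice g e t) ≤ covLaw P g e t := by
  rw [covLaw_eq]
  refine Measure.le_iff.2 fun B _ => ?_
  rw [Measure.smul_apply, smul_eq_mul]
  exact le_mul_of_one_le_left zero_le (ENNReal.one_le_inv.2 prob_le_one)

theorem covMeasure_exposed_le (g : ControlGroup) (e t : ℕ) :
    covMeasure P (exposed e) ≤ covLaw P g e t :=
  le_trans (by rw [covMeasure_slice]; exact Measure.le_add_right le_rfl)
    (covMeasure_slice_le g e t)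

theorem covMeasure_control_le (g : ControlGroup) (e t : ℕ) :
    covMeasure P (control g e t) ≤ covLaw P g e t :=
  le_trans (by rw [covMeasure_slice]; exact Measure.le_add_left le_rfl)
    (covMeasure_slice_le g e t)

end CovariateMeasures

/-! ### Orthogonality of regression residuals. -/

section Regression

variable {𝒳 : Type*} [MeasurableSpace 𝒳] {P : Measure (Obs 𝒳)} [IsProbabilityMeasure P]
  {V : Obs 𝒳 → ℝ} {A : Set (Obs 𝒳)} {m : 𝒳 → ℝ}

theorem memLp_cond {p : ℝ≥0∞} (hA : P A ≠ 0) (hV : MemLp V p (P.restrict A)) :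
    MemLp V p (ProbabilityTheory.cond P A) :=
  hV.smul_measure (ENNReal.inv_ne_top.2 hA)

theorem memLp_of_cond {p : ℝ≥0∞} (hA : P A ≠ 0) (hV : MemLp V p (ProbabilityTheory.cond P A)) :
    MemLp V p (P.restrict A) := by
  have h := hV.smul_measure (c := P A) (measure_ne_top P A)
  rwa [ProbabilityTheory.cond, smul_smul, ENNReal.mul_inv_cancel hA (measure_ne_top P A),
    one_smul] at h

theorem IsRegression.memLp (hm : IsRegression P V A m) (hA : P A ≠ 0) (hV : MemLp V 2 P) :
    MemLp (fun o => m (obsX o)) 2 (P.restrict A) :=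
  memLp_of_cond hA (((memLp_cond hA (hV.restrict A)).condExp one_le_two).ae_eq hm.2.symm)

/-- Regression residuals are orthogonal to functions of the covariates. -/
theorem IsRegression.integral_mul_residual (hm : IsRegression P V A m) (hA : P A ≠ 0)
    (hV : Integrable V P) {h : 𝒳 → ℝ} (hh : Measurable h)
    (hint : Integrable (fun o => h (obsX o) * V o) (P.restrict A)) :
    ∫ o in A, h (obsX o) * (V o - m (obsX o)) ∂P = 0 := by
  set Q := ProbabilityTheory.cond P A with hQ
  have : IsProbabilityMeasure Q := cond_isProbabilityMeasure hA
  have hle := (measurable_obsX (𝒳 := 𝒳)).comap_le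
  have hVQ : Integrable V Q :=
    memLp_one_iff_integrable.1 (memLp_cond hA (memLp_one_iff_integrable.2 hV.restrict))
  have hhV : Integrable ((fun o => h (obsX o)) * V) Q :=
    memLp_one_iff_integrable.1 (memLp_cond hA (memLp_one_iff_integrable.2 hint))
  have hsm : StronglyMeasurable[MeasurableSpace.comap (obsX (𝒳 := 𝒳)) inferInstance] fun o : Obs 𝒳 => h (obsX o) :=
    (hh.comp (comap_measurable _)).stronglyMeasurable
  have hce := condExp_mul_of_stronglyMeasurable_left hsm hhV hVQ
  have hae : (fun o => h (obsX o) * m (obsX o)) =ᵐ[Q] Q[(fun o => h (obsX o)) * V |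
      MeasurableSpace.comap (obsX (𝒳 := 𝒳)) inferInstance] := by
    filter_upwards [hce, hm.2] with o h1 h2
    rw [h1, Pi.mul_apply, h2]
  have hhm : Integrable (fun o => h (obsX o) * m (obsX o)) Q :=
    integrable_condExp.congr hae.symm
  have h0 : ∫ o, h (obsX o) * (V o - m (obsX o)) ∂Q = 0 := by
    simp only [mul_sub]
    rw [integral_sub (by exact hhV) hhm, integral_congr_ae hae, integral_condExp hle, sub_eq_zero]
    rfl
  rw [hQ, ProbabilityTheory.cond, integral_smul_measure, smul_eq_zero] at h0
  refine h0.resolve_left ?_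
  simp [ENNReal.toReal_eq_zero_iff, hA]

end Regression

/-! ### The propensity odds as a density between the two groups. -/

section Overlap

variable {𝒳 : Type*} [MeasurableSpace 𝒳]

/-- Overlap and sampling assumptions on the population law of repeated cross-sections. -/
structure OverlapDesign (P : Measure (Obs 𝒳)) (g : ControlGroup) (e t : ℕ) (c : ℝ)
    (η : Nuisance 𝒳) : Prop where
  periods_ne : e - 1 ≠ t
  indep : IndepFun (fun o : Obs 𝒳 => obsT o) (fun o : Obs 𝒳 => (obsE o, obsX o)) P
  c_pos : 0 < c
  lt_exposed : c < P.real (exposed e)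
  overlap : ∀ᵐ x ∂(covLaw P g e t), η.p x < 1 - c
  propensity : IsRegression P (ind (exposed e)) (slice g e t) η.p

namespace OverlapDesign

variable {P : Measure (Obs 𝒳)} [IsProbabilityMeasure P] {g : ControlGroup} {e t : ℕ} {c : ℝ}
  {η : Nuisance 𝒳}

theorem measure_exposed_ne_zero (hP : OverlapDesign P g e t c η) : P (exposed e) ≠ 0 := fun h => by
  have := hP.lt_exposed
  rw [measureReal_def, h] at this
  exact absurd (hP.c_pos.trans this) (by simp)

theorem measure_slice_ne_zero (hP : OverlapDesign P g e t c η) : P (slice g e t) ≠ 0 := fun h =>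
  hP.measure_exposed_ne_zero (measure_mono_null Set.subset_union_left h)

theorem c_lt_one (hP : OverlapDesign P g e t c η) : c < 1 :=
  hP.lt_exposed.trans_le measureReal_le_one

theorem measurable_odds (hP : OverlapDesign P g e t c η) : Measurable η.odds := by
  have := hP.propensity.1
  unfold Nuisance.odds
  fun_prop

theorem ae_lt (hP : OverlapDesign P g e t c η) :
    ∀ᵐ x ∂(covMeasure P (slice g e t)), η.p x < 1 - c :=
  (Measure.absolutelyContinuous_of_le (covMeasure_slice_le g e t)) hP.overlap

theorem ae_nonneg (hP : OverlapDesign P g e t c η) :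
    ∀ᵐ x ∂(covMeasure P (slice g e t)), 0 ≤ η.p x := by
  rw [ae_covMeasure_iff (measurableSet_le measurable_const hP.propensity.1)]
  have h0 : 0 ≤ᵐ[ProbabilityTheory.cond P (slice g e t)]
      (ProbabilityTheory.cond P (slice g e t))[ind (exposed e) |
        MeasurableSpace.comap (obsX (𝒳 := 𝒳)) inferInstance] :=
    condExp_nonneg (Eventually.of_forall fun o => Set.indicator_nonneg (by simp) o)
  have h1 : ∀ᵐ o ∂(ProbabilityTheory.cond P (slice g e t)), 0 ≤ η.p (obsX o) := by
    filter_upwards [h0, hP.propensity.2] with o ho hp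
    rw [hp]; exact ho
  rwa [ProbabilityTheory.cond, Measure.ae_ennreal_smul_measure_iff
    (ENNReal.inv_ne_zero.2 (measure_ne_top _ _))] at h1

/-- The defining property of a conditional expectation, tested on the events `{X ∈ B}`, says exactly
that the propensity score is a density. -/
theorem covMeasure_exposed_eq_withDensity (hP : OverlapDesign P g e t c η) :
    covMeasure P (exposed e)
      = (covMeasure P (slice g e t)).withDensity fun x => ENNReal.ofReal (η.p x) := by
  set Q := ProbabilityTheory.cond P (slice g e t) with hQ
  have hS := hP.measure_slice_ne_zero
  have : IsProbabilityMeasure Q := cond_isProbabilityMeasure hS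
  have hE := measurableSet_exposed (𝒳 := 𝒳) e
  have hpm := hP.propensity.1
  have hindQ : Integrable (ind (exposed e)) Q :=
    (integrable_const (1 : ℝ)).indicator hE
  have hpint : Integrable (fun o => η.p (obsX o)) Q :=
    integrable_condExp.congr hP.propensity.2.symm
  have hp0 : 0 ≤ᵐ[Q] fun o => η.p (obsX o) := by
    have := (ae_covMeasure_iff (measurableSet_le measurable_const hpm)).1 hP.ae_nonneg
    exact (Measure.smul_absolutelyContinuous (μ := P.restrict (slice g e t))) this
  ext B hB
  have hXB := measurable_obsX hB
  rw [covMeasure_apply hB, withDensity_apply _ hB, covMeasure,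
    setLIntegral_map hB hpm.ennreal_ofReal measurable_obsX]
  have h1 : ∫⁻ o in obsX ⁻¹' B, ENNReal.ofReal (η.p (obsX o)) ∂Q = Q (obsX ⁻¹' B ∩ exposed e) := by
    rw [← ofReal_integral_eq_lintegral_ofReal hpint.restrict (ae_restrict_of_ae hp0),
      integral_congr_ae (ae_restrict_of_ae hP.propensity.2),
      setIntegral_condExp measurable_obsX.comap_le hindQ ⟨B, hB, rfl⟩]
    have : ind (exposed e) = (exposed (𝒳 := 𝒳) e).indicator fun _ => (1 : ℝ) := rfl
    rw [this, integral_indicator hE, Measure.restrict_restrict hE]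
    simp [Set.inter_comm]
  have h2 : Q (obsX ⁻¹' B ∩ exposed e) = (P (slice g e t))⁻¹ * P (obsX ⁻¹' B ∩ exposed e) := by
    rw [hQ, cond_apply (measurableSet_slice g e t)]
    congr 2
    exact Set.inter_eq_self_of_subset_right (Set.inter_subset_right.trans Set.subset_union_left)
  have h3 : ∫⁻ o in obsX ⁻¹' B, ENNReal.ofReal (η.p (obsX o)) ∂Q
      = (P (slice g e t))⁻¹
        * ∫⁻ o in obsX ⁻¹' B, ENNReal.ofReal (η.p (obsX o)) ∂(P.restrict (slice g e t)) := by
    rw [hQ, ProbabilityTheory.cond, Measure.restrict_smul, lintegral_smul_measure, smul_eq_mul]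
  rw [h2, h3] at h1
  exact ((ENNReal.mul_right_inj (ENNReal.inv_ne_zero.2 (measure_ne_top _ _))
    (ENNReal.inv_ne_top.2 hS)).1 h1).symm

/-- The exposed and the controls partition the slice and `p + (1 - p) = 1`. The exposed part is
finite and cancels. -/
theorem covMeasure_control_eq_withDensity (hP : OverlapDesign P g e t c η) :
    covMeasure P (control g e t)
      = (covMeasure P (slice g e t)).withDensity fun x => ENNReal.ofReal (1 - η.p x) := by
  have hpm := hP.propensity.1
  have h : covMeasure P (exposed e) + (covMeasure P (slice g e t)).withDensity
      (fun x => ENNReal.ofReal (1 - η.p x)) = covMeasure P (exposed e)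
        + covMeasure P (control g e t) := by
    rw [← covMeasure_slice g e t, hP.covMeasure_exposed_eq_withDensity,
      ← withDensity_add_left hpm.ennreal_ofReal]
    conv_rhs => rw [← withDensity_one (μ := covMeasure P (slice g e t))]
    refine withDensity_congr_ae ?_
    filter_upwards [hP.ae_lt, hP.ae_nonneg] with x h1 h2
    rw [Pi.add_apply, ← ENNReal.ofReal_add h2 (by linarith [hP.c_pos])]
    simp
  ext B hB
  have hB' := congrArg (fun μ : Measure 𝒳 => μ B) h
  simp only [Measure.add_apply] at hB'
  exact ((ENNReal.add_right_inj (measure_ne_top _ _)).1 hB').symm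

theorem ae_odds (hP : OverlapDesign P g e t c η) :
    ∀ᵐ x ∂(covMeasure P (slice g e t)), 0 ≤ η.odds x ∧ |η.odds x| ≤ c⁻¹ := by
  filter_upwards [hP.ae_lt, hP.ae_nonneg] with x h1 h2
  have hc := hP.c_pos
  have h0 : 0 ≤ η.odds x := div_nonneg h2 (by linarith)
  refine ⟨h0, ?_⟩
  rw [abs_of_nonneg h0, Nuisance.odds, div_le_iff₀ (by linarith), ← div_eq_inv_mul,
    le_div_iff₀ hc]
  nlinarith

theorem control_absolutelyContinuous :
    covMeasure P (control g e t) ≪ covMeasure P (slice g e t) := by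
  rw [covMeasure_slice]
  exact Measure.absolutelyContinuous_of_le (Measure.le_add_left le_rfl)

/-- Since `(1 - p) r = p`, weighting the controls by the odds reproduces the exposed covariates.
This identity is the source of the orthogonality with respect to the control regressions. -/
theorem covMeasure_exposed_eq_withDensity_odds (hP : OverlapDesign P g e t c η) :
    covMeasure P (exposed e)
      = (covMeasure P (control g e t)).withDensity fun x => ENNReal.ofReal (η.odds x) := by
  have hpm := hP.propensity.1
  rw [hP.covMeasure_control_eq_withDensity, ← withDensity_mul _ (by fun_prop)
    hP.measurable_odds.ennreal_ofReal, hP.covMeasure_exposed_eq_withDensity]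
  refine withDensity_congr_ae ?_
  filter_upwards [hP.ae_lt, hP.ae_odds] with x h1 h2
  have hc := hP.c_pos
  rw [Pi.mul_apply, ← ENNReal.ofReal_mul (by linarith), Nuisance.odds,
    mul_div_cancel₀ _ (by linarith)]

theorem integral_exposed_eq (hP : OverlapDesign P g e t c η) (u : 𝒳 → ℝ) :
    ∫ x, u x ∂(covMeasure P (exposed e)) = ∫ x, η.odds x * u x ∂(covMeasure P (control g e t)) := by
  rw [hP.covMeasure_exposed_eq_withDensity_odds, integral_withDensity_eq_integral_toReal_smul
    hP.measurable_odds.ennreal_ofReal (by simp)]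
  refine integral_congr_ae ?_
  filter_upwards [control_absolutelyContinuous hP.ae_odds] with x hx
  rw [ENNReal.toReal_ofReal hx.1, smul_eq_mul]

theorem lintegral_exposed_le (hP : OverlapDesign P g e t c η) {f : 𝒳 → ℝ≥0∞}
    (hf : Measurable f) :
    ∫⁻ x, f x ∂(covMeasure P (exposed e))
      ≤ ENNReal.ofReal c⁻¹ * ∫⁻ x, f x ∂(covMeasure P (control g e t)) := by
  rw [hP.covMeasure_exposed_eq_withDensity_odds,
    lintegral_withDensity_eq_lintegral_mul _ hP.measurable_odds.ennreal_ofReal hf,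
    ← lintegral_const_mul _ hf]
  refine lintegral_mono_ae ?_
  filter_upwards [control_absolutelyContinuous hP.ae_odds] with x hx
  exact mul_le_mul_left (ENNReal.ofReal_le_ofReal ((le_abs_self _).trans hx.2)) _

/-- The existence of controls is a consequence of overlap: the exposed covariate measure is at most
`1/c` times the control one, so both would vanish together. -/
theorem measure_control_ne_zero (hP : OverlapDesign P g e t c η) : P (control g e t) ≠ 0 := by
  intro h
  have h1 := hP.lintegral_exposed_le (f := fun _ => 1) measurable_const
  simp only [lintegral_const, one_mul, covMeasure_apply MeasurableSet.univ, Set.preimage_univ,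
    Set.univ_inter, h, mul_zero, nonpos_iff_eq_zero] at h1
  exact hP.measure_exposed_ne_zero h1

theorem covMeasure_exposed_period (hP : OverlapDesign P g e t c η) (s : ℕ) :
    covMeasure P (exposed e ∩ period s) = P (period s) • covMeasure P (exposed e) :=
  covMeasure_inter_period hP.indep {(e : ℕ∞)} s

theorem covMeasure_control_period (hP : OverlapDesign P g e t c η) (s : ℕ) :
    covMeasure P (control g e t ∩ period s) = P (period s) • covMeasure P (control g e t) := by
  rw [control_eq_preimage]
  exact covMeasure_inter_period hP.indep _ s

theorem measure_exposed_period_ne_zero (hP : OverlapDesign P g e t c η) {s : ℕ}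
    (hs : P (period s) ≠ 0) : P (exposed e ∩ period s) ≠ 0 := by
  have h := congrArg (fun μ : Measure 𝒳 => μ Set.univ) (hP.covMeasure_exposed_period s)
  simp only [covMeasure_apply MeasurableSet.univ, Set.preimage_univ, Set.univ_inter,
    Measure.smul_apply, smul_eq_mul] at h
  rw [h]
  exact mul_ne_zero hs hP.measure_exposed_ne_zero

theorem measure_control_period_ne_zero (hP : OverlapDesign P g e t c η) {s : ℕ}
    (hs : P (period s) ≠ 0) : P (control g e t ∩ period s) ≠ 0 := by
  have h := congrArg (fun μ : Measure 𝒳 => μ Set.univ) (hP.covMeasure_control_period s)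
  simp only [covMeasure_apply MeasurableSet.univ, Set.preimage_univ, Set.univ_inter,
    Measure.smul_apply, smul_eq_mul] at h
  rw [h]
  exact mul_ne_zero hs hP.measure_control_ne_zero

theorem integral_exposed_period (hP : OverlapDesign P g e t c η) (s : ℕ) {f : 𝒳 → ℝ}
    (hf : Measurable f) :
    ∫ o, ind (exposed e) o * ind (period s) o * f (obsX o) ∂P
      = P.real (period s) * ∫ x, f x ∂(covMeasure P (exposed e)) := by
  simp only [ind_mul_ind]
  rw [integral_covMeasure ((measurableSet_exposed e).inter (measurableSet_period s)) hf,
    hP.covMeasure_exposed_period, integral_smul_measure, smul_eq_mul, measureReal_def]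

theorem integral_control_period (hP : OverlapDesign P g e t c η) (s : ℕ) {f : 𝒳 → ℝ}
    (hf : Measurable f) :
    ∫ o, ind (control g e t) o * ind (period s) o * f (obsX o) ∂P
      = P.real (period s) * ∫ x, f x ∂(covMeasure P (control g e t)) := by
  simp only [ind_mul_ind]
  rw [integral_covMeasure ((measurableSet_control g e t).inter (measurableSet_period s)) hf,
    hP.covMeasure_control_period, integral_smul_measure, smul_eq_mul, measureReal_def]

theorem integral_odds_control (hP : OverlapDesign P g e t c η) :
    ∫ x, η.odds x ∂(covMeasure P (control g e t)) = P.real (exposed e) := by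
  have h := hP.integral_exposed_eq fun _ => 1
  simp only [mul_one] at h
  rw [← h, integral_const, smul_eq_mul, mul_one, measureReal_def,
    covMeasure_apply MeasurableSet.univ]
  simp [measureReal_def]

end OverlapDesign

theorem integral_ind {P : Measure (Obs 𝒳)} {A : Set (Obs 𝒳)} (hA : MeasurableSet A) :
    ∫ o, ind A o ∂P = P.real A := by
  have : ind A = A.indicator fun _ => (1 : ℝ) := rfl
  rw [this, integral_indicator_const _ hA, smul_eq_mul, mul_one]

namespace OverlapDesign

variable {P : Measure (Obs 𝒳)} [IsProbabilityMeasure P] {g : ControlGroup} {e t : ℕ} {c : ℝ}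
  {η : Nuisance 𝒳}

theorem popNormalizers_rho : (popNormalizers P g e t η).rho = P.real (exposed e) :=
  integral_ind (measurableSet_exposed e)

theorem popNormalizers_rhoTrt (hP : OverlapDesign P g e t c η) (s : ℕ) :
    (popNormalizers P g e t η).rhoTrt s = P.real (period s) * P.real (exposed e) := by
  have h := hP.integral_exposed_period s (f := fun _ => 1) measurable_const
  simp only [mul_one, integral_const, smul_eq_mul] at h
  refine h.trans ?_
  simp [measureReal_def, covMeasure_apply]

/-- By the reweighting identity the control weights have the same normalizer `λ_s ρ` as the treated
ones. -/
theorem popNormalizers_rhoCtl (hP : OverlapDesign P g e t c η) (s : ℕ) :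
    (popNormalizers P g e t η).rhoCtl s = P.real (period s) * P.real (exposed e) := by
  have h := hP.integral_control_period s hP.measurable_odds
  rw [hP.integral_odds_control] at h
  exact h

end OverlapDesign

end Overlap

/-! ### Residuals of the true regressions -/

section Residuals

variable {𝒳 : Type*} [MeasurableSpace 𝒳]

/-- `V` is square integrable, and `μT`, `μC` are its regression functions among the exposed and
among the controls of period `s`. -/
structure RegressionPair (P : Measure (Obs 𝒳)) (g : ControlGroup) (e t s : ℕ) (V : Obs 𝒳 → ℝ)
    (μT μC : 𝒳 → ℝ) : Prop where
  meas : Measurable V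
  memLp : MemLp V 2 P
  pos : P (period s) ≠ 0
  trt : IsRegression P V (exposed e ∩ period s) μT
  ctl : IsRegression P V (control g e t ∩ period s) μC

/-- The residual of `V` on the event `A`. -/
noncomputable def residual (A : Set (Obs 𝒳)) (s : ℕ) (V : Obs 𝒳 → ℝ) (μ : 𝒳 → ℝ) (o : Obs 𝒳) : ℝ :=
  ind A o * ind (period s) o * (V o - μ (obsX o))

theorem residual_eq_indicator (A : Set (Obs 𝒳)) (s : ℕ) (V : Obs 𝒳 → ℝ) (μ : 𝒳 → ℝ) :
    residual A s V μ = (A ∩ period s).indicator fun o => V o - μ (obsX o) := by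
  rw [← ind_mul]
  ext o
  rw [residual, ind_mul_ind]

theorem measurable_residual {A : Set (Obs 𝒳)} (hA : MeasurableSet A) {s : ℕ} {V : Obs 𝒳 → ℝ}
    {μ : 𝒳 → ℝ} (hV : Measurable V) (hμ : Measurable μ) : Measurable (residual A s V μ) := by
  have h1 := measurable_ind hA
  have h2 := measurable_ind (measurableSet_period (𝒳 := 𝒳) s)
  have h3 := hμ.comp (measurable_obsX (𝒳 := 𝒳))
  exact (h1.mul h2).mul (hV.sub h3)

variable {P : Measure (Obs 𝒳)} [IsProbabilityMeasure P] {g : ControlGroup} {e t s : ℕ} {c : ℝ}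
  {η : Nuisance 𝒳} {V : Obs 𝒳 → ℝ} {μT μC : 𝒳 → ℝ}

theorem memLp_covMeasure_iff {A : Set (Obs 𝒳)} {f : 𝒳 → ℝ} (hf : Measurable f) :
    MemLp f 2 (covMeasure P A) ↔ MemLp (fun o => f (obsX o)) 2 (P.restrict A) :=
  memLp_map_measure_iff hf.aestronglyMeasurable measurable_obsX.aemeasurable

theorem memLp_of_smul {ν : Measure 𝒳} {f : 𝒳 → ℝ} {a : ℝ≥0∞} (ha : a ≠ 0) (ha' : a ≠ ∞)
    (h : MemLp f 2 (a • ν)) : MemLp f 2 ν := by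
  have h1 := h.smul_measure (c := a⁻¹) (ENNReal.inv_ne_top.2 ha)
  rwa [smul_smul, ENNReal.inv_mul_cancel ha ha', one_smul] at h1

/-- The odds are bounded only almost everywhere on the slice, hence the condition on the support of
`F`. -/
theorem OverlapDesign.memLp_mul_odds (hP : OverlapDesign P g e t c η) {F : Obs 𝒳 → ℝ}
    (hF : MemLp F 2 P) (hsupp : ∀ o, o ∉ control g e t → F o = 0) :
    MemLp (fun o => F o * η.odds (obsX o)) 2 P := by
  have hms := measurableSet_control (𝒳 := 𝒳) g e t
  have heq : (fun o => F o * η.odds (obsX o))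
      = (control g e t).indicator fun o => F o * η.odds (obsX o) := by
    ext o
    by_cases ho : o ∈ control g e t
    · rw [Set.indicator_of_mem ho]
    · rw [Set.indicator_of_notMem ho, hsupp o ho, zero_mul]
  rw [heq, memLp_indicator_iff_restrict hms]
  have hb : ∀ᵐ o ∂(P.restrict (control g e t)), ‖η.odds (obsX o)‖ ≤ c⁻¹ := by
    have h1 := OverlapDesign.control_absolutelyContinuous
      (hP.ae_odds.mono fun x hx => hx.2)
    exact (ae_covMeasure_iff (measurableSet_le hP.measurable_odds.abs measurable_const)).1 h1
  have hmm := hP.measurable_odds.comp (measurable_obsX (𝒳 := 𝒳))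
  refine MemLp.of_le_mul (c := c⁻¹) (hF.restrict _)
    ((hF.restrict _).1.mul hmm.aestronglyMeasurable) ?_
  filter_upwards [hb] with o ho
  rw [norm_mul, mul_comm]
  exact mul_le_mul_of_nonneg_right ho (norm_nonneg _)

namespace RegressionPair

theorem memLp_residual_trt (hV : RegressionPair P g e t s V μT μC) (hP : OverlapDesign P g e t c η) :
    MemLp (residual (exposed e) s V μT) 2 P := by
  rw [residual_eq_indicator, memLp_indicator_iff_restrict
    ((measurableSet_exposed e).inter (measurableSet_period s))]
  exact hV.memLp.restrict _ |>.sub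
    (hV.trt.memLp (hP.measure_exposed_period_ne_zero hV.pos) hV.memLp)

theorem memLp_residual_ctl (hV : RegressionPair P g e t s V μT μC) (hP : OverlapDesign P g e t c η) :
    MemLp (residual (control g e t) s V μC) 2 P := by
  rw [residual_eq_indicator, memLp_indicator_iff_restrict
    ((measurableSet_control g e t).inter (measurableSet_period s))]
  exact hV.memLp.restrict _ |>.sub
    (hV.ctl.memLp (hP.measure_control_period_ne_zero hV.pos) hV.memLp)

/-- A conditional expectation of a square integrable variable is square integrable on the group in
period `s`. There the covariate measure is `λ_s` times that of the whole group, and `λ_s ≠ 0` can be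
divided out. -/
theorem memLp_ctl (hV : RegressionPair P g e t s V μT μC) (hP : OverlapDesign P g e t c η) :
    MemLp μC 2 (covMeasure P (control g e t)) := by
  have h := (memLp_covMeasure_iff hV.ctl.1).2
    (hV.ctl.memLp (hP.measure_control_period_ne_zero hV.pos) hV.memLp)
  rw [hP.covMeasure_control_period] at h
  exact memLp_of_smul hV.pos (measure_ne_top _ _) h

theorem memLp_trt (hV : RegressionPair P g e t s V μT μC) (hP : OverlapDesign P g e t c η) :
    MemLp μT 2 (covMeasure P (exposed e)) := by
  have h := (memLp_covMeasure_iff hV.trt.1).2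
    (hV.trt.memLp (hP.measure_exposed_period_ne_zero hV.pos) hV.memLp)
  rw [hP.covMeasure_exposed_period] at h
  exact memLp_of_smul hV.pos (measure_ne_top _ _) h

/-- The score evaluates the control regression at covariates of the exposed; the bounded odds carry
integrability from one group to the other. -/
theorem memLp_ctl_exposed (hV : RegressionPair P g e t s V μT μC)
    (hP : OverlapDesign P g e t c η) : MemLp μC 2 (covMeasure P (exposed e)) := by
  rw [memLp_two_iff_lintegral hV.ctl.1.aestronglyMeasurable]
  have hm : Measurable fun x => ‖μC x‖ₑ ^ 2 := hV.ctl.1.enorm.pow_const 2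
  exact ne_top_of_le_ne_top (ENNReal.mul_ne_top ENNReal.ofReal_ne_top
    ((memLp_two_iff_lintegral hV.ctl.1.aestronglyMeasurable).1 (hV.memLp_ctl hP)))
    (hP.lintegral_exposed_le hm)

theorem memLp_contrast (hV : RegressionPair P g e t s V μT μC) (hP : OverlapDesign P g e t c η) :
    MemLp (fun o => ind (exposed e) o * (μT (obsX o) - μC (obsX o))) 2 P := by
  rw [ind_mul, memLp_indicator_iff_restrict (measurableSet_exposed e)]
  exact (memLp_covMeasure_iff (hV.trt.1.sub hV.ctl.1)).1
    ((hV.memLp_trt hP).sub (hV.memLp_ctl_exposed hP))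

theorem integral_residual_trt (hV : RegressionPair P g e t s V μT μC)
    (hP : OverlapDesign P g e t c η) : ∫ o, residual (exposed e) s V μT o ∂P = 0 := by
  rw [residual_eq_indicator, integral_indicator
    ((measurableSet_exposed e).inter (measurableSet_period s))]
  have hint := hV.memLp.integrable one_le_two
  simpa using hV.trt.integral_mul_residual (hP.measure_exposed_period_ne_zero hV.pos) hint
    (h := fun _ => 1) measurable_const (by simpa using hint.restrict)

/-- Residuals among the controls are orthogonal to bounded functions of the covariates. -/
theorem integral_residual_ctl_mul (hV : RegressionPair P g e t s V μT μC)
    (hP : OverlapDesign P g e t c η) {h : 𝒳 → ℝ} (hh : Measurable h) {B : ℝ}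
    (hB : ∀ᵐ x ∂(covMeasure P (control g e t)), |h x| ≤ B) :
    ∫ o, residual (control g e t) s V μC o * h (obsX o) ∂P = 0 := by
  have hms := (measurableSet_control (𝒳 := 𝒳) g e t).inter (measurableSet_period s)
  have hint := hV.memLp.integrable one_le_two
  have heq : (fun o => residual (control g e t) s V μC o * h (obsX o))
      = (control g e t ∩ period s).indicator fun o => h (obsX o) * (V o - μC (obsX o)) := by
    rw [← ind_mul]
    ext o
    rw [residual, ind_mul_ind]
    ring
  rw [heq, integral_indicator hms]
  refine hV.ctl.integral_mul_residual (hP.measure_control_period_ne_zero hV.pos) hint hh ?_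
  refine hint.restrict.bdd_mul (c := B) (hh.comp measurable_obsX).aestronglyMeasurable ?_
  have h1 := (ae_covMeasure_iff (measurableSet_le hh.abs measurable_const)).1 hB
  exact ae_restrict_of_ae_restrict_of_subset Set.inter_subset_left h1

theorem memLp_odds_mul_residual (hV : RegressionPair P g e t s V μT μC)
    (hP : OverlapDesign P g e t c η) :
    MemLp (fun o => residual (control g e t) s V μC o * η.odds (obsX o)) 2 P :=
  hP.memLp_mul_odds (hV.memLp_residual_ctl hP) fun o ho => by simp [residual, ind_of_notMem ho]

end RegressionPair

end Residuals

/-! ### Second moments of cross-fitted functions of the covariates -/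

section SecondMoments

variable {𝒳 Ω : Type*} [MeasurableSpace 𝒳] [MeasurableSpace Ω] {Pr : Measure Ω}

theorem IsLittleOP.of_le {Z W : ℕ → Ω → ℝ≥0∞} (hW : IsLittleOP Pr W fun _ => 1)
    (h : HighProb Pr fun b ω => Z b ω ≤ W b ω) : IsLittleOP Pr Z fun _ => 1 :=
  .of_highProb fun _ hε => ((hW.highProb_lt hε).and h).mono
    (Eventually.of_forall fun _ _ hb => hb.2.trans_lt hb.1)

theorem IsLittleOP.add {Z W : ℕ → Ω → ℝ≥0∞} (hZ : IsLittleOP Pr Z fun _ => 1)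
    (hW : IsLittleOP Pr W fun _ => 1) : IsLittleOP Pr (fun b ω => Z b ω + W b ω) fun _ => 1 :=
  .of_highProb fun ε hε => ((hZ.highProb_lt (half_pos hε)).and (hW.highProb_lt (half_pos hε))).mono
    (Eventually.of_forall fun b ω hb => (ENNReal.add_lt_add hb.1 hb.2).trans_eq (by
      rw [← ENNReal.ofReal_add (by positivity) (by positivity), add_halves]))

theorem IsLittleOP.const_mul {Z : ℕ → Ω → ℝ≥0∞} (hZ : IsLittleOP Pr Z fun _ => 1) {C : ℝ}
    (hC : 0 ≤ C) : IsLittleOP Pr (fun b ω => ENNReal.ofReal C * Z b ω) fun _ => 1 :=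
  -- Dividing by `C + 1` allows `C = 0` and gives the strict inequality.
  .of_highProb fun ε hε => (hZ.highProb_lt (show 0 < ε / (C + 1) by positivity)).mono
    (Eventually.of_forall fun b ω hb => by
      calc ENNReal.ofReal C * Z b ω ≤ ENNReal.ofReal C * ENNReal.ofReal (ε / (C + 1)) := by gcongr
        _ = ENNReal.ofReal (C * (ε / (C + 1))) := (ENNReal.ofReal_mul hC).symm
        _ < ENNReal.ofReal ε := by
          refine (ENNReal.ofReal_lt_ofReal_iff hε).2 ?_
          rw [mul_div_assoc', div_lt_iff₀ (by positivity)]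
          nlinarith)

theorem IsLittleOP.sq {Z : ℕ → Ω → ℝ≥0∞} (hZ : IsLittleOP Pr Z fun _ => 1) :
    IsLittleOP Pr (fun b ω => Z b ω ^ 2) fun _ => 1 :=
  .of_highProb fun ε hε => (hZ.highProb_lt (Real.sqrt_pos.2 hε)).mono
    (Eventually.of_forall fun b ω hb => by
      calc Z b ω ^ 2 < ENNReal.ofReal √ε ^ 2 := ENNReal.pow_lt_pow_left two_ne_zero hb
        _ = ENNReal.ofReal ε := by
          rw [← ENNReal.ofReal_pow (Real.sqrt_nonneg _), Real.sq_sqrt hε.le])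

variable {P : Measure (Obs 𝒳)} [IsProbabilityMeasure P] {g : ControlGroup} {e t : ℕ}
  {A : Set (Obs 𝒳)}

theorem lintegral_sq_le_of_abs_le_ind (hA : covMeasure P A ≤ covLaw P g e t)
    (hAm : MeasurableSet A) {φ : Obs 𝒳 → ℝ} (hφ : ∀ o, |φ o| ≤ ind A o) {f : 𝒳 → ℝ}
    (hf : Measurable f) :
    ∫⁻ o, ‖φ o * f (obsX o)‖ₑ ^ 2 ∂P ≤ eLpNorm f 2 (covLaw P g e t) ^ 2 := by
  have hm : Measurable fun x => ‖f x‖ₑ ^ 2 := hf.enorm.pow_const 2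
  calc ∫⁻ o, ‖φ o * f (obsX o)‖ₑ ^ 2 ∂P
      ≤ ∫⁻ o, A.indicator (fun o => ‖f (obsX o)‖ₑ ^ 2) o ∂P := by
        refine lintegral_mono fun o => ?_
        have h := hφ o
        by_cases ho : o ∈ A
        · rw [Set.indicator_of_mem ho, enorm_mul]
          rw [ind_of_mem ho] at h
          gcongr
          refine mul_le_of_le_one_left zero_le ?_
          rw [Real.enorm_eq_ofReal_abs]
          exact ENNReal.ofReal_le_one.2 h
        · rw [Set.indicator_of_notMem ho]
          rw [ind_of_notMem ho] at h
          simp [abs_nonpos_iff.1 h]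
    _ = ∫⁻ x, ‖f x‖ₑ ^ 2 ∂(covMeasure P A) := by
        rw [lintegral_indicator hAm, lintegral_covMeasure A hm]
    _ ≤ ∫⁻ x, ‖f x‖ₑ ^ 2 ∂(covLaw P g e t) := lintegral_mono' hA le_rfl
    _ = eLpNorm f 2 (covLaw P g e t) ^ 2 := (eLpNorm_two_sq _ _).symm

/-- A square-integrable variable times a bounded function of the covariates that tends to zero in
`L²` tends to zero in `L²`. -/
theorem isLittleOP_lintegral_mul_bounded (hA : covMeasure P A ≤ covLaw P g e t)
    (hAm : MeasurableSet A) {f : Obs 𝒳 → ℝ} (hf : Measurable f) (hL2 : MemLp f 2 P)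
    (hsupp : ∀ o, o ∉ A → f o = 0) {h : ℕ → Ω → 𝒳 → ℝ} (hh : ∀ b ω, Measurable (h b ω)) {B : ℝ}
    (hB0 : 0 ≤ B) (hB : HighProb Pr fun b ω => ∀ᵐ x ∂(covLaw P g e t), |h b ω x| ≤ B)
    (hsmall : IsLittleOP Pr (fun b ω => eLpNorm (h b ω) 2 (covLaw P g e t)) fun _ => 1) :
    IsLittleOP Pr (fun b ω => ∫⁻ o, ‖f o * h b ω (obsX o)‖ₑ ^ 2 ∂P) fun _ => 1 := by
  refine .of_highProb fun ε hε => ?_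
  -- Truncation level: `M` makes the tail of `f` smaller than `ε'` in `L²`, so that `B² ε'² ≤ ε /
  -- 2`.
  set ε' : ℝ := √(ε / 2) / (B + 1) with hε'
  have hε'0 : 0 < ε' := by positivity
  obtain ⟨M, hM0, hM⟩ := hL2.eLpNorm_indicator_norm_ge_pos_le hf.stronglyMeasurable hε'0
  set T : Set (Obs 𝒳) := {x | M ≤ ‖f x‖₊} with hT
  have hTm : MeasurableSet T := measurableSet_le measurable_const (by fun_prop)
  have htail : ENNReal.ofReal (B ^ 2) * ∫⁻ o, ‖T.indicator f o‖ₑ ^ 2 ∂P ≤ ENNReal.ofReal (ε / 2) := by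
    rw [← eLpNorm_two_sq]
    calc _ ≤ ENNReal.ofReal (B ^ 2) * ENNReal.ofReal ε' ^ 2 := by gcongr
      _ = ENNReal.ofReal (B ^ 2 * ε' ^ 2) := by
        rw [← ENNReal.ofReal_pow hε'0.le, ← ENNReal.ofReal_mul (by positivity)]
      _ ≤ _ := ENNReal.ofReal_le_ofReal (by
        rw [hε', div_pow, Real.sq_sqrt (by positivity), mul_div_assoc', div_le_iff₀ (by positivity)]
        nlinarith)
  have hmain := (hsmall.sq.const_mul (C := M ^ 2) (by positivity)).highProb_lt (half_pos hε)
  refine (hmain.and hB).mono (Eventually.of_forall fun b ω hb => ?_)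
  have hae : ∀ᵐ o ∂P, o ∈ A → |h b ω (obsX o)| ≤ B := by
    have h1 := (Measure.absolutelyContinuous_of_le hA) hb.2
    exact (ae_restrict_iff' hAm).1
      ((ae_covMeasure_iff (measurableSet_le (hh b ω).abs measurable_const)).1 h1)
  -- Where `|f| < M` the factor `f` is bounded and `h` is small in `L²`. Where `|f| ≥ M` the factor
  -- `h` is bounded by `B` and the tail of `f` is small.
  have hbound : ∫⁻ o, ‖f o * h b ω (obsX o)‖ₑ ^ 2 ∂P
      ≤ ENNReal.ofReal (M ^ 2) * ∫⁻ o, ‖ind A o * h b ω (obsX o)‖ₑ ^ 2 ∂P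
        + ENNReal.ofReal (B ^ 2) * ∫⁻ o, ‖T.indicator f o‖ₑ ^ 2 ∂P := by
    have hm1 : Measurable fun o => ‖ind A o * h b ω (obsX o)‖ₑ ^ 2 :=
      (((measurable_ind hAm).mul ((hh b ω).comp measurable_obsX)).enorm).pow_const 2
    have hm2 : Measurable fun o => ‖T.indicator f o‖ₑ ^ 2 :=
      ((hf.indicator hTm).enorm).pow_const 2
    rw [← lintegral_const_mul _ hm1, ← lintegral_const_mul _ hm2,
      ← lintegral_add_left (hm1.const_mul _)]
    refine lintegral_mono_ae ?_
    filter_upwards [hae] with o ho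
    by_cases hoA : o ∈ A
    · simp only [enorm_sq_eq_ofReal_sq, ind_of_mem hoA, one_mul]
      by_cases hoT : o ∈ T
      · rw [Set.indicator_of_mem hoT]
        refine le_trans ?_ le_add_self
        rw [← ENNReal.ofReal_mul (by positivity)]
        refine ENNReal.ofReal_le_ofReal ?_
        rw [mul_pow, mul_comm]
        exact mul_le_mul_of_nonneg_right (sq_le_sq' (abs_le.1 (ho hoA)).1 (abs_le.1 (ho hoA)).2)
          (sq_nonneg _)
      · refine le_trans ?_ le_self_add
        rw [← ENNReal.ofReal_mul (by positivity)]
        refine ENNReal.ofReal_le_ofReal ?_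
        rw [mul_pow]
        have hlt : |f o| ≤ M := by
          have : ¬ M ≤ |f o| := by simpa [hT] using hoT
          linarith
        exact mul_le_mul_of_nonneg_right (sq_le_sq' (abs_le.1 hlt).1 (abs_le.1 hlt).2)
          (sq_nonneg _)
    · simp [hsupp o hoA]
  have h2 := lintegral_sq_le_of_abs_le_ind hA hAm (φ := ind A)
    (fun o => by by_cases ho : o ∈ A <;> simp [ind, ho]) (hh b ω)
  calc ∫⁻ o, ‖f o * h b ω (obsX o)‖ₑ ^ 2 ∂P ≤ _ := hbound
    _ ≤ ENNReal.ofReal (M ^ 2) * eLpNorm (h b ω) 2 (covLaw P g e t) ^ 2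
        + ENNReal.ofReal (ε / 2) := by gcongr
    _ < ENNReal.ofReal (ε / 2) + ENNReal.ofReal (ε / 2) :=
        ENNReal.add_lt_add_of_lt_of_le ENNReal.ofReal_ne_top hb.1 le_rfl
    _ = ENNReal.ofReal ε := by
        rw [← ENNReal.ofReal_add (by positivity) (by positivity), add_halves]

/-- Cauchy–Schwarz for measures dominated by the covariate law. -/
theorem abs_integral_mul_le {ν ν' : Measure 𝒳} (hν : ν ≤ ν') {f h : 𝒳 → ℝ}
    (hf : Measurable f) (hh : Measurable h) (hf' : eLpNorm f 2 ν' ≠ ∞) (hh' : eLpNorm h 2 ν' ≠ ∞) :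
    |∫ x, f x * h x ∂ν| ≤ (eLpNorm f 2 ν').toReal * (eLpNorm h 2 ν').toReal := by
  rw [← ENNReal.toReal_mul, ← Real.norm_eq_abs, ← toReal_enorm]
  refine ENNReal.toReal_mono (ENNReal.mul_ne_top hf' hh') ?_
  have h1 : eLpNorm (f • h) 1 ν' ≤ eLpNorm f 2 ν' * eLpNorm h 2 ν' :=
    eLpNorm_smul_le_mul_eLpNorm hh.aestronglyMeasurable hf.aestronglyMeasurable
  rw [eLpNorm_one_eq_lintegral_enorm] at h1
  exact (enorm_integral_le_lintegral_enorm _).trans ((lintegral_mono' hν le_rfl).trans h1)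

end SecondMoments

/-! ### Expansion of the estimated score in one period -/

section EmpiricalNorm

variable {𝒳 Ω : Type*} [MeasurableSpace 𝒳] [MeasurableSpace Ω] {P : Measure (Obs 𝒳)}
  {Pr : Measure Ω} [IsProbabilityMeasure P] [IsProbabilityMeasure Pr] {O : ℕ → Ω → Obs 𝒳} {K : ℕ}
  {fold : (b : ℕ) → Fin (K * b) → Fin K} {k : Fin K}

/-- The empirical second moment over fold `k` is `o_P(1)`. -/
def EmpSmall (Pr : Measure Ω) (O : ℕ → Ω → Obs 𝒳) (fold : (b : ℕ) → Fin (K * b) → Fin K)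
    (k : Fin K) (f : ℕ → Ω → Obs 𝒳 → ℝ) : Prop :=
  Negligible Pr fun b ω => foldMean (fold b) (sample K b O ω) k fun o => f b ω o ^ 2

theorem EmpSmall.congr {f h : ℕ → Ω → Obs 𝒳 → ℝ} (hf : EmpSmall Pr O fold k f)
    (hfh : ∀ b ω o, h b ω o = f b ω o) : EmpSmall Pr O fold k h := by
  have : h = f := by ext; exact hfh _ _ _
  rwa [this]

theorem EmpSmall.add {f h : ℕ → Ω → Obs 𝒳 → ℝ} (hf : EmpSmall Pr O fold k f)
    (hh : EmpSmall Pr O fold k h) : EmpSmall Pr O fold k fun b ω o => f b ω o + h b ω o := by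
  refine ((hf.const_mul 2).add (hh.const_mul 2)).of_le (HighProb.of_forall fun b ω => ?_)
  rw [← foldMean_const_mul, ← foldMean_const_mul, ← foldMean_add,
    abs_of_nonneg (foldMean_nonneg _ _ _ fun _ => sq_nonneg _),
    abs_of_nonneg (foldMean_nonneg _ _ _ fun _ => by positivity)]
  refine foldMean_mono _ _ _ fun o => ?_
  nlinarith [sq_nonneg (f b ω o - h b ω o)]

theorem EmpSmall.tight_mul {a : ℕ → Ω → ℝ} {f : ℕ → Ω → Obs 𝒳 → ℝ} (ha : Tight Pr a)
    (hf : EmpSmall Pr O fold k f) : EmpSmall Pr O fold k fun b ω o => a b ω * f b ω o := by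
  refine (ha.sq.mul_negligible hf).congr (HighProb.of_forall fun b ω => ?_)
  rw [← foldMean_const_mul]
  simp only [mul_pow]

theorem EmpSmall.sub {f h : ℕ → Ω → Obs 𝒳 → ℝ} (hf : EmpSmall Pr O fold k f)
    (hh : EmpSmall Pr O fold k h) : EmpSmall Pr O fold k fun b ω o => f b ω o - h b ω o :=
  (hf.add (hh.tight_mul (Tight.const (-1)))).congr fun _ _ _ => by ring

theorem EmpSmall.of_negligible_mul (hS : FoldedSample P Pr O K fold) {a : ℕ → Ω → ℝ}
    {f : Obs 𝒳 → ℝ} (ha : Negligible Pr a) (hf : Measurable f) (hL2 : MemLp f 2 P) :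
    EmpSmall Pr O fold k fun b ω o => a b ω * f o := by
  refine (ha.sq.mul_tight (hS.tight_foldMean_sq k hf hL2)).congr (HighProb.of_forall fun b ω => ?_)
  rw [← foldMean_const_mul]
  simp only [mul_pow]

theorem EmpSmall.negligible_foldMean (hS : FoldedSample P Pr O K fold)
    {f : ℕ → Ω → Obs 𝒳 → ℝ} (hf : EmpSmall Pr O fold k f) :
    Negligible Pr fun b ω => foldMean (fold b) (sample K b O ω) k (f b ω) := by
  refine Negligible.of_sq (hf.of_le (HighProb.of_forall fun b ω => ?_))
  rw [abs_of_nonneg (sq_nonneg _), abs_of_nonneg (foldMean_nonneg _ _ _ fun _ => sq_nonneg _)]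
  exact foldMean_sq_le _ _ _ (hS.card b k) _

theorem measurable_uncurry_mul_comp {Θ : Type*} [MeasurableSpace Θ] {φ : Obs 𝒳 → ℝ}
    (hφ : Measurable φ) {f : Θ → 𝒳 → ℝ} (hf : Measurable (Function.uncurry f)) :
    Measurable (Function.uncurry fun θ (o : Obs 𝒳) => φ o * f θ (obsX o)) :=
  (hφ.comp measurable_snd).mul
    (hf.comp (measurable_fst.prodMk (measurable_obsX.comp measurable_snd)))

end EmpiricalNorm

section Expansion

variable {𝒳 Ω : Type*} [MeasurableSpace 𝒳] [MeasurableSpace Ω]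

/-- The contribution of period `s` to a score component. -/
noncomputable def scoreAt (N : Normalizers) (g : ControlGroup) (e t s : ℕ) (r : 𝒳 → ℝ)
    (V : Obs 𝒳 → ℝ) (μT μC : 𝒳 → ℝ) (o : Obs 𝒳) : ℝ :=
  (N.rhoTrt s)⁻¹ * residual (exposed e) s V μT o
    - (N.rhoCtl s)⁻¹ * (residual (control g e t) s V μC o * r (obsX o))
    + N.rho⁻¹ * (ind (exposed e) o * (μT (obsX o) - μC (obsX o)))

/-- Consistency and rate conditions for the nuisances of period `s` learned outside fold `k`. -/
structure LearnedSlice (P : Measure (Obs 𝒳)) (Pr : Measure Ω) (O : ℕ → Ω → Obs 𝒳) {K : ℕ}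
    (fold : (b : ℕ) → Fin (K * b) → Fin K) (g : ControlGroup) (e t : ℕ) (c : ℝ) (k : Fin K)
    (s : ℕ) (r μT μC : 𝒳 → ℝ)
    (ηh : (b : ℕ) → ({i : Fin (K * b) // fold b i ≠ k} → Obs 𝒳) → Nuisance 𝒳)
    (μTh μCh : (b : ℕ) → ({i : Fin (K * b) // fold b i ≠ k} → Obs 𝒳) → 𝒳 → ℝ) : Prop where
  meas_odds : ∀ b, Measurable (Function.uncurry fun θ => (ηh b θ).odds)
  meas_trt : ∀ b, Measurable (Function.uncurry (μTh b))
  meas_ctl : ∀ b, Measurable (Function.uncurry (μCh b))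
  overlap : HighProb Pr fun b ω =>
    ∀ᵐ x ∂(covLaw P g e t), |(ηh b (train (fold b) O k ω)).odds x| ≤ c⁻¹
  odds : IsLittleOP Pr (fun b ω => eLpNorm
    (fun x => (ηh b (train (fold b) O k ω)).odds x - r x) 2 (covLaw P g e t)) fun _ => 1
  trt : IsLittleOP Pr (fun b ω => eLpNorm
    (fun x => μTh b (train (fold b) O k ω) x - μT x) 2 (covLaw P g e t)) fun _ => 1
  ctl : IsLittleOP Pr (fun b ω => eLpNorm
    (fun x => μCh b (train (fold b) O k ω) x - μC x) 2 (covLaw P g e t)) fun _ => 1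
  rate : Negligible Pr fun b ω => √(b : ℝ) *
    ((eLpNorm (fun x => (ηh b (train (fold b) O k ω)).odds x - r x) 2 (covLaw P g e t)).toReal
      * (eLpNorm (fun x => μCh b (train (fold b) O k ω) x - μC x) 2 (covLaw P g e t)).toReal)
  weights : Tight Pr fun b ω => √(b : ℝ) * (P.real (period s)
      / foldMean (fold b) (sample K b O ω) k (fun o => ind (exposed e) o * ind (period s) o)
    - 1 / foldMean (fold b) (sample K b O ω) k (ind (exposed e)))

namespace LearnedSlice

variable {P : Measure (Obs 𝒳)} {Pr : Measure Ω} [IsProbabilityMeasure P] [IsProbabilityMeasure Pr]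
  {O : ℕ → Ω → Obs 𝒳} {K : ℕ} {fold : (b : ℕ) → Fin (K * b) → Fin K} {g : ControlGroup} {e t : ℕ}
  {c : ℝ} {η : Nuisance 𝒳} {k : Fin K} {s : ℕ} {V : Obs 𝒳 → ℝ} {μT μC : 𝒳 → ℝ}
  {ηh : (b : ℕ) → ({i : Fin (K * b) // fold b i ≠ k} → Obs 𝒳) → Nuisance 𝒳}
  {μTh μCh : (b : ℕ) → ({i : Fin (K * b) // fold b i ≠ k} → Obs 𝒳) → 𝒳 → ℝ}

theorem meas_odds_sub (hL : LearnedSlice P Pr O fold g e t c k s η.odds μT μC ηh μTh μCh)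
    (hP : OverlapDesign P g e t c η) (b : ℕ) :
    Measurable (Function.uncurry fun θ x => (ηh b θ).odds x - η.odds x) :=
  (hL.meas_odds b).sub (hP.measurable_odds.comp measurable_snd)

theorem meas_trt_sub (hL : LearnedSlice P Pr O fold g e t c k s η.odds μT μC ηh μTh μCh)
    (hV : RegressionPair P g e t s V μT μC) (b : ℕ) :
    Measurable (Function.uncurry fun θ x => μTh b θ x - μT x) :=
  (hL.meas_trt b).sub (hV.trt.1.comp measurable_snd)

theorem meas_ctl_sub (hL : LearnedSlice P Pr O fold g e t c k s η.odds μT μC ηh μTh μCh)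
    (hV : RegressionPair P g e t s V μT μC) (b : ℕ) :
    Measurable (Function.uncurry fun θ x => μCh b θ x - μC x) :=
  (hL.meas_ctl b).sub (hV.ctl.1.comp measurable_snd)

theorem measurable_ind_control_period : Measurable fun o : Obs 𝒳 =>
    ind (control g e t) o * ind (period s) o :=
  (measurable_ind (measurableSet_control g e t)).mul (measurable_ind (measurableSet_period s))

theorem abs_ind_mul_le {A : Set (Obs 𝒳)} {ψ : Obs 𝒳 → ℝ} (hψ : ∀ o, |ψ o| ≤ 1) (o : Obs 𝒳) :
    |ind A o * ψ o| ≤ ind A o := by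
  by_cases ho : o ∈ A
  · simpa [ind_of_mem ho] using hψ o
  · simp [ind_of_notMem ho]

/-- A bounded function supported on `A` times a learned function of the covariates that tends to
zero in `L²`. -/
theorem isLittleOP_of_bounded {A : Set (Obs 𝒳)} (hA : covMeasure P A ≤ covLaw P g e t)
    (hAm : MeasurableSet A) {ψ : Obs 𝒳 → ℝ} (hψ : ∀ o, |ψ o| ≤ 1) {h : ℕ → Ω → 𝒳 → ℝ}
    (hh : ∀ b ω, Measurable (h b ω))
    (hsmall : IsLittleOP Pr (fun b ω => eLpNorm (h b ω) 2 (covLaw P g e t)) fun _ => 1) :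
    IsLittleOP Pr (fun b ω => ∫⁻ o, ‖ind A o * ψ o * h b ω (obsX o)‖ₑ ^ 2 ∂P) fun _ => 1 :=
  hsmall.sq.of_le (HighProb.of_forall fun b ω =>
    lintegral_sq_le_of_abs_le_ind hA hAm (abs_ind_mul_le hψ) (hh b ω))

/-- The factor `ψ` will be `1`, `1{T = s}` or the centred `1{T = s} - λ_s`. -/
theorem small_trt (hL : LearnedSlice P Pr O fold g e t c k s η.odds μT μC ηh μTh μCh)
    (hV : RegressionPair P g e t s V μT μC) {ψ : Obs 𝒳 → ℝ} (hψ : ∀ o, |ψ o| ≤ 1) :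
    IsLittleOP Pr (fun b ω => ∫⁻ o, ‖ind (exposed e) o * ψ o *
      (μTh b (train (fold b) O k ω) (obsX o) - μT (obsX o))‖ₑ ^ 2 ∂P) fun _ => 1 :=
  isLittleOP_of_bounded (covMeasure_exposed_le g e t) (measurableSet_exposed e) hψ
    (h := fun b ω x => μTh b (train (fold b) O k ω) x - μT x)
    (fun b ω => (hL.meas_trt_sub hV b).of_uncurry_left (x := train (fold b) O k ω)) hL.trt

theorem small_ctl (hL : LearnedSlice P Pr O fold g e t c k s η.odds μT μC ηh μTh μCh)
    (hV : RegressionPair P g e t s V μT μC) {ψ : Obs 𝒳 → ℝ} (hψ : ∀ o, |ψ o| ≤ 1) :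
    IsLittleOP Pr (fun b ω => ∫⁻ o, ‖ind (exposed e) o * ψ o *
      (μCh b (train (fold b) O k ω) (obsX o) - μC (obsX o))‖ₑ ^ 2 ∂P) fun _ => 1 :=
  isLittleOP_of_bounded (covMeasure_exposed_le g e t) (measurableSet_exposed e) hψ
    (h := fun b ω x => μCh b (train (fold b) O k ω) x - μC x)
    (fun b ω => (hL.meas_ctl_sub hV b).of_uncurry_left (x := train (fold b) O k ω)) hL.ctl

theorem small_odds (hL : LearnedSlice P Pr O fold g e t c k s η.odds μT μC ηh μTh μCh)
    (hP : OverlapDesign P g e t c η) :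
    IsLittleOP Pr (fun b ω => ∫⁻ o, ‖ind (control g e t) o * ind (period s) o *
      ((ηh b (train (fold b) O k ω)).odds (obsX o) - η.odds (obsX o))‖ₑ ^ 2 ∂P) fun _ => 1 :=
  isLittleOP_of_bounded (covMeasure_control_le g e t) (measurableSet_control g e t)
    (abs_ind_le_one _) (h := fun b ω x => (ηh b (train (fold b) O k ω)).odds x - η.odds x)
    (fun b ω => (hL.meas_odds_sub hP b).of_uncurry_left (x := train (fold b) O k ω)) hL.odds

theorem ae_odds_sub (hL : LearnedSlice P Pr O fold g e t c k s η.odds μT μC ηh μTh μCh)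
    (hP : OverlapDesign P g e t c η) : HighProb Pr fun b ω => ∀ᵐ x ∂(covLaw P g e t),
      |(ηh b (train (fold b) O k ω)).odds x - η.odds x| ≤ 2 * c⁻¹ := by
  refine hL.overlap.mono (Eventually.of_forall fun b ω hb => ?_)
  have h : ∀ᵐ x ∂(covLaw P g e t), |η.odds x| ≤ c⁻¹ := by
    rw [covLaw_eq]
    exact Measure.smul_absolutelyContinuous (hP.ae_odds.mono fun x hx => hx.2)
  filter_upwards [hb, h] with x h1 h2
  have := norm_sub_le ((ηh b (train (fold b) O k ω)).odds x) (η.odds x)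
  simp only [Real.norm_eq_abs] at this
  linarith

/-- The residual is only square integrable, so convergence of the odds in `L²` is not enough by
itself. The bound on the estimated odds given by overlap permits the truncation argument. -/
theorem small_residual (hL : LearnedSlice P Pr O fold g e t c k s η.odds μT μC ηh μTh μCh)
    (hP : OverlapDesign P g e t c η) (hV : RegressionPair P g e t s V μT μC) :
    IsLittleOP Pr (fun b ω => ∫⁻ o, ‖residual (control g e t) s V μC o *
      ((ηh b (train (fold b) O k ω)).odds (obsX o) - η.odds (obsX o))‖ₑ ^ 2 ∂P) fun _ => 1 :=
  isLittleOP_lintegral_mul_bounded (covMeasure_control_le g e t) (measurableSet_control g e t)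
    (measurable_residual (measurableSet_control g e t) hV.meas hV.ctl.1) (hV.memLp_residual_ctl hP)
    (fun o ho => by simp [residual, ind_of_notMem ho])
    (h := fun b ω x => (ηh b (train (fold b) O k ω)).odds x - η.odds x)
    (fun b ω => (hL.meas_odds_sub hP b).of_uncurry_left (x := train (fold b) O k ω))
    (by have := hP.c_pos; positivity) (hL.ae_odds_sub hP) hL.odds

theorem small_odds_ctl (hL : LearnedSlice P Pr O fold g e t c k s η.odds μT μC ηh μTh μCh)
    (hP : OverlapDesign P g e t c η) (hV : RegressionPair P g e t s V μT μC) :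
    IsLittleOP Pr (fun b ω => ∫⁻ o, ‖ind (control g e t) o * ind (period s) o *
      ((ηh b (train (fold b) O k ω)).odds (obsX o) *
        (μCh b (train (fold b) O k ω) (obsX o) - μC (obsX o)))‖ₑ ^ 2 ∂P) fun _ => 1 := by
  have hc := hP.c_pos
  refine isLittleOP_of_bounded (covMeasure_control_le g e t) (measurableSet_control g e t)
    (abs_ind_le_one _) (h := fun b ω x => (ηh b (train (fold b) O k ω)).odds x *
        (μCh b (train (fold b) O k ω) x - μC x))
    (fun b ω => ((hL.meas_odds b).of_uncurry_left (x := train (fold b) O k ω)).mul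
      ((hL.meas_ctl_sub hV b).of_uncurry_left (x := train (fold b) O k ω))) ?_
  refine (hL.ctl.const_mul (C := c⁻¹) (by positivity)).of_le
    (hL.overlap.mono (Eventually.of_forall fun b ω hb => ?_))
  refine eLpNorm_le_mul_eLpNorm_of_ae_le_mul ?_ 2
  filter_upwards [hb] with x hx
  rw [norm_mul]
  exact mul_le_mul_of_nonneg_right hx (norm_nonneg _)

/-- The learned nuisances are square integrable and bounded with probability tending to one. -/
theorem highProb_good (hL : LearnedSlice P Pr O fold g e t c k s η.odds μT μC ηh μTh μCh)
    (hP : OverlapDesign P g e t c η) : HighProb Pr fun b ω =>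
      eLpNorm (fun x => μTh b (train (fold b) O k ω) x - μT x) 2 (covLaw P g e t) ≠ ∞ ∧
      eLpNorm (fun x => μCh b (train (fold b) O k ω) x - μC x) 2 (covLaw P g e t) ≠ ∞ ∧
      eLpNorm (fun x => (ηh b (train (fold b) O k ω)).odds x - η.odds x) 2
        (covLaw P g e t) ≠ ∞ ∧
      ∀ᵐ x ∂(covLaw P g e t),
        |(ηh b (train (fold b) O k ω)).odds x - η.odds x| ≤ 2 * c⁻¹ :=
  hL.trt.highProb_ne_top.and (hL.ctl.highProb_ne_top.and (hL.odds.highProb_ne_top.and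
    (hL.ae_odds_sub hP)))

end LearnedSlice

end Expansion

/-! ### The control-group remainder as algebra of stochastic orders. -/

section Core

variable {Ω : Type*} [MeasurableSpace Ω] {Pr : Measure Ω}

/-- The second-order remainder of the control-group terms. -/
theorem negligible_control_remainder {d f H u rho rhoC β γ κ : ℕ → Ω → ℝ} {lam ρ ρC : ℝ}
    (hd : Negligible Pr fun b ω => √(b : ℝ) * (d b ω - lam * (β b ω + γ b ω)))
    (hβ : Negligible Pr fun b ω => √(b : ℝ) * β b ω)
    (hu : Negligible Pr fun b ω => √(b : ℝ) * (u b ω - γ b ω))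
    (hγ : Negligible Pr γ)
    (hγκ : Negligible Pr fun b ω => √(b : ℝ) * (γ b ω * κ b ω))
    (hf : Negligible Pr fun b ω => √(b : ℝ) * (f b ω - lam * κ b ω))
    (hH : Tight Pr fun b ω => √(b : ℝ) * H b ω)
    (hsum : ∀ b ω, rhoC b ω = lam * rho b ω + f b ω + H b ω)
    (hrho : Negligible Pr fun b ω => rho b ω - ρ) (hρ : ρ ≠ 0)
    (hrhoC : Negligible Pr fun b ω => rhoC b ω - ρC) (hρC : ρC ≠ 0) :
    Negligible Pr fun b ω => √(b : ℝ) * ((rhoC b ω)⁻¹ * d b ω - (rho b ω)⁻¹ * u b ω) := by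
  have hi := (hrho.inv_sub_inv hρ).tight_of_sub
  have hiC := (hrhoC.inv_sub_inv hρC).tight_of_sub
  -- In the application `u` and `d` are the empirical means of the control regression error on the
  -- exposed and on the reweighted controls. Their expectations are `γ` and `λ(β + γ)`, where `β` is
  -- the integral of the product of the two errors and `κ` that of the odds error. Here `λρ̂ - ρ̂C =
  -- -(f + H)`, and `f` is split into its fluctuation and `λκ`.
  have hlast : Negligible Pr fun b ω => √(b : ℝ) * (γ b ω * (lam * rho b ω - rhoC b ω)) := by
    have h1 := (hf.mul_tight hγ.tight).add ((hγ.mul_tight hH).add (hγκ.const_mul lam))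
    exact h1.neg.congr (HighProb.of_forall fun b ω => by rw [hsum]; ring)
  -- `d/ρ̂C - u/ρ̂ = (d - λ(β + γ))/ρ̂C + λβ/ρ̂C + γ(λρ̂ - ρ̂C)/(ρ̂ρ̂C) - (u - γ)/ρ̂`.
  have htot := ((hd.mul_tight hiC).add ((hβ.const_mul lam).mul_tight hiC)).add
    ((hlast.mul_tight (hi.mul hiC)).sub (hu.mul_tight hi))
  refine htot.congr (((hrho.highProb_ne_zero hρ).and (hrhoC.highProb_ne_zero hρC)).mono
    (Eventually.of_forall fun b ω hb => ?_))
  have h1 := hb.1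
  have h2 := hb.2
  field_simp
  ring

end Core

/-! ### Conditional means of the learned errors. -/

section Expansion

variable {𝒳 Ω : Type*} [MeasurableSpace 𝒳] [MeasurableSpace Ω]
  {P : Measure (Obs 𝒳)} {Pr : Measure Ω} [IsProbabilityMeasure P] [IsProbabilityMeasure Pr]
  {O : ℕ → Ω → Obs 𝒳} {K : ℕ} {fold : (b : ℕ) → Fin (K * b) → Fin K} {g : ControlGroup} {e t : ℕ}
  {c : ℝ} {η : Nuisance 𝒳} {k : Fin K} {s : ℕ} {V : Obs 𝒳 → ℝ} {μT μC : 𝒳 → ℝ}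
  {ηh : (b : ℕ) → ({i : Fin (K * b) // fold b i ≠ k} → Obs 𝒳) → Nuisance 𝒳}
  {μTh μCh : (b : ℕ) → ({i : Fin (K * b) // fold b i ≠ k} → Obs 𝒳) → 𝒳 → ℝ}

theorem FoldedSample.learned_mul (hS : FoldedSample P Pr O K fold) {φ : Obs 𝒳 → ℝ}
    (hφ : Measurable φ)
    {f : (b : ℕ) → ({i : Fin (K * b) // fold b i ≠ k} → Obs 𝒳) → 𝒳 → ℝ}
    (hf : ∀ b, Measurable (Function.uncurry (f b)))
    (hsmall : IsLittleOP Pr (fun b ω =>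
      ∫⁻ o, ‖φ o * f b (train (fold b) O k ω) (obsX o)‖ₑ ^ 2 ∂P) fun _ => 1) :
    (Negligible Pr fun b ω => √(b : ℝ) * (foldMean (fold b) (sample K b O ω) k
        (fun o => φ o * f b (train (fold b) O k ω) (obsX o))
      - ∫ o, φ o * f b (train (fold b) O k ω) (obsX o) ∂P)) ∧
    EmpSmall Pr O fold k fun b ω o => φ o * f b (train (fold b) O k ω) (obsX o) :=
  ⟨hS.negligible_fluctuation (h := fun b θ o => φ o * f b θ (obsX o))
      (fun b => measurable_uncurry_mul_comp hφ (hf b)) hsmall,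
    hS.negligible_foldMean_sq (h := fun b θ o => φ o * f b θ (obsX o))
      (fun b => measurable_uncurry_mul_comp hφ (hf b)) hsmall⟩

theorem isProbabilityMeasure_covLaw (hP : OverlapDesign P g e t c η) :
    IsProbabilityMeasure (covLaw P g e t) :=
  have := cond_isProbabilityMeasure hP.measure_slice_ne_zero
  Measure.isProbabilityMeasure_map measurable_obsX.aemeasurable

theorem abs_integral_le {ν : Measure 𝒳} (hP : OverlapDesign P g e t c η)
    (hν : ν ≤ covLaw P g e t) {f : 𝒳 → ℝ} (hf : Measurable f)
    (hf' : eLpNorm f 2 (covLaw P g e t) ≠ ∞) :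
    |∫ x, f x ∂ν| ≤ (eLpNorm f 2 (covLaw P g e t)).toReal := by
  have := isProbabilityMeasure_covLaw hP
  have h1 : eLpNorm (fun _ : 𝒳 => (1 : ℝ)) 2 (covLaw P g e t) = 1 := by
    rw [eLpNorm_const' _ (by norm_num) (by norm_num)]; simp
  have h := abs_integral_mul_le hν hf (measurable_const (a := (1 : ℝ))) hf' (by rw [h1]; simp)
  rw [h1] at h
  simpa only [mul_one, ENNReal.toReal_one] using h

theorem memLp_two_ind_mul {A : Set (Obs 𝒳)} (hA : MeasurableSet A) (B : Set (Obs 𝒳))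
    (hB : MeasurableSet B) : MemLp (fun o => ind A o * ind B o) 2 P := by
  simp only [ind_mul_ind]
  exact (memLp_const (1 : ℝ)).indicator (hA.inter hB)

theorem memLp_two_ind {A : Set (Obs 𝒳)} (hA : MeasurableSet A) : MemLp (ind A) 2 P :=
  (memLp_const (1 : ℝ)).indicator hA

namespace LearnedSlice

/-- `1{T = s} - λ_s` is uncorrelated with every integrable function of `(E, X)`, so the error of the
treated regression causes no bias here, whatever its rate. The restriction to high probability is
for integrability. -/
theorem integral_centered_trt (hL : LearnedSlice P Pr O fold g e t c k s η.odds μT μC ηh μTh μCh)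
    (hP : OverlapDesign P g e t c η) (hV : RegressionPair P g e t s V μT μC) :
    HighProb Pr fun b ω => ∫ o, ind (exposed e) o * (ind (period s) o - P.real (period s)) *
      (μTh b (train (fold b) O k ω) (obsX o) - μT (obsX o)) ∂P = 0 := by
  refine (hL.highProb_good hP).mono (Eventually.of_forall fun b ω hb => ?_)
  have hum := (hL.meas_trt_sub hV b).of_uncurry_left (x := train (fold b) O k ω)
  set u : 𝒳 → ℝ := fun x => μTh b (train (fold b) O k ω) x - μT x with hu
  have hint : Integrable u (covMeasure P (exposed e)) :=
    MemLp.integrable one_le_two (MemLp.mono_measure (covMeasure_exposed_le g e t)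
      ⟨hum.aestronglyMeasurable, lt_top_iff_ne_top.2 hb.1⟩)
  have hE := measurableSet_exposed (𝒳 := 𝒳) e
  have hI : Integrable (fun o => ind (exposed e) o * u (obsX o)) P := by
    rw [ind_mul, integrable_indicator_iff hE]
    exact (integrable_map_measure hum.aestronglyMeasurable measurable_obsX.aemeasurable).1 hint
  have hI2 : Integrable (fun o => ind (exposed e) o * ind (period s) o * u (obsX o)) P := by
    refine (hI.indicator (measurableSet_period s)).congr (Eventually.of_forall fun o => ?_)
    rw [← ind_mul]
    ring
  calc _ = ∫ o, (ind (exposed e) o * ind (period s) o * u (obsX o)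
        - P.real (period s) * (ind (exposed e) o * u (obsX o))) ∂P := by
        congr 1; ext o; rw [hu]; ring
    _ = 0 := by
        rw [integral_sub hI2 (hI.const_mul _), integral_const_mul,
          hP.integral_exposed_period s hum, integral_covMeasure hE hum, sub_self]

theorem abs_integral_ctl_le (hL : LearnedSlice P Pr O fold g e t c k s η.odds μT μC ηh μTh μCh)
    (hP : OverlapDesign P g e t c η) (hV : RegressionPair P g e t s V μT μC) :
    HighProb Pr fun b ω =>
      |∫ x, (μCh b (train (fold b) O k ω) x - μC x) ∂(covMeasure P (exposed e))|
        ≤ (eLpNorm (fun x => μCh b (train (fold b) O k ω) x - μC x) 2 (covLaw P g e t)).toReal :=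
  (hL.highProb_good hP).mono (Eventually.of_forall fun b ω hb =>
    abs_integral_le hP (covMeasure_exposed_le g e t)
      ((hL.meas_ctl_sub hV b).of_uncurry_left (x := train (fold b) O k ω)) hb.2.1)

theorem abs_integral_odds_le (hL : LearnedSlice P Pr O fold g e t c k s η.odds μT μC ηh μTh μCh)
    (hP : OverlapDesign P g e t c η) :
    HighProb Pr fun b ω =>
      |∫ x, ((ηh b (train (fold b) O k ω)).odds x - η.odds x) ∂(covMeasure P (control g e t))|
        ≤ (eLpNorm (fun x => (ηh b (train (fold b) O k ω)).odds x - η.odds x) 2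
          (covLaw P g e t)).toReal :=
  (hL.highProb_good hP).mono (Eventually.of_forall fun b ω hb =>
    abs_integral_le hP (covMeasure_control_le g e t)
      ((hL.meas_odds_sub hP b).of_uncurry_left (x := train (fold b) O k ω)) hb.2.2.1)

theorem abs_integral_odds_ctl_le
    (hL : LearnedSlice P Pr O fold g e t c k s η.odds μT μC ηh μTh μCh)
    (hP : OverlapDesign P g e t c η) (hV : RegressionPair P g e t s V μT μC) :
    HighProb Pr fun b ω =>
      |∫ x, ((ηh b (train (fold b) O k ω)).odds x - η.odds x)
          * (μCh b (train (fold b) O k ω) x - μC x) ∂(covMeasure P (control g e t))|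
        ≤ (eLpNorm (fun x => (ηh b (train (fold b) O k ω)).odds x - η.odds x) 2
          (covLaw P g e t)).toReal
          * (eLpNorm (fun x => μCh b (train (fold b) O k ω) x - μC x) 2 (covLaw P g e t)).toReal :=
  (hL.highProb_good hP).mono (Eventually.of_forall fun b ω hb =>
    abs_integral_mul_le (covMeasure_control_le g e t)
      ((hL.meas_odds_sub hP b).of_uncurry_left (x := train (fold b) O k ω))
      ((hL.meas_ctl_sub hV b).of_uncurry_left (x := train (fold b) O k ω)) hb.2.2.1 hb.2.1)

/-- Split the estimated odds into their error and the truth. The error gives the product bias, and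
the true odds turn the control integral into an integral over the exposed. -/
theorem integral_odds_mul_ctl
    (hL : LearnedSlice P Pr O fold g e t c k s η.odds μT μC ηh μTh μCh)
    (hP : OverlapDesign P g e t c η) (hV : RegressionPair P g e t s V μT μC) :
    HighProb Pr fun b ω => ∫ o, ind (control g e t) o * ind (period s) o *
      ((ηh b (train (fold b) O k ω)).odds (obsX o) *
        (μCh b (train (fold b) O k ω) (obsX o) - μC (obsX o))) ∂P
      = P.real (period s) *
        ((∫ x, ((ηh b (train (fold b) O k ω)).odds x - η.odds x)
          * (μCh b (train (fold b) O k ω) x - μC x) ∂(covMeasure P (control g e t)))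
        + ∫ x, (μCh b (train (fold b) O k ω) x - μC x) ∂(covMeasure P (exposed e))) := by
  refine (hL.highProb_good hP).mono (Eventually.of_forall fun b ω hb => ?_)
  have hum := (hL.meas_ctl_sub hV b).of_uncurry_left (x := train (fold b) O k ω)
  have hdm := (hL.meas_odds_sub hP b).of_uncurry_left (x := train (fold b) O k ω)
  have hrm := (hL.meas_odds b).of_uncurry_left (x := train (fold b) O k ω)
  have hu2 : MemLp (fun x => μCh b (train (fold b) O k ω) x - μC x) 2
      (covMeasure P (control g e t)) := MemLp.mono_measure (covMeasure_control_le g e t)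
      ⟨hum.aestronglyMeasurable, lt_top_iff_ne_top.2 hb.2.1⟩
  have hd2 : MemLp (fun x => (ηh b (train (fold b) O k ω)).odds x - η.odds x) 2
      (covMeasure P (control g e t)) := MemLp.mono_measure (covMeasure_control_le g e t)
      ⟨hdm.aestronglyMeasurable, lt_top_iff_ne_top.2 hb.2.2.1⟩
  have hi1 : Integrable (fun x => ((ηh b (train (fold b) O k ω)).odds x - η.odds x)
      * (μCh b (train (fold b) O k ω) x - μC x)) (covMeasure P (control g e t)) :=
    hd2.integrable_mul hu2
  have hi2 : Integrable (fun x => η.odds x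
      * (μCh b (train (fold b) O k ω) x - μC x)) (covMeasure P (control g e t)) := by
    refine (hu2.integrable one_le_two).bdd_mul (c := c⁻¹)
      hP.measurable_odds.aestronglyMeasurable ?_
    exact OverlapDesign.control_absolutelyContinuous (hP.ae_odds.mono fun x hx => hx.2)
  rw [hP.integral_control_period s (f := fun x => (ηh b (train (fold b) O k ω)).odds x *
        (μCh b (train (fold b) O k ω) x - μC x)) (hrm.mul hum),
    hP.integral_exposed_eq, ← integral_add hi1 hi2]
  congr 2
  ext x
  ring

theorem integral_residual_odds
    (hL : LearnedSlice P Pr O fold g e t c k s η.odds μT μC ηh μTh μCh)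
    (hP : OverlapDesign P g e t c η) (hV : RegressionPair P g e t s V μT μC) :
    HighProb Pr fun b ω => ∫ o, residual (control g e t) s V μC o *
      ((ηh b (train (fold b) O k ω)).odds (obsX o) - η.odds (obsX o)) ∂P = 0 :=
  (hL.highProb_good hP).mono (Eventually.of_forall fun b ω hb =>
    hV.integral_residual_ctl_mul hP
      ((hL.meas_odds_sub hP b).of_uncurry_left (x := train (fold b) O k ω))
      (Measure.absolutelyContinuous_of_le (covMeasure_control_le g e t) hb.2.2.2))

end LearnedSlice

end Expansion

/-! ### Assembling the expansion of one period. -/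

section Expansion

variable {𝒳 Ω : Type*} [MeasurableSpace 𝒳] [MeasurableSpace Ω]
  {P : Measure (Obs 𝒳)} {Pr : Measure Ω} [IsProbabilityMeasure P] [IsProbabilityMeasure Pr]
  {O : ℕ → Ω → Obs 𝒳} {K : ℕ} {fold : (b : ℕ) → Fin (K * b) → Fin K} {g : ControlGroup} {e t : ℕ}
  {c : ℝ} {η : Nuisance 𝒳} {k : Fin K} {s : ℕ} {V : Obs 𝒳 → ℝ} {μT μC : 𝒳 → ℝ}
  {ηh : (b : ℕ) → ({i : Fin (K * b) // fold b i ≠ k} → Obs 𝒳) → Nuisance 𝒳}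
  {μTh μCh : (b : ℕ) → ({i : Fin (K * b) // fold b i ≠ k} → Obs 𝒳) → 𝒳 → ℝ}

/-- The estimated weight denominators of fold `k`. -/
noncomputable def learnedNormalizers (O : ℕ → Ω → Obs 𝒳) (fold : (b : ℕ) → Fin (K * b) → Fin K)
    (g : ControlGroup) (e t : ℕ) (k : Fin K)
    (ηh : (b : ℕ) → ({i : Fin (K * b) // fold b i ≠ k} → Obs 𝒳) → Nuisance 𝒳) (b : ℕ) (ω : Ω) :
    Normalizers :=
  normalizers (foldMean (fold b) (sample K b O ω) k) g e t (ηh b (train (fold b) O k ω))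

theorem OverlapDesign.exposed_pos (hP : OverlapDesign P g e t c η) : P.real (exposed e) ≠ 0 :=
  (hP.c_pos.trans hP.lt_exposed).ne'

theorem OverlapDesign.exposed_period_pos (hP : OverlapDesign P g e t c η)
    (hs : P (period s) ≠ 0) : P.real (period s) * P.real (exposed e) ≠ 0 :=
  mul_ne_zero (by simp [measureReal_def, ENNReal.toReal_eq_zero_iff, hs]) hP.exposed_pos

theorem negligible_rho (hS : FoldedSample P Pr O K fold) :
    Negligible Pr fun b ω => (learnedNormalizers O fold g e t k ηh b ω).rho
      - P.real (exposed e) := by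
  have h := hS.negligible_foldMean_sub k (measurable_ind (measurableSet_exposed (𝒳 := 𝒳) e))
    (memLp_two_ind (measurableSet_exposed e))
  rwa [integral_ind (measurableSet_exposed e)] at h

theorem negligible_rhoTrt (hS : FoldedSample P Pr O K fold) (hP : OverlapDesign P g e t c η) :
    Negligible Pr fun b ω => (learnedNormalizers O fold g e t k ηh b ω).rhoTrt s
      - P.real (period s) * P.real (exposed e) := by
  have h := hS.negligible_foldMean_sub k
    ((measurable_ind (measurableSet_exposed (𝒳 := 𝒳) e)).mul
      (measurable_ind (measurableSet_period s)))
    (memLp_two_ind_mul (measurableSet_exposed e) _ (measurableSet_period s))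
  have h2 : ∫ o, ind (exposed e) o * ind (period s) o ∂P
      = P.real (period s) * P.real (exposed e) := hP.popNormalizers_rhoTrt s
  simp only [Pi.mul_apply] at h
  rwa [h2] at h

theorem memLp_ind_odds (hP : OverlapDesign P g e t c η) :
    MemLp (fun o => ind (control g e t) o * ind (period s) o * η.odds (obsX o)) 2 P :=
  hP.memLp_mul_odds (memLp_two_ind_mul (measurableSet_control g e t) _ (measurableSet_period s))
    fun o ho => by rw [ind_of_notMem ho, zero_mul]

theorem measurable_ind_odds (hP : OverlapDesign P g e t c η) :
    Measurable fun o : Obs 𝒳 => ind (control g e t) o * ind (period s) o * η.odds (obsX o) :=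
  LearnedSlice.measurable_ind_control_period.mul (hP.measurable_odds.comp measurable_obsX)

namespace LearnedSlice

/-- The control normalizer is compared with `λ_s ρ̂` rather than with its limit: the difference is
then an odds error plus the fluctuation of a fixed function of mean zero. -/
theorem rhoCtl_eq (P : Measure (Obs 𝒳)) (η : Nuisance 𝒳) (b : ℕ) (ω : Ω) :
    (learnedNormalizers O fold g e t k ηh b ω).rhoCtl s
      = P.real (period s) * (learnedNormalizers O fold g e t k ηh b ω).rho
        + foldMean (fold b) (sample K b O ω) k (fun o => ind (control g e t) o * ind (period s) o *
          ((ηh b (train (fold b) O k ω)).odds (obsX o) - η.odds (obsX o)))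
        + foldMean (fold b) (sample K b O ω) k (fun o =>
          ind (control g e t) o * ind (period s) o * η.odds (obsX o)
            - P.real (period s) * ind (exposed e) o) := by
  simp only [learnedNormalizers, normalizers]
  rw [← foldMean_const_mul, ← foldMean_add, ← foldMean_add]
  congr 1
  ext o
  ring

theorem negligible_rhoCtl (hL : LearnedSlice P Pr O fold g e t c k s η.odds μT μC ηh μTh μCh)
    (hS : FoldedSample P Pr O K fold) (hP : OverlapDesign P g e t c η) :
    Negligible Pr fun b ω => (learnedNormalizers O fold g e t k ηh b ω).rhoCtl s
      - P.real (period s) * P.real (exposed e) := by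
  have h1 := (hS.learned_mul measurable_ind_control_period (hL.meas_odds_sub hP)
    (hL.small_odds hP)).2.negligible_foldMean hS
  have h2 := hS.negligible_foldMean_sub k (measurable_ind_odds (s := s) hP) (memLp_ind_odds hP)
  have h3 : ∫ o, ind (control g e t) o * ind (period s) o * η.odds (obsX o) ∂P
      = P.real (period s) * P.real (exposed e) := hP.popNormalizers_rhoCtl s
  rw [h3] at h2
  refine (h1.add h2).congr (HighProb.of_forall fun b ω => ?_)
  simp only [learnedNormalizers, normalizers]
  rw [add_sub_assoc', ← foldMean_add]
  congr 2
  ext o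
  ring

theorem empSmall_trt (hL : LearnedSlice P Pr O fold g e t c k s η.odds μT μC ηh μTh μCh)
    (hS : FoldedSample P Pr O K fold) (hV : RegressionPair P g e t s V μT μC) :
    EmpSmall Pr O fold k fun b ω o => ind (exposed e) o *
      (μTh b (train (fold b) O k ω) (obsX o) - μT (obsX o)) := by
  have h := hL.small_trt hV (ψ := fun _ => 1) (by simp)
  simp only [mul_one] at h
  exact (hS.learned_mul (measurable_ind (measurableSet_exposed e)) (hL.meas_trt_sub hV) h).2

theorem learned_ctl (hL : LearnedSlice P Pr O fold g e t c k s η.odds μT μC ηh μTh μCh)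
    (hS : FoldedSample P Pr O K fold) (hV : RegressionPair P g e t s V μT μC) :
    (Negligible Pr fun b ω => √(b : ℝ) * (foldMean (fold b) (sample K b O ω) k
        (fun o => ind (exposed e) o * (μCh b (train (fold b) O k ω) (obsX o) - μC (obsX o)))
      - ∫ x, (μCh b (train (fold b) O k ω) x - μC x) ∂(covMeasure P (exposed e)))) ∧
    EmpSmall Pr O fold k fun b ω o => ind (exposed e) o *
      (μCh b (train (fold b) O k ω) (obsX o) - μC (obsX o)) := by
  have h := hL.small_ctl hV (ψ := fun _ => 1) (by simp)
  simp only [mul_one] at h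
  have h2 := hS.learned_mul (measurable_ind (measurableSet_exposed e)) (hL.meas_ctl_sub hV) h
  refine ⟨h2.1.congr (HighProb.of_forall fun b ω => ?_), h2.2⟩
  rw [← integral_covMeasure (measurableSet_exposed e)
    ((hL.meas_ctl_sub hV b).of_uncurry_left (x := train (fold b) O k ω))]

theorem negligible_centered_trt
    (hL : LearnedSlice P Pr O fold g e t c k s η.odds μT μC ηh μTh μCh)
    (hS : FoldedSample P Pr O K fold) (hP : OverlapDesign P g e t c η)
    (hV : RegressionPair P g e t s V μT μC) :
    Negligible Pr fun b ω => √(b : ℝ) * foldMean (fold b) (sample K b O ω) k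
        (fun o => ind (exposed e) o * (ind (period s) o - P.real (period s)) *
          (μTh b (train (fold b) O k ω) (obsX o) - μT (obsX o))) := by
  have hψ : ∀ o : Obs 𝒳, |ind (period s) o - P.real (period s)| ≤ 1 := fun o => by
    have h0 : 0 ≤ P.real (period s) := measureReal_nonneg
    have h1 : P.real (period s) ≤ 1 := measureReal_le_one
    by_cases ho : o ∈ period s
    · rw [ind_of_mem ho, abs_le]; constructor <;> linarith
    · rw [ind_of_notMem ho, abs_le]; constructor <;> linarith
  have h := hS.learned_mul ((measurable_ind (measurableSet_exposed e)).mul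
    ((measurable_ind (measurableSet_period s)).sub measurable_const)) (hL.meas_trt_sub hV)
    (hL.small_trt hV hψ)
  refine h.1.congr ((hL.integral_centered_trt hP hV).mono (Eventually.of_forall fun b ω hb => ?_))
  simp only [Pi.mul_apply, Pi.sub_apply]
  rw [hb, sub_zero]

/-- Orthogonality in the control nuisances: the two means agree to first order, and the remaining
biases are products of an odds error and a regression error. -/
theorem negligible_ctl_remainder
    (hL : LearnedSlice P Pr O fold g e t c k s η.odds μT μC ηh μTh μCh)
    (hS : FoldedSample P Pr O K fold) (hP : OverlapDesign P g e t c η)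
    (hV : RegressionPair P g e t s V μT μC) :
    Negligible Pr fun b ω => √(b : ℝ) *
      (((learnedNormalizers O fold g e t k ηh b ω).rhoCtl s)⁻¹
          * foldMean (fold b) (sample K b O ω) k (fun o => ind (control g e t) o * ind (period s) o *
            ((ηh b (train (fold b) O k ω)).odds (obsX o) *
              (μCh b (train (fold b) O k ω) (obsX o) - μC (obsX o))))
        - ((learnedNormalizers O fold g e t k ηh b ω).rho)⁻¹
          * foldMean (fold b) (sample K b O ω) k (fun o => ind (exposed e) o *
            (μCh b (train (fold b) O k ω) (obsX o) - μC (obsX o)))) := by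
  have hd := hS.learned_mul measurable_ind_control_period
    (f := fun b θ x => (ηh b θ).odds x * (μCh b θ x - μC x)) (fun b => (hL.meas_odds b).mul (hL.meas_ctl_sub hV b)) (hL.small_odds_ctl hP hV)
  have hf := hS.learned_mul measurable_ind_control_period (hL.meas_odds_sub hP) (hL.small_odds hP)
  have hH := hS.tight_fluctuation k ((measurable_ind_odds (s := s) hP).sub
    ((measurable_ind (measurableSet_exposed e)).const_mul (P.real (period s))))
    ((memLp_ind_odds (s := s) hP).sub
      ((memLp_two_ind (measurableSet_exposed e)).const_mul (P.real (period s))))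
  have hH0 : ∫ o, (ind (control g e t) o * ind (period s) o * η.odds (obsX o)
      - P.real (period s) * ind (exposed e) o) ∂P = 0 := by
    have h3 : ∫ o, ind (control g e t) o * ind (period s) o * η.odds (obsX o) ∂P
      = P.real (period s) * P.real (exposed e) := hP.popNormalizers_rhoCtl s
    rw [integral_sub ((memLp_ind_odds hP).integrable one_le_two)
      (((memLp_two_ind (measurableSet_exposed e)).const_mul (P.real (period s))).integrable
        one_le_two), h3, integral_const_mul, integral_ind (measurableSet_exposed e), sub_self]
  refine negligible_control_remainder
    (γ := fun b ω => ∫ x, (μCh b (train (fold b) O k ω) x - μC x) ∂(covMeasure P (exposed e)))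
    (β := fun b ω => ∫ x, ((ηh b (train (fold b) O k ω)).odds x - η.odds x)
          * (μCh b (train (fold b) O k ω) x - μC x) ∂(covMeasure P (control g e t)))
    (κ := fun b ω => ∫ x, ((ηh b (train (fold b) O k ω)).odds x - η.odds x)
      ∂(covMeasure P (control g e t)))
    (lam := P.real (period s)) ?_ ?_ (hL.learned_ctl hS hV).1 ?_ ?_ ?_ ?_ (rhoCtl_eq P η)
    (negligible_rho hS) hP.exposed_pos (hL.negligible_rhoCtl hS hP) (hP.exposed_period_pos hV.pos)
  · refine hd.1.congr ((hL.integral_odds_mul_ctl hP hV).mono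
      (Eventually.of_forall fun b ω hb => ?_))
    rw [← hb]
  · refine hL.rate.of_le ((hL.abs_integral_odds_ctl_le hP hV).mono
      (Eventually.of_forall fun b ω hb => ?_))
    rw [abs_mul, abs_mul]
    exact mul_le_mul_of_nonneg_left (hb.trans (le_abs_self _)) (abs_nonneg _)
  · exact hL.ctl.negligible_toReal.of_le ((hL.abs_integral_ctl_le hP hV).mono
      (Eventually.of_forall fun b ω hb => hb.trans (le_abs_self _)))
  -- The estimated control normalizer creates a second product, of separate integrals, bounded by
  -- the same product of norms.
  · refine hL.rate.of_le (((hL.abs_integral_ctl_le hP hV).and (hL.abs_integral_odds_le hP)).mono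
      (Eventually.of_forall fun b ω hb => ?_))
    rw [abs_mul (√(b : ℝ)), abs_mul (√(b : ℝ))]
    refine mul_le_mul_of_nonneg_left ?_ (abs_nonneg _)
    rw [abs_mul, mul_comm]
    exact (mul_le_mul hb.2 hb.1 (abs_nonneg _) ENNReal.toReal_nonneg).trans (le_abs_self _)
  · refine hf.1.congr (HighProb.of_forall fun b ω => ?_)
    rw [hP.integral_control_period s ((hL.meas_odds_sub hP b).of_uncurry_left
      (x := train (fold b) O k ω))]
  · refine hH.of_le (HighProb.of_forall fun b ω => ?_)
    simp only [Pi.sub_apply]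
    rw [hH0, sub_zero]
    exact le_rfl

/-- The estimated score of period `s`, averaged over fold `k`, is asymptotically equivalent to the
true score up to the estimation of the normalizer of the last term. -/
theorem negligible_expansion (hL : LearnedSlice P Pr O fold g e t c k s η.odds μT μC ηh μTh μCh)
    (hS : FoldedSample P Pr O K fold) (hP : OverlapDesign P g e t c η)
    (hV : RegressionPair P g e t s V μT μC) :
    Negligible Pr fun b ω => √(b : ℝ) *
      (foldMean (fold b) (sample K b O ω) k
          (scoreAt (learnedNormalizers O fold g e t k ηh b ω) g e t s
            (ηh b (train (fold b) O k ω)).odds V (μTh b (train (fold b) O k ω))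
            (μCh b (train (fold b) O k ω)))
        - foldMean (fold b) (sample K b O ω) k
          (scoreAt (popNormalizers P g e t η) g e t s η.odds V μT μC)
        - (((learnedNormalizers O fold g e t k ηh b ω).rho)⁻¹ - (P.real (exposed e))⁻¹)
          * foldMean (fold b) (sample K b O ω) k
            (fun o => ind (exposed e) o * (μT (obsX o) - μC (obsX o)))) := by
  have hE := measurableSet_exposed (𝒳 := 𝒳) e
  have hC := measurableSet_control (𝒳 := 𝒳) g e t
  have hc := hP.c_pos
  have hpos := hP.exposed_period_pos hV.pos
  have hRT := hS.tight_fluctuation k (measurable_residual hE hV.meas hV.trt.1)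
    (hV.memLp_residual_trt hP)
  simp only [hV.integral_residual_trt hP, sub_zero] at hRT
  have hRC := hS.tight_fluctuation k
    (f := fun o => residual (control g e t) s V μC o * η.odds (obsX o))
    ((measurable_residual hC hV.meas hV.ctl.1).mul
    (hP.measurable_odds.comp measurable_obsX)) (hV.memLp_odds_mul_residual hP)
  simp only [hV.integral_residual_ctl_mul hP hP.measurable_odds
    (OverlapDesign.control_absolutelyContinuous (hP.ae_odds.mono fun x hx => hx.2)),
    sub_zero] at hRC
  have hcR := (hS.learned_mul (measurable_residual hC hV.meas hV.ctl.1) (hL.meas_odds_sub hP)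
    (hL.small_residual hP hV)).1.congr (Z := fun b ω => √(b : ℝ) *
      foldMean (fold b) (sample K b O ω) k (fun o => residual (control g e t) s V μC o *
        ((ηh b (train (fold b) O k ω)).odds (obsX o) - η.odds (obsX o))))
    ((hL.integral_residual_odds hP hV).mono (Eventually.of_forall fun b ω hb => by
      rw [hb, sub_zero]))
  have hiT := (negligible_rhoTrt (ηh := ηh) (k := k) (s := s) hS hP).inv_sub_inv hpos
  have hiC := (hL.negligible_rhoCtl hS hP).inv_sub_inv hpos
  -- The six remainders: treated residuals times a weight error, the centred treated error, the
  -- weight fluctuation times a consistent mean, control residuals times a weight error, control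
  -- residuals times an odds error, and the orthogonal control remainder.
  have htot := ((((hRT.mul_negligible hiT).sub
    ((hL.negligible_centered_trt hS hP hV).mul_tight hiT.tight_of_sub)).sub
    (hL.weights.mul_negligible ((hL.empSmall_trt hS hV).negligible_foldMean hS))).sub
    (hRC.mul_negligible hiC)).sub (hcR.mul_tight hiC.tight_of_sub) |>.add
    (hL.negligible_ctl_remainder hS hP hV)
  refine htot.congr (HighProb.of_forall fun b ω => ?_)
  -- In the treated error `1{T = s}` is written as its centred part plus `λ_s`. The `λ_s` part then
  -- meets the last term of the score with the coefficient `λ_s/ρ̂^trt_s - 1/ρ̂`.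
  have e1 : foldMean (fold b) (sample K b O ω) k
      (scoreAt (learnedNormalizers O fold g e t k ηh b ω) g e t s
            (ηh b (train (fold b) O k ω)).odds V (μTh b (train (fold b) O k ω))
            (μCh b (train (fold b) O k ω)))
      = ((learnedNormalizers O fold g e t k ηh b ω).rhoTrt s)⁻¹ *
        (foldMean (fold b) (sample K b O ω) k (residual (exposed e) s V μT)
          - foldMean (fold b) (sample K b O ω) k (fun o => ind (exposed e) o *
            (ind (period s) o - P.real (period s)) *
              (μTh b (train (fold b) O k ω) (obsX o) - μT (obsX o)))
          - P.real (period s) * foldMean (fold b) (sample K b O ω) k (fun o => ind (exposed e) o *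
              (μTh b (train (fold b) O k ω) (obsX o) - μT (obsX o))))
        - ((learnedNormalizers O fold g e t k ηh b ω).rhoCtl s)⁻¹ *
        (foldMean (fold b) (sample K b O ω) k
            (fun o => residual (control g e t) s V μC o * η.odds (obsX o))
          + foldMean (fold b) (sample K b O ω) k (fun o => residual (control g e t) s V μC o *
            ((ηh b (train (fold b) O k ω)).odds (obsX o) - η.odds (obsX o)))
          - foldMean (fold b) (sample K b O ω) k (fun o => ind (control g e t) o * ind (period s) o *
            ((ηh b (train (fold b) O k ω)).odds (obsX o) *
              (μCh b (train (fold b) O k ω) (obsX o) - μC (obsX o)))))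
        + ((learnedNormalizers O fold g e t k ηh b ω).rho)⁻¹ *
        (foldMean (fold b) (sample K b O ω) k
            (fun o => ind (exposed e) o * (μT (obsX o) - μC (obsX o)))
          + foldMean (fold b) (sample K b O ω) k (fun o => ind (exposed e) o *
              (μTh b (train (fold b) O k ω) (obsX o) - μT (obsX o)))
          - foldMean (fold b) (sample K b O ω) k (fun o => ind (exposed e) o *
              (μCh b (train (fold b) O k ω) (obsX o) - μC (obsX o)))) := by
    simp only [← foldMean_const_mul, ← foldMean_add, ← foldMean_sub]
    congr 1
    ext o
    simp only [scoreAt, residual]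
    ring
  have e2 : foldMean (fold b) (sample K b O ω) k
      (scoreAt (popNormalizers P g e t η) g e t s η.odds V μT μC)
      = (P.real (period s) * P.real (exposed e))⁻¹ *
        foldMean (fold b) (sample K b O ω) k (residual (exposed e) s V μT)
        - (P.real (period s) * P.real (exposed e))⁻¹ * foldMean (fold b) (sample K b O ω) k
            (fun o => residual (control g e t) s V μC o * η.odds (obsX o))
        + (P.real (exposed e))⁻¹ * foldMean (fold b) (sample K b O ω) k
            (fun o => ind (exposed e) o * (μT (obsX o) - μC (obsX o))) := by
    simp only [← foldMean_const_mul, ← foldMean_add, ← foldMean_sub]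
    congr 1
    ext o
    simp only [scoreAt, hP.popNormalizers_rhoTrt, hP.popNormalizers_rhoCtl,
      OverlapDesign.popNormalizers_rho]
  rw [e1, e2]
  have e3 : foldMean (fold b) (sample K b O ω) k
      (fun o => ind (exposed e) o * ind (period s) o)
      = (learnedNormalizers O fold g e t k ηh b ω).rhoTrt s := rfl
  have e4 : foldMean (fold b) (sample K b O ω) k (ind (exposed e))
      = (learnedNormalizers O fold g e t k ηh b ω).rho := rfl
  rw [e3, e4]
  ring

/-- The estimated score of period `s` is consistent in empirical `L²`. -/
theorem empSmall_score_sub (hL : LearnedSlice P Pr O fold g e t c k s η.odds μT μC ηh μTh μCh)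
    (hS : FoldedSample P Pr O K fold) (hP : OverlapDesign P g e t c η)
    (hV : RegressionPair P g e t s V μT μC) :
    EmpSmall Pr O fold k fun b ω o =>
      scoreAt (learnedNormalizers O fold g e t k ηh b ω) g e t s
            (ηh b (train (fold b) O k ω)).odds V (μTh b (train (fold b) O k ω))
            (μCh b (train (fold b) O k ω)) o
        - scoreAt (popNormalizers P g e t η) g e t s η.odds V μT μC o := by
  have hE := measurableSet_exposed (𝒳 := 𝒳) e
  have hC := measurableSet_control (𝒳 := 𝒳) g e t
  have hpos := hP.exposed_period_pos hV.pos
  have hiT := (negligible_rhoTrt (ηh := ηh) (k := k) (s := s) hS hP).inv_sub_inv hpos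
  have hiC := (hL.negligible_rhoCtl hS hP).inv_sub_inv hpos
  have hi := (negligible_rho (ηh := ηh) (k := k) (e := e) (g := g) (t := t) hS).inv_sub_inv
    hP.exposed_pos
  have hT := hL.small_trt hV (ψ := ind (period s)) (abs_ind_le_one _)
  have h1 := EmpSmall.of_negligible_mul (k := k) hS hiT (measurable_residual hE hV.meas hV.trt.1)
    (hV.memLp_residual_trt hP)
  have h2 := (hS.learned_mul (φ := fun o => ind (exposed e) o * ind (period s) o)
    (f := fun b θ x => μTh b θ x - μT x) ((measurable_ind hE).mul (measurable_ind (measurableSet_period s)))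
    (hL.meas_trt_sub hV) hT).2.tight_mul hiT.tight_of_sub
  have h3 := EmpSmall.of_negligible_mul (k := k) hS hiC
    (f := fun o => residual (control g e t) s V μC o * η.odds (obsX o)) ((measurable_residual hC hV.meas hV.ctl.1).mul
    (hP.measurable_odds.comp measurable_obsX)) (hV.memLp_odds_mul_residual hP)
  have h4 := (hS.learned_mul (f := fun b θ x => (ηh b θ).odds x - η.odds x) (measurable_residual hC hV.meas hV.ctl.1) (hL.meas_odds_sub hP)
    (hL.small_residual hP hV)).2.tight_mul hiC.tight_of_sub
  have h5 := (hS.learned_mul measurable_ind_control_period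
    (f := fun b θ x => (ηh b θ).odds x * (μCh b θ x - μC x)) (fun b => (hL.meas_odds b).mul (hL.meas_ctl_sub hV b))
    (hL.small_odds_ctl hP hV)).2.tight_mul hiC.tight_of_sub
  have h6 := EmpSmall.of_negligible_mul (k := k) hS hi
    (f := fun o => ind (exposed e) o * (μT (obsX o) - μC (obsX o))) ((measurable_ind hE).mul ((hV.trt.1.sub hV.ctl.1).comp measurable_obsX))
    (hV.memLp_contrast hP)
  have h7 := (hL.empSmall_trt hS hV).tight_mul hi.tight_of_sub
  have h8 := (hL.learned_ctl hS hV).2.tight_mul hi.tight_of_sub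
  -- Each summand is either a weight error times a fixed square integrable function or an estimated,
  -- hence tight, weight times a learned error.
  refine (((h1.sub h2).sub ((h3.add h4).sub h5)).add ((h6.add h7).sub h8)).congr fun b ω o => ?_
  simp only [scoreAt, hP.popNormalizers_rhoTrt, hP.popNormalizers_rhoCtl,
      OverlapDesign.popNormalizers_rho, residual]
  ring

end LearnedSlice

end Expansion

/-! ### Linear combinations of the two score components -/

section Mixed

variable {𝒳 : Type*}

/-- The variable `α Y + β D`. -/
def mixObs (α β : ℝ) (o : Obs 𝒳) : ℝ := α * obsY o + β * obsD o

/-- The regression function of `α Y + β D` among the exposed. -/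
def mixTrt (η : Nuisance 𝒳) (α β : ℝ) (s : ℕ) (x : 𝒳) : ℝ := α * η.mTrt s x + β * η.gTrt s x

/-- The regression function of `α Y + β D` among the controls. -/
def mixCtl (η : Nuisance 𝒳) (α β : ℝ) (s : ℕ) (x : 𝒳) : ℝ := α * η.mCtl s x + β * η.gCtl s x

/-- The score component of `α Y + β D`. -/
noncomputable def mixScore (N : Normalizers) (g : ControlGroup) (e t : ℕ) (η : Nuisance 𝒳) (α β : ℝ)
    (o : Obs 𝒳) : ℝ :=
  α * psiB N g e t η o + β * psiA N g e t η o

theorem psi_eq_mixScore (N : Normalizers) (g : ControlGroup) (e t : ℕ) (η : Nuisance 𝒳) (τ : ℝ)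
    (o : Obs 𝒳) : psi N g e t η τ o = mixScore N g e t η 1 (-τ) o := by
  simp only [psi, mixScore]; ring

theorem psiA_eq_mixScore (N : Normalizers) (g : ControlGroup) (e t : ℕ) (η : Nuisance 𝒳)
    (o : Obs 𝒳) : psiA N g e t η o = mixScore N g e t η 0 1 o := by
  simp only [mixScore]; ring

theorem psiB_eq_mixScore (N : Normalizers) (g : ControlGroup) (e t : ℕ) (η : Nuisance 𝒳)
    (o : Obs 𝒳) : psiB N g e t η o = mixScore N g e t η 1 0 o := by
  simp only [mixScore]; ring

/-- The periods are disjoint, so cross products of their indicators vanish and `joined` reduces to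
the regression of the period selected by the weight. -/
theorem mixScore_eq {e t : ℕ} (h : e - 1 ≠ t) (N : Normalizers) (g : ControlGroup)
    (η : Nuisance 𝒳) (α β : ℝ) (o : Obs 𝒳) :
    mixScore N g e t η α β o
      = scoreAt N g e t t η.odds (mixObs α β) (mixTrt η α β t) (mixCtl η α β t) o
        - scoreAt N g e t (e - 1) η.odds (mixObs α β) (mixTrt η α β (e - 1))
          (mixCtl η α β (e - 1)) o := by
  have h1 : ind (period t) o * ind (period (e - 1)) o = 0 := by
    by_cases ho : o ∈ period t
    · rw [ind_of_notMem (A := period (e - 1)), mul_zero]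
      intro ho'
      exact h (Eq.trans (Eq.symm ho') ho)
    · rw [ind_of_notMem ho, zero_mul]
  have h2 : ∀ s, ind (period s) o * ind (period s) o = ind (period s) o := fun s => by
    rw [ind_mul_ind, Set.inter_self]
  have key : ∀ (W a b : ℝ), ind (period t) o * (W - (ind (period (e - 1)) o * a
      + ind (period t) o * b)) = ind (period t) o * (W - b) ∧
      ind (period (e - 1)) o * (W - (ind (period (e - 1)) o * a + ind (period t) o * b))
        = ind (period (e - 1)) o * (W - a) := fun W a b =>
    ⟨by linear_combination (-a) * h1 - b * h2 t, by linear_combination (-b) * h1 - a * h2 (e - 1)⟩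
  have expand : ∀ (W a b x y z : ℝ),
      (x * ind (period t) o * y - x * ind (period (e - 1)) o * z)
        * (W - (ind (period (e - 1)) o * a + ind (period t) o * b))
      = x * y * (ind (period t) o * (W - b)) - x * z * (ind (period (e - 1)) o * (W - a)) :=
    fun W a b x y z => by
      linear_combination x * y * (key W a b).1 - x * z * (key W a b).2
  simp only [mixScore, psiB, psiA, scorePart, wTrt, wCtl, wTrtAt, wCtlAt, joined, didContrast,
    scoreAt, residual, mixObs, mixTrt, mixCtl, div_eq_mul_inv, mul_assoc]
  simp only [← mul_assoc]
  have eT : ∀ W a b : ℝ, _ := fun W a b => expand W a b (ind (exposed e) o) (N.rhoTrt t)⁻¹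
    (N.rhoTrt (e - 1))⁻¹
  have eC : ∀ W a b : ℝ, _ := fun W a b => expand W a b (ind (control g e t) o)
    (η.odds (obsX o) * (N.rhoCtl t)⁻¹) (η.odds (obsX o) * (N.rhoCtl (e - 1))⁻¹)
  simp only [← mul_assoc] at eT eC
  rw [eT, eT, eC, eC]
  ring

variable [MeasurableSpace 𝒳] {P : Measure (Obs 𝒳)} [IsProbabilityMeasure P] {g : ControlGroup}
  {e t s : ℕ} {c : ℝ} {η : Nuisance 𝒳}

theorem IsRegression.mix {V W : Obs 𝒳 → ℝ} {A : Set (Obs 𝒳)} {m n : 𝒳 → ℝ}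
    (hm : IsRegression P V A m) (hn : IsRegression P W A n) (hA : P A ≠ 0)
    (hV : Integrable V P) (hW : Integrable W P) (α β : ℝ) :
    IsRegression P (fun o => α * V o + β * W o) A (fun x => α * m x + β * n x) := by
  have hVQ : Integrable V (ProbabilityTheory.cond P A) :=
    memLp_one_iff_integrable.1 (memLp_cond hA (memLp_one_iff_integrable.2 hV.restrict))
  have hWQ : Integrable W (ProbabilityTheory.cond P A) :=
    memLp_one_iff_integrable.1 (memLp_cond hA (memLp_one_iff_integrable.2 hW.restrict))
  refine ⟨(hm.1.const_mul α).add (hn.1.const_mul β), ?_⟩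
  have h1 := condExp_add (hVQ.smul α) (hWQ.smul β)
    (MeasurableSpace.comap (obsX (𝒳 := 𝒳)) inferInstance)
  have h2 := condExp_smul α V (μ := ProbabilityTheory.cond P A)
    (MeasurableSpace.comap (obsX (𝒳 := 𝒳)) inferInstance)
  have h3 := condExp_smul β W (μ := ProbabilityTheory.cond P A)
    (MeasurableSpace.comap (obsX (𝒳 := 𝒳)) inferInstance)
  have h4 : (fun o => α * V o + β * W o) = α • V + β • W := rfl
  rw [h4]
  filter_upwards [h1, h2, h3, hm.2, hn.2] with o a1 a2 a3 a4 a5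
  rw [a1, Pi.add_apply, a2, a3, Pi.smul_apply, Pi.smul_apply, ← a4, ← a5, smul_eq_mul, smul_eq_mul]

theorem memLp_obsD (hD : ∀ᵐ o ∂P, obsD o = 0 ∨ obsD o = 1) :
    MemLp (fun o : Obs 𝒳 => obsD o) 2 P := by
  refine MemLp.of_bound measurable_obsD.aestronglyMeasurable 1 ?_
  filter_upwards [hD] with o ho
  rcases ho with h | h <;> simp [h]

theorem regressionPair_mix (hP : OverlapDesign P g e t c η) (hη : IsTrueNuisance P g e t η)
    (hD : ∀ᵐ o ∂P, obsD o = 0 ∨ obsD o = 1) (hY : MemLp (fun o : Obs 𝒳 => obsY o) 2 P)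
    (hs : s = e - 1 ∨ s = t) (hpos : P (period s) ≠ 0) (α β : ℝ) :
    RegressionPair P g e t s (mixObs α β) (mixTrt η α β s) (mixCtl η α β s) where
  meas := (measurable_obsY.const_mul α).add (measurable_obsD.const_mul β)
  memLp := (hY.const_mul α).add ((memLp_obsD hD).const_mul β)
  pos := hpos
  trt := (hη.mTrt s hs).mix (hη.gTrt s hs) (hP.measure_exposed_period_ne_zero hpos)
    (hY.integrable one_le_two) ((memLp_obsD hD).integrable one_le_two) α β
  ctl := (hη.mCtl s hs).mix (hη.gCtl s hs) (hP.measure_control_period_ne_zero hpos)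
    (hY.integrable one_le_two) ((memLp_obsD hD).integrable one_le_two) α β

namespace RegressionPair

variable {V : Obs 𝒳 → ℝ} {μT μC : 𝒳 → ℝ}

theorem measurable_scoreAt (hV : RegressionPair P g e t s V μT μC)
    (hP : OverlapDesign P g e t c η) (N : Normalizers) :
    Measurable (scoreAt N g e t s η.odds V μT μC) := by
  have h1 := measurable_residual (measurableSet_exposed (𝒳 := 𝒳) e) (s := s) hV.meas hV.trt.1
  have h2 := measurable_residual (measurableSet_control (𝒳 := 𝒳) g e t) (s := s) hV.meas hV.ctl.1
  have h3 := hP.measurable_odds.comp (measurable_obsX (𝒳 := 𝒳))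
  have h4 := (measurable_ind (measurableSet_exposed (𝒳 := 𝒳) e)).mul
    ((hV.trt.1.sub hV.ctl.1).comp measurable_obsX)
  exact ((h1.const_mul _).sub ((h2.mul h3).const_mul _)).add (h4.const_mul _)

theorem memLp_scoreAt (hV : RegressionPair P g e t s V μT μC)
    (hP : OverlapDesign P g e t c η) (N : Normalizers) :
    MemLp (scoreAt N g e t s η.odds V μT μC) 2 P :=
  (((hV.memLp_residual_trt hP).const_mul _).sub
    ((hV.memLp_odds_mul_residual hP).const_mul _)).add ((hV.memLp_contrast hP).const_mul _)

theorem integral_scoreAt (hV : RegressionPair P g e t s V μT μC)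
    (hP : OverlapDesign P g e t c η) :
    ∫ o, scoreAt (popNormalizers P g e t η) g e t s η.odds V μT μC o ∂P
      = (P.real (exposed e))⁻¹ * ∫ o, ind (exposed e) o * (μT (obsX o) - μC (obsX o)) ∂P := by
  have h1 := ((hV.memLp_residual_trt hP).const_mul
    ((popNormalizers P g e t η).rhoTrt s)⁻¹).integrable one_le_two
  have h2 := ((hV.memLp_odds_mul_residual hP).const_mul
    ((popNormalizers P g e t η).rhoCtl s)⁻¹).integrable one_le_two
  have h3 := ((hV.memLp_contrast hP).const_mul
    ((popNormalizers P g e t η).rho)⁻¹).integrable one_le_two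
  simp only [scoreAt]
  rw [integral_add (by exact h1.sub h2) h3, integral_sub h1 h2, integral_const_mul, integral_const_mul,
    integral_const_mul, hV.integral_residual_trt hP, hV.integral_residual_ctl_mul hP
      hP.measurable_odds (OverlapDesign.control_absolutelyContinuous
        (hP.ae_odds.mono fun x hx => hx.2)), OverlapDesign.popNormalizers_rho]
  ring

end RegressionPair

end Mixed

/-! ### From rates in `n = K * b` to scaling by `√b`. -/

section Rates

variable {Ω : Type*} [MeasurableSpace Ω] {Pr : Measure Ω} {K : ℕ}

theorem sqrt_le_sqrt_mul (hK : 2 ≤ K) (b : ℕ) : √(b : ℝ) ≤ √((K * b : ℕ) : ℝ) := by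
  refine Real.sqrt_le_sqrt ?_
  exact_mod_cast Nat.le_mul_of_pos_left b (by omega)

theorem IsLittleOP.negligible_sqrt_mul {Z : ℕ → Ω → ℝ≥0∞} (hK : 2 ≤ K)
    (h : IsLittleOP Pr Z (rootRate K)) : Negligible Pr fun b ω => √(b : ℝ) * (Z b ω).toReal := by
  intro ε hε
  have h1 : HighProb Pr fun b ω => Z b ω < ENNReal.ofReal (ε * rootRate K b) := by
    simpa [HighProb] using h ε hε
  refine h1.mono ?_
  filter_upwards [eventually_gt_atTop 0] with b hb ω hZ
  have hbR : (0 : ℝ) < b := by exact_mod_cast hb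
  have hs : 0 < √((K * b : ℕ) : ℝ) := (Real.sqrt_pos.2 hbR).trans_le (sqrt_le_sqrt_mul hK b)
  have hr : 0 < rootRate K b := inv_pos.2 hs
  have hlt : (Z b ω).toReal < ε * rootRate K b := by
    rw [← ENNReal.toReal_ofReal (show 0 ≤ ε * rootRate K b by positivity)]
    exact (ENNReal.toReal_lt_toReal (hZ.trans ENNReal.ofReal_lt_top).ne ENNReal.ofReal_ne_top).2 hZ
  rw [abs_of_nonneg (by positivity)]
  calc √(b : ℝ) * (Z b ω).toReal < √(b : ℝ) * (ε * rootRate K b) :=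
        mul_lt_mul_of_pos_left hlt (Real.sqrt_pos.2 hbR)
    _ ≤ √((K * b : ℕ) : ℝ) * (ε * rootRate K b) :=
        mul_le_mul_of_nonneg_right (sqrt_le_sqrt_mul hK b) (by positivity)
    _ = ε := by rw [rootRate]; field_simp

theorem IsBigOP.tight_sqrt_mul {Z : ℕ → Ω → ℝ} (hK : 2 ≤ K) (h : IsBigOP Pr Z (rootRate K)) :
    Tight Pr fun b ω => √(b : ℝ) * Z b ω := by
  intro δ hδ
  obtain ⟨δ', hδ'0, hδ'⟩ : ∃ δ' : ℝ, 0 < δ' ∧ ENNReal.ofReal δ' ≤ δ := by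
    rcases eq_or_ne δ ∞ with rfl | hfin
    · exact ⟨1, one_pos, le_top⟩
    · exact ⟨δ.toReal, ENNReal.toReal_pos hδ.ne' hfin, ENNReal.ofReal_toReal_le⟩
  obtain ⟨M, hM⟩ := h δ' hδ'0
  -- The bound provided by `IsBigOP` need not be positive.
  refine ⟨|M| + 1, by positivity, ?_⟩
  filter_upwards [hM, eventually_gt_atTop 0] with b hb hb0
  refine le_trans (measure_mono ?_) (hb.trans hδ')
  intro ω hω
  have hbR : (0 : ℝ) < b := by exact_mod_cast hb0
  have hs : 0 < √((K * b : ℕ) : ℝ) := (Real.sqrt_pos.2 hbR).trans_le (sqrt_le_sqrt_mul hK b)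
  simp only [Set.mem_ofPred_eq, not_le, abs_mul, abs_of_nonneg (Real.sqrt_nonneg _)] at hω ⊢
  rw [rootRate, ← div_eq_mul_inv, div_lt_iff₀ hs]
  calc M ≤ |M| := le_abs_self M
    _ < √(b : ℝ) * |Z b ω| := by linarith
    _ ≤ √((K * b : ℕ) : ℝ) * |Z b ω| :=
        mul_le_mul_of_nonneg_right (sqrt_le_sqrt_mul hK b) (abs_nonneg _)
    _ = _ := mul_comm _ _

end Rates

/-! ### Nuisance conditions for linear combinations of outcome and treatment. -/

section Conditions

variable {𝒳 Ω : Type*} [MeasurableSpace 𝒳] [MeasurableSpace Ω]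
  {P : Measure (Obs 𝒳)} {Pr : Measure Ω} [IsProbabilityMeasure P] [IsProbabilityMeasure Pr]
  {O : ℕ → Ω → Obs 𝒳} {K : ℕ} {fold : (b : ℕ) → Fin (K * b) → Fin K} {g : ControlGroup} {e t : ℕ}
  {c : ℝ} {η : Nuisance 𝒳} {s : ℕ} {L : (b : ℕ) → Learner 𝒳 (fold b)}

/-- Estimated propensities may be negative. In that case `|p|/(1 - p) < 1`, so an upper bound on `p`
alone controls the odds. -/
theorem abs_odds_le {η : Nuisance 𝒳} (hc : 0 < c) (hc1 : c < 1) {x : 𝒳} (h : η.p x < 1 - c) :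
    |η.odds x| ≤ c⁻¹ := by
  have h1 : 0 < 1 - η.p x := by linarith
  rw [Nuisance.odds, abs_div, abs_of_pos h1, div_le_iff₀ h1, ← div_eq_inv_mul, le_div_iff₀ hc,
    ← abs_of_pos hc, ← abs_mul, abs_le]
  constructor <;> nlinarith

theorem eLpNorm_mix_le {μ : Measure 𝒳} {f f' h h' : 𝒳 → ℝ} (hf : Measurable f)
    (hf' : Measurable f') (hh : Measurable h) (hh' : Measurable h') (α β : ℝ) :
    eLpNorm (fun x => (α * f' x + β * h' x) - (α * f x + β * h x)) 2 μ
      ≤ ENNReal.ofReal |α| * eLpNorm (fun x => f x - f' x) 2 μ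
        + ENNReal.ofReal |β| * eLpNorm (fun x => h x - h' x) 2 μ := by
  have heq : (fun x => (α * f' x + β * h' x) - (α * f x + β * h x))
      = (-α) • (fun x => f x - f' x) + (-β) • (fun x => h x - h' x) := by
    ext x; simp only [Pi.add_apply, Pi.smul_apply, smul_eq_mul]; ring
  rw [heq]
  refine (eLpNorm_add_le ((hf.sub hf').aestronglyMeasurable.const_smul _)
    ((hh.sub hh').aestronglyMeasurable.const_smul _) one_le_two).trans ?_
  refine add_le_add ?_ ?_ <;>
  · rw [eLpNorm_const_smul, Real.enorm_eq_ofReal_abs, abs_neg]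
    exact le_rfl

theorem learnedSlice_mix (hP : OverlapDesign P g e t c η) (hη : IsTrueNuisance P g e t η)
    (hK : 2 ≤ K) (hL : ∀ b k, IsMeasurableLearner (L b k))
    (hcond : NuisanceConditions Pr P g e t c η
      (fun b ω => fit (fold b) (L b) (sample K b O ω))
      (fun b ω => fitNormalizers (fold b) (L b) g e t (sample K b O ω)))
    (k : Fin K) (hs : s = e - 1 ∨ s = t) (α β : ℝ) :
    LearnedSlice P Pr O fold g e t c k s η.odds (mixTrt η α β s) (mixCtl η α β s)
      (fun b => L b k) (fun b θ => mixTrt (L b k θ) α β s) (fun b θ => mixCtl (L b k θ) α β s) := by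
  have hmT : ∀ b ω, Measurable ((L b k (train (fold b) O k ω)).mTrt s) := fun b ω =>
    ((hL b k).mTrt s).of_uncurry_left (x := train (fold b) O k ω)
      (f := fun θ x => (L b k θ).mTrt s x)
  have hgT : ∀ b ω, Measurable ((L b k (train (fold b) O k ω)).gTrt s) := fun b ω =>
    ((hL b k).gTrt s).of_uncurry_left (x := train (fold b) O k ω)
      (f := fun θ x => (L b k θ).gTrt s x)
  have hmC : ∀ b ω, Measurable ((L b k (train (fold b) O k ω)).mCtl s) := fun b ω =>
    ((hL b k).mCtl s).of_uncurry_left (x := train (fold b) O k ω)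
      (f := fun θ x => (L b k θ).mCtl s x)
  have hgC : ∀ b ω, Measurable ((L b k (train (fold b) O k ω)).gCtl s) := fun b ω =>
    ((hL b k).gCtl s).of_uncurry_left (x := train (fold b) O k ω)
      (f := fun θ x => (L b k θ).gCtl s x)
  have hodds : ∀ b ω, eLpNorm (fun x => (L b k (train (fold b) O k ω)).odds x - η.odds x) 2
      (covLaw P g e t) = l2dist P g e t η.odds (L b k (train (fold b) O k ω)).odds := fun b ω =>
    eLpNorm_sub_comm _ _ _ _
  have hmC1 := (hη.mCtl s hs).1
  have hgC1 := (hη.gCtl s hs).1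
  have hctl_le : ∀ b ω, eLpNorm (fun x => mixCtl (L b k (train (fold b) O k ω)) α β s x
      - mixCtl η α β s x) 2 (covLaw P g e t)
      ≤ ENNReal.ofReal |α| * l2dist P g e t (η.mCtl s) ((L b k (train (fold b) O k ω)).mCtl s)
        + ENNReal.ofReal |β| * l2dist P g e t (η.gCtl s) ((L b k (train (fold b) O k ω)).gCtl s) :=
    fun b ω => eLpNorm_mix_le hmC1 (hmC b ω) hgC1 (hgC b ω) α β
  refine ⟨fun b => ?_, fun b => ?_, fun b => ?_, ?_, ?_, ?_, ?_, ?_, ?_⟩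
  · exact (hL b k).p.div (measurable_const.sub (hL b k).p)
  · exact (((hL b k).mTrt s).const_mul α).add (((hL b k).gTrt s).const_mul β)
  · exact (((hL b k).mCtl s).const_mul α).add (((hL b k).gCtl s).const_mul β)
  · exact HighProb.mono (hcond.overlap k) (Eventually.of_forall fun b ω hb =>
      hb.mono fun x hx => abs_odds_le hP.c_pos hP.c_lt_one hx)
  · simp only [hodds]
    exact hcond.odds_consistent k
  · exact (((hcond.mTrt_consistent k s hs).const_mul (abs_nonneg α)).add
      ((hcond.gTrt_consistent k s hs).const_mul (abs_nonneg β))).of_le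
      (HighProb.of_forall fun b ω => eLpNorm_mix_le (hη.mTrt s hs).1 (hmT b ω) (hη.gTrt s hs).1
        (hgT b ω) α β)
  · exact (((hcond.mCtl_consistent k s hs).const_mul (abs_nonneg α)).add
      ((hcond.gCtl_consistent k s hs).const_mul (abs_nonneg β))).of_le
      (HighProb.of_forall hctl_le)
  · have h1 := ((hcond.rate_m k s hs).negligible_sqrt_mul hK).const_mul |α|
    have h2 := ((hcond.rate_g k s hs).negligible_sqrt_mul hK).const_mul |β|
    refine (h1.add h2).of_le (((hcond.mCtl_consistent k s hs).highProb_ne_top.and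
      (hcond.gCtl_consistent k s hs).highProb_ne_top).mono (Eventually.of_forall fun b ω hb => ?_))
    -- Passing to real numbers is monotone only below `∞`, hence the restriction to finite
    -- distances.
    have hle := ENNReal.toReal_mono (ENNReal.add_ne_top.2
      ⟨ENNReal.mul_ne_top ENNReal.ofReal_ne_top hb.1,
        ENNReal.mul_ne_top ENNReal.ofReal_ne_top hb.2⟩) (hctl_le b ω)
    rw [ENNReal.toReal_add (ENNReal.mul_ne_top ENNReal.ofReal_ne_top hb.1)
        (ENNReal.mul_ne_top ENNReal.ofReal_ne_top hb.2), ENNReal.toReal_mul, ENNReal.toReal_mul,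
      ENNReal.toReal_ofReal (abs_nonneg _), ENNReal.toReal_ofReal (abs_nonneg _)] at hle
    rw [hodds, abs_of_nonneg (by positivity)]
    refine le_trans ?_ (le_abs_self _)
    simp only [ENNReal.toReal_mul]
    refine (mul_le_mul_of_nonneg_left (mul_le_mul_of_nonneg_left hle ENNReal.toReal_nonneg)
      (Real.sqrt_nonneg _)).trans (le_of_eq ?_)
    have hfit : fit (fold b) (L b) (sample K b O ω) k = L b k (train (fold b) O k ω) := rfl
    simp only [hfit]
    ring
  · exact (hcond.weights k s hs).tight_sqrt_mul hK

end Conditions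

/-! ### Moments of the true score. -/

section Population

variable {𝒳 : Type*} [MeasurableSpace 𝒳]

/-- The population assumptions: overlap, square integrable outcome, binary treatment, and true
nuisance functions. -/
structure StudyDesign (P : Measure (Obs 𝒳)) (g : ControlGroup) (e t : ℕ) (c : ℝ)
    (η : Nuisance 𝒳) : Prop where
  overlap : OverlapDesign P g e t c η
  nuisance : IsTrueNuisance P g e t η
  binary : ∀ᵐ o ∂P, obsD o = 0 ∨ obsD o = 1
  outcome : MemLp (fun o : Obs 𝒳 => obsY o) 2 P
  period_ne_zero : ∀ s, s = e - 1 ∨ s = t → P (period s) ≠ 0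

/-- The score component of `α Y + β D` at the true nuisance functions. -/
noncomputable def trueScore (P : Measure (Obs 𝒳)) (g : ControlGroup) (e t : ℕ) (η : Nuisance 𝒳)
    (α β : ℝ) (o : Obs 𝒳) : ℝ :=
  mixScore (popNormalizers P g e t η) g e t η α β o

/-- The difference-in-differences contrast of `α Y + β D` on the exposed cohort. -/
noncomputable def exposedContrast (e t : ℕ) (η : Nuisance 𝒳) (α β : ℝ) (o : Obs 𝒳) : ℝ :=
  ind (exposed e) o * didContrast e t (mixTrt η α β) (mixCtl η α β) (obsX o)

theorem exposedContrast_eq (e t : ℕ) (η : Nuisance 𝒳) (α β : ℝ) (o : Obs 𝒳) :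
    exposedContrast e t η α β o
      = ind (exposed e) o * (mixTrt η α β t (obsX o) - mixCtl η α β t (obsX o))
        - ind (exposed e) o * (mixTrt η α β (e - 1) (obsX o) - mixCtl η α β (e - 1) (obsX o)) := by
  simp only [exposedContrast, didContrast]; ring

theorem integral_cond_exposed (P : Measure (Obs 𝒳)) (e : ℕ) (f : Obs 𝒳 → ℝ) :
    ∫ o, f o ∂(ProbabilityTheory.cond P (exposed e))
      = (P.real (exposed e))⁻¹ * ∫ o, ind (exposed e) o * f o ∂P := by
  rw [ind_mul, integral_indicator (measurableSet_exposed e), ProbabilityTheory.cond,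
    integral_smul_measure, ENNReal.toReal_inv, measureReal_def, smul_eq_mul]

namespace StudyDesign

variable {P : Measure (Obs 𝒳)} [IsProbabilityMeasure P] {g : ControlGroup} {e t s : ℕ} {c : ℝ}
  {η : Nuisance 𝒳}

theorem regressionPair (hP : StudyDesign P g e t c η) (hs : s = e - 1 ∨ s = t) (α β : ℝ) :
    RegressionPair P g e t s (mixObs α β) (mixTrt η α β s) (mixCtl η α β s) :=
  regressionPair_mix hP.overlap hP.nuisance hP.binary hP.outcome hs (hP.period_ne_zero s hs) α β

theorem trueScore_eq (hP : StudyDesign P g e t c η) (α β : ℝ) :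
    trueScore P g e t η α β = fun o =>
      scoreAt (popNormalizers P g e t η) g e t t η.odds (mixObs α β) (mixTrt η α β t)
          (mixCtl η α β t) o
        - scoreAt (popNormalizers P g e t η) g e t (e - 1) η.odds (mixObs α β)
          (mixTrt η α β (e - 1)) (mixCtl η α β (e - 1)) o :=
  funext fun o => mixScore_eq hP.overlap.periods_ne _ _ _ _ _ o

theorem measurable_trueScore (hP : StudyDesign P g e t c η) (α β : ℝ) :
    Measurable (trueScore P g e t η α β) := by
  rw [hP.trueScore_eq]
  exact ((hP.regressionPair (Or.inr rfl) α β).measurable_scoreAt hP.overlap _).sub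
    ((hP.regressionPair (Or.inl rfl) α β).measurable_scoreAt hP.overlap _)

theorem memLp_trueScore (hP : StudyDesign P g e t c η) (α β : ℝ) :
    MemLp (trueScore P g e t η α β) 2 P := by
  rw [hP.trueScore_eq]
  exact ((hP.regressionPair (Or.inr rfl) α β).memLp_scoreAt hP.overlap _).sub
    ((hP.regressionPair (Or.inl rfl) α β).memLp_scoreAt hP.overlap _)

theorem measurable_exposedContrast (hP : StudyDesign P g e t c η) (α β : ℝ) :
    Measurable (exposedContrast e t η α β) := by
  have h1 := hP.regressionPair (Or.inr rfl) α β
  have h2 := hP.regressionPair (Or.inl rfl) α β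
  exact (measurable_ind (measurableSet_exposed e)).mul
    (((h1.trt.1.sub h2.trt.1).sub (h1.ctl.1.sub h2.ctl.1)).comp measurable_obsX)

theorem memLp_exposedContrast (hP : StudyDesign P g e t c η) (α β : ℝ) :
    MemLp (exposedContrast e t η α β) 2 P := by
  have h : exposedContrast e t η α β = _ := funext fun o => exposedContrast_eq e t η α β o
  rw [h]
  exact ((hP.regressionPair (Or.inr rfl) α β).memLp_contrast hP.overlap).sub
    ((hP.regressionPair (Or.inl rfl) α β).memLp_contrast hP.overlap)

theorem integral_trueScore_eq (hP : StudyDesign P g e t c η) (α β : ℝ) :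
    ∫ o, trueScore P g e t η α β o ∂P
      = (P.real (exposed e))⁻¹ * ∫ o, exposedContrast e t η α β o ∂P := by
  have h1 := hP.regressionPair (Or.inr rfl) α β
  have h2 := hP.regressionPair (Or.inl rfl) α β
  rw [hP.trueScore_eq, integral_sub ((h1.memLp_scoreAt hP.overlap _).integrable one_le_two)
    ((h2.memLp_scoreAt hP.overlap _).integrable one_le_two), h1.integral_scoreAt hP.overlap,
    h2.integral_scoreAt hP.overlap]
  simp only [exposedContrast_eq]
  rw [integral_sub ((h1.memLp_contrast hP.overlap).integrable one_le_two)
    ((h2.memLp_contrast hP.overlap).integrable one_le_two), mul_sub]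

theorem integral_psiB (hP : StudyDesign P g e t c η) :
    ∫ o, trueScore P g e t η 1 0 o ∂P = tauNum P e t η := by
  rw [hP.integral_trueScore_eq, tauNum, integral_cond_exposed]
  simp [exposedContrast, mixTrt, mixCtl, didContrast]

theorem integral_psiA (hP : StudyDesign P g e t c η) :
    ∫ o, trueScore P g e t η 0 1 o ∂P = tauDen P e t η := by
  rw [hP.integral_trueScore_eq, tauDen, integral_cond_exposed]
  simp [exposedContrast, mixTrt, mixCtl, didContrast]

theorem integral_trueScore (hP : StudyDesign P g e t c η) (α β : ℝ) :
    ∫ o, trueScore P g e t η α β o ∂P = α * tauNum P e t η + β * tauDen P e t η := by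
  have heq : trueScore P g e t η α β
      = fun o => α * trueScore P g e t η 1 0 o + β * trueScore P g e t η 0 1 o := by
    ext o; simp only [trueScore, mixScore]; ring
  rw [heq, integral_add (((hP.memLp_trueScore 1 0).integrable one_le_two).const_mul α)
    (((hP.memLp_trueScore 0 1).integrable one_le_two).const_mul β), integral_const_mul,
    integral_const_mul, hP.integral_psiB, hP.integral_psiA]

theorem J0_eq (hP : StudyDesign P g e t c η) : J0 P g e t η = tauDen P e t η := by
  simp only [J0, psiA_eq_mixScore]
  exact hP.integral_psiA

theorem psiTrue_eq (P : Measure (Obs 𝒳)) (g : ControlGroup) (e t : ℕ) (η : Nuisance 𝒳) :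
    psiTrue P g e t η = trueScore P g e t η 1 (-tau P e t η) :=
  funext fun o => psi_eq_mixScore _ _ _ _ _ _ o

theorem measurable_psiTrue (hP : StudyDesign P g e t c η) : Measurable (psiTrue P g e t η) := by
  rw [psiTrue_eq]; exact hP.measurable_trueScore _ _

theorem memLp_psiTrue (hP : StudyDesign P g e t c η) : MemLp (psiTrue P g e t η) 2 P := by
  rw [psiTrue_eq]; exact hP.memLp_trueScore _ _

theorem integral_psiTrue (hP : StudyDesign P g e t c η) (hden : tauDen P e t η ≠ 0) :
    ∫ o, psiTrue P g e t η o ∂P = 0 := by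
  rw [psiTrue_eq, hP.integral_trueScore, tau]
  field_simp
  ring

/-- Because of this cancellation at `τ₀`, estimating `ρ` in the last term of the score has no
first-order cost. -/
theorem integral_exposedContrast (hP : StudyDesign P g e t c η) (hden : tauDen P e t η ≠ 0) :
    ∫ o, exposedContrast e t η 1 (-tau P e t η) o ∂P = 0 := by
  have h := hP.integral_psiTrue hden
  rw [psiTrue_eq, hP.integral_trueScore_eq] at h
  exact (mul_eq_zero.1 h).resolve_left (inv_ne_zero hP.overlap.exposed_pos)

end StudyDesign

end Population

/-! ### Asymptotic linearity within each fold. -/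

section Folds

variable {𝒳 Ω : Type*} [MeasurableSpace 𝒳] [MeasurableSpace Ω]

/-- The population, sampling and learning assumptions of the cross-fitted estimator. -/
structure CrossFitDesign (P : Measure (Obs 𝒳)) (Pr : Measure Ω) (O : ℕ → Ω → Obs 𝒳) {K : ℕ}
    (fold : (b : ℕ) → Fin (K * b) → Fin K) (g : ControlGroup) (e t : ℕ) (c : ℝ) (η : Nuisance 𝒳)
    (L : (b : ℕ) → Learner 𝒳 (fold b)) : Prop where
  study : StudyDesign P g e t c η
  den : tauDen P e t η ≠ 0
  sample : FoldedSample P Pr O K fold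
  folds : 2 ≤ K
  learner : ∀ b k, IsMeasurableLearner (L b k)
  cond : NuisanceConditions Pr P g e t c η
      (fun b ω => fit (fold b) (L b) (IDiD.sample K b O ω))
      (fun b ω => fitNormalizers (fold b) (L b) g e t (IDiD.sample K b O ω))

/-- The score component of `α Y + β D` at the nuisances estimated outside fold `k`. -/
noncomputable def fitScore {K b : ℕ} (fold : Fin (K * b) → Fin K) (L : Learner 𝒳 fold)
    (g : ControlGroup) (e t : ℕ) (α β : ℝ) (o : Fin (K * b) → Obs 𝒳) (k : Fin K) (o' : Obs 𝒳) : ℝ :=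
  mixScore (fitNormalizers fold L g e t o k) g e t (fit fold L o k) α β o'

namespace CrossFitDesign

variable {P : Measure (Obs 𝒳)} {Pr : Measure Ω} [IsProbabilityMeasure P] [IsProbabilityMeasure Pr]
  {O : ℕ → Ω → Obs 𝒳} {K : ℕ} {fold : (b : ℕ) → Fin (K * b) → Fin K} {g : ControlGroup} {e t : ℕ}
  {c : ℝ} {η : Nuisance 𝒳} {L : (b : ℕ) → Learner 𝒳 (fold b)} {s : ℕ}

theorem learnedSlice (h : CrossFitDesign P Pr O fold g e t c η L) (k : Fin K)
    (hs : s = e - 1 ∨ s = t) (α β : ℝ) :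
    LearnedSlice P Pr O fold g e t c k s η.odds (mixTrt η α β s) (mixCtl η α β s)
      (fun b => L b k) (fun b θ => mixTrt (L b k θ) α β s) (fun b θ => mixCtl (L b k θ) α β s) :=
  learnedSlice_mix h.study.overlap h.study.nuisance h.folds h.learner h.cond k hs α β

theorem fitScore_eq (h : CrossFitDesign P Pr O fold g e t c η L) (k : Fin K) (α β : ℝ) (b : ℕ)
    (ω : Ω) : fitScore (fold b) (L b) g e t α β (IDiD.sample K b O ω) k = fun o =>
      scoreAt (learnedNormalizers O fold g e t k (fun b => L b k) b ω) g e t t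
          (L b k (train (fold b) O k ω)).odds (mixObs α β)
          (mixTrt (L b k (train (fold b) O k ω)) α β t)
          (mixCtl (L b k (train (fold b) O k ω)) α β t) o
        - scoreAt (learnedNormalizers O fold g e t k (fun b => L b k) b ω) g e t (e - 1)
          (L b k (train (fold b) O k ω)).odds (mixObs α β)
          (mixTrt (L b k (train (fold b) O k ω)) α β (e - 1))
          (mixCtl (L b k (train (fold b) O k ω)) α β (e - 1)) o :=
  funext fun o => mixScore_eq h.study.overlap.periods_ne _ _ _ _ _ o

/-- The estimated score is close to the true score in the empirical `L²` norm of every fold. -/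
theorem empSmall_fitScore_sub (h : CrossFitDesign P Pr O fold g e t c η L) (k : Fin K) (α β : ℝ) :
    EmpSmall Pr O fold k fun b ω o =>
      fitScore (fold b) (L b) g e t α β (IDiD.sample K b O ω) k o - trueScore P g e t η α β o := by
  have h1 := (h.learnedSlice k (Or.inr rfl) α β).empSmall_score_sub h.sample h.study.overlap
    (h.study.regressionPair (Or.inr rfl) α β)
  have h2 := (h.learnedSlice k (Or.inl rfl) α β).empSmall_score_sub h.sample h.study.overlap
    (h.study.regressionPair (Or.inl rfl) α β)
  refine (h1.sub h2).congr fun b ω o => ?_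
  rw [h.fitScore_eq, h.study.trueScore_eq]
  ring

theorem negligible_foldMean_fitScore (h : CrossFitDesign P Pr O fold g e t c η L) (k : Fin K)
    (α β : ℝ) : Negligible Pr fun b ω => foldMean (fold b) (IDiD.sample K b O ω) k
        (fitScore (fold b) (L b) g e t α β (IDiD.sample K b O ω) k)
      - ∫ o, trueScore P g e t η α β o ∂P := by
  have h1 := (h.empSmall_fitScore_sub k α β).negligible_foldMean h.sample
  have h2 := h.sample.negligible_foldMean_sub k (h.study.measurable_trueScore α β)
    (h.study.memLp_trueScore α β)
  refine (h1.add h2).congr (HighProb.of_forall fun b ω => ?_)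
  rw [foldMean_sub]
  ring

/-- The estimated score at `τ₀` is asymptotically equivalent to the true score. -/
theorem negligible_sqrt_mul_foldMean (h : CrossFitDesign P Pr O fold g e t c η L) (k : Fin K) :
    Negligible Pr fun b ω => √(b : ℝ) *
      (foldMean (fold b) (IDiD.sample K b O ω) k
          (fitScore (fold b) (L b) g e t 1 (-tau P e t η) (IDiD.sample K b O ω) k)
        - foldMean (fold b) (IDiD.sample K b O ω) k (psiTrue P g e t η)) := by
  set β := -tau P e t η with hβ
  have h1 := (h.learnedSlice k (Or.inr rfl) 1 β).negligible_expansion h.sample h.study.overlap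
    (h.study.regressionPair (Or.inr rfl) 1 β)
  have h2 := (h.learnedSlice k (Or.inl rfl) 1 β).negligible_expansion h.sample h.study.overlap
    (h.study.regressionPair (Or.inl rfl) 1 β)
  -- The two expansions leave `1/ρ̂ - 1/ρ = o_P(1)` times the mean of the exposed contrast. That
  -- contrast is centred, so `√b` times its mean is tight.
  have h3 := h.sample.tight_fluctuation k (h.study.measurable_exposedContrast 1 β)
    (h.study.memLp_exposedContrast 1 β)
  rw [h.study.integral_exposedContrast h.den] at h3
  have h4 := (negligible_rho (ηh := fun b => L b k) (k := k) (e := e) (g := g) (t := t)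
    h.sample).inv_sub_inv h.study.overlap.exposed_pos
  refine ((h1.sub h2).add (h4.mul_tight h3)).congr (HighProb.of_forall fun b ω => ?_)
  have hc : exposedContrast e t η 1 β = _ := funext fun o => exposedContrast_eq e t η 1 β o
  rw [h.fitScore_eq, StudyDesign.psiTrue_eq, ← hβ, h.study.trueScore_eq, hc, foldMean_sub,
    foldMean_sub, foldMean_sub]
  ring

end CrossFitDesign

end Folds

/-! ### Averaging over folds and asymptotic normality. -/

section CrossMeans

variable {𝒳 Ω : Type*} [MeasurableSpace 𝒳] [MeasurableSpace Ω]

/-- The sample enters through the normalizers, the nuisances and the evaluation point at once.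
Convergence in distribution requires the estimator to be measurable. -/
theorem measurable_scoreAt_comp {N : Ω → Normalizers} {g : ControlGroup} {e t s : ℕ}
    {r μT μC : Ω → 𝒳 → ℝ} {V : Obs 𝒳 → ℝ} {A : Ω → Obs 𝒳} (hA : Measurable A)
    (hrho : Measurable fun ω => (N ω).rho) (hT : Measurable fun ω => (N ω).rhoTrt s)
    (hC : Measurable fun ω => (N ω).rhoCtl s) (hV : Measurable V)
    (hr : Measurable fun ω => r ω (obsX (A ω))) (hμT : Measurable fun ω => μT ω (obsX (A ω)))
    (hμC : Measurable fun ω => μC ω (obsX (A ω))) :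
    Measurable fun ω => scoreAt (N ω) g e t s (r ω) V (μT ω) (μC ω) (A ω) := by
  have hE := (measurable_ind (measurableSet_exposed (𝒳 := 𝒳) e)).comp hA
  have hCt := (measurable_ind (measurableSet_control (𝒳 := 𝒳) g e t)).comp hA
  have hp := (measurable_ind (measurableSet_period (𝒳 := 𝒳) s)).comp hA
  have hVA := hV.comp hA
  exact ((hT.inv.mul ((hE.mul hp).mul (hVA.sub hμT))).sub
    (hC.inv.mul (((hCt.mul hp).mul (hVA.sub hμC)).mul hr))).add
    (hrho.inv.mul (hE.mul (hμT.sub hμC)))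

theorem Negligible.crossMean {Pr : Measure Ω} {K : ℕ} {Z : Fin K → ℕ → Ω → ℝ}
    (h : ∀ k, Negligible Pr (Z k)) : Negligible Pr fun b ω => (K : ℝ)⁻¹ * ∑ k, Z k b ω :=
  (Negligible.sum Finset.univ fun k _ => h k).const_mul _

theorem Tight.sum {Pr : Measure Ω} {ι : Type*} (s : Finset ι) {Z : ι → ℕ → Ω → ℝ}
    (h : ∀ i ∈ s, Tight Pr (Z i)) : Tight Pr fun b ω => ∑ i ∈ s, Z i b ω := by
  classical
  induction s using Finset.induction_on with
  | empty => simpa using Tight.const 0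
  | insert i s hi ih =>
    simp only [Finset.sum_insert hi]
    exact (h i (Finset.mem_insert_self i s)).add
      (ih fun j hj => h j (Finset.mem_insert_of_mem hj))

theorem sqrt_mul_crossMean_fixed {K b : ℕ} (fold : Fin (K * b) → Fin K) (O : ℕ → Ω → Obs 𝒳)
    (ω : Ω) (f : Obs 𝒳 → ℝ) :
    √((K * b : ℕ) : ℝ) * crossMean fold (sample K b O ω) (fun _ => f)
      = (√((K * b : ℕ) : ℝ))⁻¹ * ∑ i ∈ Finset.range (K * b), f (O i ω) := by
  rw [crossMean_fixed, Finset.sum_range, ← mul_assoc, ← mul_inv, ← Nat.cast_mul, ← div_eq_mul_inv,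
    Real.sqrt_div_self', one_div]
  rfl

namespace CrossFitDesign

variable {P : Measure (Obs 𝒳)} {Pr : Measure Ω} [IsProbabilityMeasure P] [IsProbabilityMeasure Pr]
  {O : ℕ → Ω → Obs 𝒳} {K : ℕ} {fold : (b : ℕ) → Fin (K * b) → Fin K} {g : ControlGroup} {e t : ℕ}
  {c : ℝ} {η : Nuisance 𝒳} {L : (b : ℕ) → Learner 𝒳 (fold b)} {s : ℕ}

theorem K_ne_zero (h : CrossFitDesign P Pr O fold g e t c η L) : (K : ℝ) ≠ 0 := by
  have := h.folds
  exact_mod_cast (by omega : K ≠ 0)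

theorem measurable_learner (h : CrossFitDesign P Pr O fold g e t c η L) (b : ℕ) (k : Fin K)
    {f : Nuisance 𝒳 → 𝒳 → ℝ}
    (hf : Measurable fun q : ({i : Fin (K * b) // fold b i ≠ k} → Obs 𝒳) × 𝒳 =>
      f (L b k q.1) q.2) (i : ℕ) :
    Measurable fun ω => f (L b k (train (fold b) O k ω)) (obsX (O i ω)) :=
  hf.comp ((h.sample.measurable_train b k).prodMk (measurable_obsX.comp (h.sample.meas i)))

theorem measurable_odds (h : CrossFitDesign P Pr O fold g e t c η L) (b : ℕ) (k : Fin K) (i : ℕ) :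
    Measurable fun ω => (L b k (train (fold b) O k ω)).odds (obsX (O i ω)) :=
  h.measurable_learner b k (f := Nuisance.odds)
    ((h.learner b k).p.div (measurable_const.sub (h.learner b k).p)) i

theorem measurable_fitScore (h : CrossFitDesign P Pr O fold g e t c η L) (b : ℕ) (k : Fin K)
    (α β : ℝ) (i : ℕ) :
    Measurable fun ω => fitScore (fold b) (L b) g e t α β (IDiD.sample K b O ω) k (O i ω) := by
  have hrho : Measurable fun ω => (learnedNormalizers O fold g e t k (fun b => L b k) b ω).rho :=
    h.sample.measurable_foldMean k (measurable_ind (measurableSet_exposed e)) b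
  have hT : ∀ s, Measurable fun ω =>
      (learnedNormalizers O fold g e t k (fun b => L b k) b ω).rhoTrt s := fun s =>
    h.sample.measurable_foldMean k ((measurable_ind (measurableSet_exposed e)).mul
      (measurable_ind (measurableSet_period s))) b
  have hC : ∀ s, Measurable fun ω =>
      (learnedNormalizers O fold g e t k (fun b => L b k) b ω).rhoCtl s := fun s => by
    refine (Finset.measurable_sum _ fun j _ => ?_).const_mul _
    exact (((measurable_ind (measurableSet_control g e t)).mul
      (measurable_ind (measurableSet_period s))).comp (h.sample.meas j)).mul
      (h.measurable_odds b k j)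
  have hV : Measurable (mixObs (𝒳 := 𝒳) α β) :=
    (measurable_obsY.const_mul α).add (measurable_obsD.const_mul β)
  have hμT : ∀ s, Measurable fun ω =>
      mixTrt (L b k (train (fold b) O k ω)) α β s (obsX (O i ω)) := fun s =>
    h.measurable_learner b k (f := fun η => mixTrt η α β s)
      ((((h.learner b k).mTrt s).const_mul α).add (((h.learner b k).gTrt s).const_mul β)) i
  have hμC : ∀ s, Measurable fun ω =>
      mixCtl (L b k (train (fold b) O k ω)) α β s (obsX (O i ω)) := fun s =>
    h.measurable_learner b k (f := fun η => mixCtl η α β s)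
      ((((h.learner b k).mCtl s).const_mul α).add (((h.learner b k).gCtl s).const_mul β)) i
  simp only [h.fitScore_eq]
  exact (measurable_scoreAt_comp (h.sample.meas i) hrho (hT t) (hC t) hV (h.measurable_odds b k i)
    (hμT t) (hμC t)).sub (measurable_scoreAt_comp (h.sample.meas i) hrho (hT (e - 1))
    (hC (e - 1)) hV (h.measurable_odds b k i) (hμT (e - 1)) (hμC (e - 1)))

theorem measurable_crossMean_fitScore (h : CrossFitDesign P Pr O fold g e t c η L) (b : ℕ)
    (α β : ℝ) : Measurable fun ω => crossMean (fold b) (IDiD.sample K b O ω)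
      (fitScore (fold b) (L b) g e t α β (IDiD.sample K b O ω)) := by
  simp only [crossMean, foldMean]
  refine (Finset.measurable_sum _ fun k _ => (Finset.measurable_sum _ fun i _ => ?_).const_mul
    _).const_mul _
  exact h.measurable_fitScore b k α β i

theorem Jhat_eq {b : ℕ} (L : Learner 𝒳 (fold b)) (o : Fin (K * b) → Obs 𝒳) :
    Jhat (fold b) L g e t o = crossMean (fold b) o (fitScore (fold b) L g e t 0 1 o) := by
  rw [Jhat]
  congr 1
  ext k o'
  exact psiA_eq_mixScore _ _ _ _ _ _

theorem tauHat_eq {b : ℕ} (L : Learner 𝒳 (fold b)) (o : Fin (K * b) → Obs 𝒳) :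
    tauHat (fold b) L g e t o
      = crossMean (fold b) o (fitScore (fold b) L g e t 1 0 o) / Jhat (fold b) L g e t o := by
  rw [tauHat]
  congr 2
  ext k o'
  exact psiB_eq_mixScore _ _ _ _ _ _

theorem fitScore_decompose {b : ℕ} (L : Learner 𝒳 (fold b)) (o : Fin (K * b) → Obs 𝒳) (α β : ℝ)
    (k : Fin K) (o' : Obs 𝒳) : fitScore (fold b) L g e t α β o k o'
      = α * fitScore (fold b) L g e t 1 0 o k o' + β * fitScore (fold b) L g e t 0 1 o k o' := by
  simp only [fitScore, mixScore]; ring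

/-- The score is affine in `τ` with slope `-ψ_a`, and its mean vanishes at the estimator, so the
error is explicit and needs no Taylor expansion. -/
theorem tauHat_sub {b : ℕ} (L : Learner 𝒳 (fold b)) (o : Fin (K * b) → Obs 𝒳)
    (hJ : Jhat (fold b) L g e t o ≠ 0) (τ : ℝ) :
    tauHat (fold b) L g e t o - τ
      = (Jhat (fold b) L g e t o)⁻¹ * crossMean (fold b) o (fitScore (fold b) L g e t 1 (-τ) o) := by
  have h1 : fitScore (fold b) L g e t 1 (-τ) o = fun k o' =>
      fitScore (fold b) L g e t 1 0 o k o' + (-τ) * fitScore (fold b) L g e t 0 1 o k o' := by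
    ext k o'
    rw [fitScore_decompose, one_mul]
  rw [h1, crossMean_add, crossMean_const_mul, ← Jhat_eq, tauHat_eq]
  field_simp
  ring

theorem measurable_Jhat (h : CrossFitDesign P Pr O fold g e t c η L) (b : ℕ) :
    Measurable fun ω => Jhat (fold b) (L b) g e t (IDiD.sample K b O ω) := by
  simp only [Jhat_eq]
  exact h.measurable_crossMean_fitScore b 0 1

theorem measurable_tauHat (h : CrossFitDesign P Pr O fold g e t c η L) (b : ℕ) :
    Measurable fun ω => tauHat (fold b) (L b) g e t (IDiD.sample K b O ω) := by
  simp only [tauHat_eq]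
  exact (h.measurable_crossMean_fitScore b 1 0).div (h.measurable_Jhat b)

theorem psi_eq_fitScore {b : ℕ} (L : Learner 𝒳 (fold b)) (o : Fin (K * b) → Obs 𝒳) (τ : ℝ)
    (k : Fin K) (o' : Obs 𝒳) :
    psi (fitNormalizers (fold b) L g e t o k) g e t (fit (fold b) L o k) τ o'
      = fitScore (fold b) L g e t 1 0 o k o' - τ * fitScore (fold b) L g e t 0 1 o k o' := by
  simp only [psi, fitScore, mixScore]; ring

theorem measurable_sigmaSqHat (h : CrossFitDesign P Pr O fold g e t c η L) (b : ℕ) :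
    Measurable fun ω => sigmaSqHat (fold b) (L b) g e t (IDiD.sample K b O ω) := by
  simp only [sigmaSqHat, psi_eq_fitScore]
  refine ((h.measurable_Jhat b).pow_const 2).inv.mul ((Finset.measurable_sum _ fun k _ =>
    (Finset.measurable_sum _ fun i _ => ?_).const_mul _).const_mul _)
  exact ((h.measurable_fitScore b k 1 0 i).sub
    ((h.measurable_tauHat b).mul (h.measurable_fitScore b k 0 1 i))).pow_const 2

theorem negligible_crossMean_fitScore (h : CrossFitDesign P Pr O fold g e t c η L) (α β : ℝ) :
    Negligible Pr fun b ω => crossMean (fold b) (IDiD.sample K b O ω)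
        (fitScore (fold b) (L b) g e t α β (IDiD.sample K b O ω))
      - ∫ o, trueScore P g e t η α β o ∂P := by
  refine (Negligible.crossMean fun k => h.negligible_foldMean_fitScore k α β).congr
    (HighProb.of_forall fun b ω => ?_)
  have hK := h.K_ne_zero
  rw [crossMean, Finset.sum_sub_distrib, Finset.sum_const, Finset.card_univ, Fintype.card_fin,
    nsmul_eq_mul]
  field_simp

theorem negligible_Jhat_sub (h : CrossFitDesign P Pr O fold g e t c η L) :
    Negligible Pr fun b ω => Jhat (fold b) (L b) g e t (IDiD.sample K b O ω)
      - tauDen P e t η := by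
  have := h.negligible_crossMean_fitScore 0 1
  rw [h.study.integral_psiA] at this
  simpa only [Jhat_eq] using this

theorem highProb_tauHat_sub (h : CrossFitDesign P Pr O fold g e t c η L) :
    HighProb Pr fun b ω => tauHat (fold b) (L b) g e t (IDiD.sample K b O ω) - tau P e t η
      = (Jhat (fold b) (L b) g e t (IDiD.sample K b O ω))⁻¹
        * crossMean (fold b) (IDiD.sample K b O ω)
          (fitScore (fold b) (L b) g e t 1 (-tau P e t η) (IDiD.sample K b O ω)) :=
  (h.negligible_Jhat_sub.highProb_ne_zero h.den).mono
    (Eventually.of_forall fun _ _ hb => tauHat_sub _ _ hb _)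

theorem negligible_tauHat_sub (h : CrossFitDesign P Pr O fold g e t c η L) :
    Negligible Pr fun b ω => tauHat (fold b) (L b) g e t (IDiD.sample K b O ω) - tau P e t η := by
  have h1 := h.negligible_crossMean_fitScore 1 (-tau P e t η)
  rw [← StudyDesign.psiTrue_eq, h.study.integral_psiTrue h.den] at h1
  simp only [sub_zero] at h1
  exact ((h.negligible_Jhat_sub.inv_sub_inv h.den).tight_of_sub.mul_negligible h1).congr
    h.highProb_tauHat_sub

theorem negligible_sqrt_mul_crossMean (h : CrossFitDesign P Pr O fold g e t c η L) :
    Negligible Pr fun b ω => √((K * b : ℕ) : ℝ) *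
      (crossMean (fold b) (IDiD.sample K b O ω)
          (fitScore (fold b) (L b) g e t 1 (-tau P e t η) (IDiD.sample K b O ω))
        - crossMean (fold b) (IDiD.sample K b O ω) fun _ => psiTrue P g e t η) := by
  refine ((Negligible.crossMean fun k => h.negligible_sqrt_mul_foldMean k).const_mul √K).congr
    (HighProb.of_forall fun b ω => ?_)
  rw [← Finset.mul_sum, Finset.sum_sub_distrib, Nat.cast_mul, Real.sqrt_mul (Nat.cast_nonneg _)]
  simp only [crossMean]
  ring

theorem iIndepFun_comp (h : CrossFitDesign P Pr O fold g e t c η L) {f : Obs 𝒳 → ℝ}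
    (hf : Measurable f) : iIndepFun (fun i ω => f (O i ω)) Pr :=
  h.sample.indep.comp (fun _ => f) fun _ => hf

theorem identDistrib_comp (h : CrossFitDesign P Pr O fold g e t c η L) {f : Obs 𝒳 → ℝ}
    (hf : Measurable f) (i : ℕ) :
    IdentDistrib (fun ω => f (O i ω)) (fun ω => f (O 0 ω)) Pr Pr :=
  IdentDistrib.comp (u := f) ⟨(h.sample.meas i).aemeasurable, (h.sample.meas 0).aemeasurable, by
    rw [h.sample.law, h.sample.law]⟩ hf

theorem integral_comp (h : CrossFitDesign P Pr O fold g e t c η L) {f : Obs 𝒳 → ℝ}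
    (hf : Measurable f) (i : ℕ) : ∫ ω, f (O i ω) ∂Pr = ∫ o, f o ∂P := by
  rw [← h.sample.law i, integral_map (h.sample.meas i).aemeasurable hf.aestronglyMeasurable]

theorem tendsto_mul_atTop (h : CrossFitDesign P Pr O fold g e t c η L) :
    Tendsto (fun b => K * b) atTop atTop :=
  tendsto_id.const_mul_atTop' (by have := h.folds; omega)

theorem tendstoInDistribution_influence (h : CrossFitDesign P Pr O fold g e t c η L) :
    TendstoInDistribution (fun b ω => √((K * b : ℕ) : ℝ) *
        ((tauDen P e t η)⁻¹ * crossMean (fold b) (IDiD.sample K b O ω) fun _ => psiTrue P g e t η))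
      atTop (id : ℝ → ℝ) (fun _ => Pr) (gaussianReal 0 (sigmaSq P g e t η).toNNReal) := by
  set f : Obs 𝒳 → ℝ := fun o => (tauDen P e t η)⁻¹ * psiTrue P g e t η o with hf
  have hfm : Measurable f := h.study.measurable_psiTrue.const_mul _
  have hf2 : MemLp f 2 P := h.study.memLp_psiTrue.const_mul _
  have hX2 : MemLp (fun ω => f (O 0 ω)) 2 Pr :=
    hf2.comp_measurePreserving (h.sample.measurePreserving 0)
  have hmean : ∫ ω, f (O 0 ω) ∂Pr = 0 := by
    rw [h.integral_comp hfm, hf, integral_const_mul, h.study.integral_psiTrue h.den, mul_zero]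
  have hvar : Var[fun ω => f (O 0 ω); Pr] = sigmaSq P g e t η := by
    rw [variance_of_integral_eq_zero hX2.1.aemeasurable hmean]
    refine (h.integral_comp (hfm.pow_const 2) 0).trans ?_
    simp only [hf, mul_pow]
    rw [integral_const_mul, sigmaSq, h.study.J0_eq, inv_pow]
  have hclt := tendstoInDistribution_inv_sqrt_mul_sum_sub (X := fun i ω => f (O i ω)) (P := Pr)
    (Y := (id : ℝ → ℝ)) (P' := gaussianReal 0 (sigmaSq P g e t η).toNNReal)
    ⟨aemeasurable_id, by rw [Measure.map_id, hvar]⟩ hX2 (h.iIndepFun_comp hfm)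
    (h.identDistrib_comp hfm)
  -- The central limit theorem is used along the subsequence of sample sizes `K * b`.
  have hsub : TendstoInDistribution (fun b ω => (√((K * b : ℕ) : ℝ))⁻¹ *
      (∑ i ∈ Finset.range (K * b), f (O i ω) - ((K * b : ℕ) : ℝ) * ∫ ω, f (O 0 ω) ∂Pr))
      atTop (id : ℝ → ℝ) (fun _ => Pr) (gaussianReal 0 (sigmaSq P g e t η).toNNReal) :=
    ⟨fun b => hclt.forall_aemeasurable (K * b), hclt.aemeasurable_limit,
      hclt.tendsto.comp h.tendsto_mul_atTop⟩
  refine hsub.congr (fun b => Eventually.of_forall fun ω => ?_) (Eventually.of_forall fun _ => rfl)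
  simp only
  rw [hmean, mul_zero, sub_zero, mul_left_comm, sqrt_mul_crossMean_fixed, hf, ← Finset.mul_sum]
  ring

theorem tight_sqrt_mul_crossMean (h : CrossFitDesign P Pr O fold g e t c η L) :
    Tight Pr fun b ω => √((K * b : ℕ) : ℝ) *
      crossMean (fold b) (IDiD.sample K b O ω) fun _ => psiTrue P g e t η := by
  have h1 : ∀ k, Tight Pr fun b ω => √(b : ℝ) *
      foldMean (fold b) (IDiD.sample K b O ω) k (psiTrue P g e t η) := fun k => by
    have := h.sample.tight_fluctuation k h.study.measurable_psiTrue h.study.memLp_psiTrue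
    simpa only [h.study.integral_psiTrue h.den, sub_zero] using this
  refine ((Tight.const (√K * (K : ℝ)⁻¹)).mul (Tight.sum Finset.univ fun k _ => h1 k)).of_le
    (HighProb.of_forall fun b ω => le_of_eq ?_)
  rw [← Finset.mul_sum, Nat.cast_mul, Real.sqrt_mul (Nat.cast_nonneg _)]
  simp only [crossMean]
  ring_nf

/-- Asymptotic normality of the estimator. -/
theorem tendstoInDistribution_tauHat (h : CrossFitDesign P Pr O fold g e t c η L) :
    TendstoInDistribution (fun b ω => √((K * b : ℕ) : ℝ) *
        (tauHat (fold b) (L b) g e t (IDiD.sample K b O ω) - tau P e t η))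
      atTop (id : ℝ → ℝ) (fun _ => Pr) (gaussianReal 0 (sigmaSq P g e t η).toNNReal) := by
  have hJ := h.negligible_Jhat_sub.inv_sub_inv h.den
  -- With `A` and `A₀` the means of the estimated and the true score, `Ĵ⁻¹A - J⁻¹A₀ = Ĵ⁻¹(A - A₀) +
  -- (Ĵ⁻¹ - J⁻¹)A₀`.
  have h1 := (hJ.tight_of_sub.mul_negligible h.negligible_sqrt_mul_crossMean).add
    (hJ.mul_tight h.tight_sqrt_mul_crossMean)
  refine tendstoInDistribution_of_tendstoInMeasure_sub _ _ h.tendstoInDistribution_influence ?_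
    fun b => ((h.measurable_tauHat b).sub_const _).const_mul _ |>.aemeasurable
  refine (negligible_iff_tendstoInMeasure (z := 0)).1 (h1.congr
    (h.highProb_tauHat_sub.mono (Eventually.of_forall fun b ω hb => ?_)))
  simp only [Pi.sub_apply, sub_zero]
  rw [hb]
  ring

end CrossFitDesign

end CrossMeans

/-! ### Quantiles of the normal distribution. -/

section Quantile

theorem leftLim_cdf (μ : Measure ℝ) [IsProbabilityMeasure μ] [NullSingletonClass μ] (x : ℝ) :
    Function.leftLim (cdf μ) x = cdf μ x := by
  have h : μ {x} = 0 := measure_singleton x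
  rw [← measure_cdf μ, StieltjesFunction.measure_singleton, ENNReal.ofReal_eq_zero] at h
  have h2 := (monotone_cdf μ).leftLim_le (le_refl x)
  linarith

/-- At the infimum right-continuity gives `≥ q`, and the left limit, equal to the value as there are
no atoms, gives `≤ q`. -/
theorem cdf_stdNormalQuantile {q : ℝ} (h0 : 0 < q) (h1 : q < 1) :
    cdf (gaussianReal 0 1) (stdNormalQuantile q) = q := by
  have : NullSingletonClass (gaussianReal 0 1) := nullSingletonClass_gaussianReal one_ne_zero
  set F := cdf (gaussianReal 0 1) with hF
  set S : Set ℝ := {x | q ≤ F x} with hS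
  obtain ⟨x₁, hx₁⟩ := ((tendsto_cdf_atTop (gaussianReal 0 1)).eventually (eventually_ge_nhds h1)).exists
  have hne : S.Nonempty := ⟨x₁, hx₁⟩
  obtain ⟨x₀, hx₀⟩ := ((tendsto_cdf_atBot (gaussianReal 0 1)).eventually (eventually_lt_nhds h0)).exists
  have hbdd : BddBelow S := ⟨x₀, fun x hx => by
    by_contra hlt
    exact absurd (hx.trans (F.mono (le_of_not_ge hlt))) (not_le.2 hx₀)⟩
  have hlow : ∀ x, x < sInf S → F x < q := fun x hx => by
    by_contra hle
    exact absurd (csInf_le hbdd (not_lt.1 hle)) (not_le.2 hx)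
  have hhigh : ∀ x, sInf S < x → q ≤ F x := fun x hx => by
    obtain ⟨y, hy, hyx⟩ := exists_lt_of_csInf_lt hne hx
    exact le_trans hy (F.mono hyx.le)
  change F (sInf S) = q
  refine le_antisymm ?_ ?_
  · rw [← leftLim_cdf (gaussianReal 0 1)]
    exact le_of_tendsto (F.mono.tendsto_leftLim _)
      (eventually_nhdsWithin_of_forall fun x hx => (hlow x hx).le)
  · refine ge_of_tendsto (((F.right_continuous (sInf S)).tendsto).mono_left
      (nhdsWithin_mono _ Set.Ioi_subset_Ici_self)) (eventually_nhdsWithin_of_forall hhigh)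

theorem cdf_gaussianReal_neg (x : ℝ) :
    cdf (gaussianReal 0 1) (-x) = 1 - cdf (gaussianReal 0 1) x := by
  have : NullSingletonClass (gaussianReal 0 1) := nullSingletonClass_gaussianReal one_ne_zero
  have hmap : (gaussianReal 0 1).map (fun y => -y) = gaussianReal 0 1 := by
    rw [gaussianReal_map_neg, neg_zero]
  rw [cdf_eq_real, cdf_eq_real, ← probReal_compl_eq_one_sub measurableSet_Iic]
  nth_rewrite 1 [← hmap]
  rw [measureReal_def, measureReal_def, Measure.map_apply measurable_neg measurableSet_Iic]
  have h : (fun y : ℝ => -y) ⁻¹' Set.Iic (-x) = Set.Ici x := by ext; simp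
  rw [h, Set.compl_Iic, measure_congr Ioi_ae_eq_Ici]

theorem gaussianReal_Icc_stdNormalQuantile {α : ℝ} (h0 : 0 < α) (h1 : α < 1) :
    gaussianReal 0 1 (Set.Icc (-stdNormalQuantile (1 - α / 2)) (stdNormalQuantile (1 - α / 2)))
      = ENNReal.ofReal (1 - α) := by
  have : NullSingletonClass (gaussianReal 0 1) := nullSingletonClass_gaussianReal one_ne_zero
  rw [← measure_cdf (gaussianReal 0 1), StieltjesFunction.measure_Icc, leftLim_cdf,
    cdf_gaussianReal_neg, cdf_stdNormalQuantile (by linarith) (by linarith)]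
  congr 1
  ring

theorem gaussianReal_abs_le {v : ℝ} (hv : 0 < v) (z : ℝ) :
    gaussianReal 0 v.toNNReal {x | |x| - z * √v ≤ 0} = gaussianReal 0 1 (Set.Icc (-z) z) := by
  have hs := Real.sqrt_pos.2 hv
  have hmap : (gaussianReal 0 1).map (fun x => √v * x) = gaussianReal 0 v.toNNReal := by
    rw [gaussianReal_map_const_mul, mul_zero, mul_one]
    congr 1
    ext
    simp [Real.sq_sqrt hv.le, hv.le]
  rw [← hmap, Measure.map_apply (measurable_const_mul _)
    (measurableSet_le (by fun_prop) measurable_const)]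
  congr 1
  ext x
  simp only [Set.mem_preimage, Set.mem_ofPred_eq, Set.mem_Icc, ← abs_le, abs_mul,
    abs_of_pos hs, sub_nonpos]
  rw [mul_comm z, mul_le_mul_iff_right₀ hs]

end Quantile

/-! ### Variance estimation and coverage. -/

section Inference

variable {𝒳 Ω : Type*} [MeasurableSpace 𝒳] [MeasurableSpace Ω]

/-- Empirical second moments of functions that are close in the empirical `L²` norm. -/
theorem EmpSmall.negligible_foldMean_sq_sub {Pr : Measure Ω} {O : ℕ → Ω → Obs 𝒳} {K : ℕ}
    {fold : (b : ℕ) → Fin (K * b) → Fin K} {k : Fin K} {f : ℕ → Ω → Obs 𝒳 → ℝ} {h : Obs 𝒳 → ℝ}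
    (hf : EmpSmall Pr O fold k fun b ω o => f b ω o - h o)
    (hh : Tight Pr fun b ω => foldMean (fold b) (sample K b O ω) k fun o => h o ^ 2) :
    Negligible Pr fun b ω => foldMean (fold b) (sample K b O ω) k (fun o => f b ω o ^ 2)
      - foldMean (fold b) (sample K b O ω) k fun o => h o ^ 2 := by
  -- Cross term in `f² - h² = (f - h)² + 2h(f - h)`, handled by Cauchy–Schwarz for the fold mean.
  have h1 : Negligible Pr fun b ω => foldMean (fold b) (sample K b O ω) k
      fun o => h o * (f b ω o - h o) := by
    refine Negligible.of_sq ((hh.mul_negligible hf).of_le (HighProb.of_forall fun b ω => ?_))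
    rw [abs_of_nonneg (sq_nonneg _)]
    exact (foldMean_mul_sq_le _ _ _ _ _).trans (le_abs_self _)
  refine (Negligible.add hf (h1.const_mul 2)).congr (HighProb.of_forall fun b ω => ?_)
  rw [← foldMean_const_mul, ← foldMean_add, ← foldMean_sub]
  congr 1
  ext o
  ring

namespace CrossFitDesign

variable {P : Measure (Obs 𝒳)} {Pr : Measure Ω} [IsProbabilityMeasure P] [IsProbabilityMeasure Pr]
  {O : ℕ → Ω → Obs 𝒳} {K : ℕ} {fold : (b : ℕ) → Fin (K * b) → Fin K} {g : ControlGroup} {e t : ℕ}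
  {c : ℝ} {η : Nuisance 𝒳} {L : (b : ℕ) → Learner 𝒳 (fold b)} {s : ℕ}

theorem empSmall_psi_sub (h : CrossFitDesign P Pr O fold g e t c η L) (k : Fin K) :
    EmpSmall Pr O fold k fun b ω o =>
      psi (fitNormalizers (fold b) (L b) g e t (IDiD.sample K b O ω) k) g e t
        (fit (fold b) (L b) (IDiD.sample K b O ω) k)
        (tauHat (fold b) (L b) g e t (IDiD.sample K b O ω)) o - psiTrue P g e t η o := by
  have h1 := h.empSmall_fitScore_sub k 1 (-tau P e t η)
  have h2 := (h.empSmall_fitScore_sub k 0 1).tight_mul h.negligible_tauHat_sub.tight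
  have h3 := EmpSmall.of_negligible_mul (k := k) h.sample h.negligible_tauHat_sub
    (h.study.measurable_trueScore 0 1) (h.study.memLp_trueScore 0 1)
  -- Moving from `τ₀` to the estimator subtracts `(τ̂ - τ₀) ψ̂_a`, split here into the error of
  -- `ψ̂_a` and the true `ψ_a`.
  refine (h1.sub (h2.add h3)).congr fun b ω o => ?_
  rw [psi_eq_fitScore, StudyDesign.psiTrue_eq, fitScore_decompose (α := 1) (β := -tau P e t η)]
  ring

/-- The law of large numbers for the squared score. -/
theorem negligible_crossMean_psiTrue_sq (h : CrossFitDesign P Pr O fold g e t c η L) :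
    Negligible Pr fun b ω => crossMean (fold b) (IDiD.sample K b O ω)
      (fun _ o => psiTrue P g e t η o ^ 2) - ∫ o, psiTrue P g e t η o ^ 2 ∂P := by
  set f : Obs 𝒳 → ℝ := fun o => psiTrue P g e t η o ^ 2 with hf
  have hfm : Measurable f := h.study.measurable_psiTrue.pow_const 2
  have hint : Integrable (fun ω => f (O 0 ω)) Pr :=
    (h.sample.measurePreserving 0).integrable_comp_of_integrable
      (h.study.memLp_psiTrue.integrable_sq)
  -- The squared score is only known to be integrable, so the second-moment law used for fold means
  -- does not apply to it.
  have hlln := strong_law_ae_real (fun i ω => f (O i ω)) hint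
    (fun i j hij => (h.iIndepFun_comp hfm).indepFun hij) (h.identDistrib_comp hfm)
  rw [h.integral_comp hfm 0] at hlln
  have heq : ∀ b ω, crossMean (fold b) (IDiD.sample K b O ω) (fun _ => f)
      = (∑ i ∈ Finset.range (K * b), f (O i ω)) / ((K * b : ℕ) : ℝ) := fun b ω => by
    rw [crossMean_fixed, Finset.sum_range, ← mul_inv, ← Nat.cast_mul, div_eq_inv_mul]
    rfl
  refine negligible_iff_tendstoInMeasure.2 (tendstoInMeasure_of_tendsto_ae
    (fun b => ?_) ?_)
  · simp only [heq]
    exact ((Finset.measurable_sum _ fun i _ => hfm.comp (h.sample.meas i)).div_const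
      _).aestronglyMeasurable
  · filter_upwards [hlln] with ω hω
    simp only [heq]
    exact hω.comp h.tendsto_mul_atTop

/-- Consistency of the variance estimator. -/
theorem negligible_sigmaSqHat_sub (h : CrossFitDesign P Pr O fold g e t c η L) :
    Negligible Pr fun b ω => sigmaSqHat (fold b) (L b) g e t (IDiD.sample K b O ω)
      - sigmaSq P g e t η := by
  have h1 := Negligible.crossMean fun k => (h.empSmall_psi_sub k).negligible_foldMean_sq_sub
    (h.sample.tight_foldMean_sq k h.study.measurable_psiTrue h.study.memLp_psiTrue)
  have h2 := h1.add h.negligible_crossMean_psiTrue_sq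
  have hJ := h.negligible_Jhat_sub.comp_continuousAt (f := fun x => (x ^ 2)⁻¹)
    ((continuous_pow 2).continuousAt.inv₀ (pow_ne_zero 2 h.den))
  refine ((hJ.tight_of_sub.mul_negligible h2).add (hJ.mul_tight
    (Tight.const (∫ o, psiTrue P g e t η o ^ 2 ∂P)))).congr (HighProb.of_forall fun b ω => ?_)
  rw [sigmaSqHat, sigmaSq, h.study.J0_eq, Finset.sum_sub_distrib]
  simp only [crossMean]
  ring

/-- Puts coverage as the sign of a continuous function of the scaled error and `σ̂`, ready for the
continuous mapping theorem. -/
theorem mem_confInterval_iff {b : ℕ} (hn : 0 < K * b) (L : Learner 𝒳 (fold b)) (α τ : ℝ)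
    (o : Fin (K * b) → Obs 𝒳) :
    τ ∈ confInterval (fold b) L g e t α o ↔
      |√((K * b : ℕ) : ℝ) * (tauHat (fold b) L g e t o - τ)|
        - stdNormalQuantile (1 - α / 2) * √(sigmaSqHat (fold b) L g e t o) ≤ 0 := by
  have hs : 0 < √((K * b : ℕ) : ℝ) := Real.sqrt_pos.2 (by exact_mod_cast hn)
  rw [abs_mul, abs_of_pos hs, sub_nonpos, mul_comm, ← le_div_iff₀ hs, abs_le]
  simp only [confInterval, Set.mem_Icc]
  constructor <;> rintro ⟨h1, h2⟩ <;> constructor <;> linarith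

/-- Asymptotic coverage of the confidence interval. -/
theorem tendsto_coverage (h : CrossFitDesign P Pr O fold g e t c η L)
    (hσ : 0 < sigmaSq P g e t η) {α : ℝ} (h0 : 0 < α) (h1 : α < 1) :
    Tendsto (fun b => Pr.real {ω | tau P e t η ∈
      confInterval (fold b) (L b) g e t α (IDiD.sample K b O ω)}) atTop (𝓝 (1 - α)) := by
  set z := stdNormalQuantile (1 - α / 2) with hz
  set v := sigmaSq P g e t η with hv
  have hS : TendstoInMeasure Pr
      (fun b ω => √(sigmaSqHat (fold b) (L b) g e t (IDiD.sample K b O ω))) atTop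
      (fun _ => √v) :=
    negligible_iff_tendstoInMeasure.1
      (h.negligible_sigmaSqHat_sub.comp_continuousAt Real.continuous_sqrt.continuousAt)
  have hD := h.tendstoInDistribution_tauHat.continuous_comp_prodMk_of_tendstoInMeasure_const
    (g := fun p : ℝ × ℝ => |p.1| - z * p.2) (by fun_prop) hS
    (fun b => (h.measurable_sigmaSqHat b).sqrt.aemeasurable)
  have : NullSingletonClass (gaussianReal 0 v.toNNReal) :=
    nullSingletonClass_gaussianReal (Real.toNNReal_pos.2 hσ).ne'
  have hmeas : Measurable fun x : ℝ => |id x| - z * √v := by fun_prop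
  -- The boundary `|x| = z√v` has at most two points and the limit law has no atoms because `v > 0`;
  -- probabilities of the event therefore converge.
  have hnull : ((gaussianReal 0 v.toNNReal).map fun x : ℝ => |id x| - z * √v)
      (frontier (Set.Iic 0)) = 0 := by
    rw [frontier_Iic, Measure.map_apply hmeas (measurableSet_singleton _)]
    refine (Set.Finite.subset (Set.toFinite {z * √v, -(z * √v)}) fun x hx => ?_).measure_zero _
    have hx' : |x| = z * √v := sub_eq_zero.1 hx
    simp only [Set.mem_insert_iff, Set.mem_singleton_iff]
    rcases abs_choice x with hc | hc
    · exact Or.inl (by linarith)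
    · exact Or.inr (by linarith)
  have hP := ProbabilityMeasure.tendsto_measure_of_null_frontier_of_tendsto' hD.tendsto hnull
  have hlim : ((gaussianReal 0 v.toNNReal).map fun x : ℝ => |id x| - z * √v) (Set.Iic 0)
      = ENNReal.ofReal (1 - α) := by
    rw [Measure.map_apply hmeas measurableSet_Iic]
    exact (gaussianReal_abs_le hσ z).trans (gaussianReal_Icc_stdNormalQuantile h0 h1)
  simp only [ProbabilityMeasure.coe_mk] at hP
  rw [hlim] at hP
  have hR := (ENNReal.tendsto_toReal ENNReal.ofReal_ne_top).comp hP
  rw [ENNReal.toReal_ofReal (by linarith)] at hR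
  refine hR.congr' ?_
  filter_upwards [eventually_gt_atTop 0] with b hb
  have hn : 0 < K * b := Nat.mul_pos (by have := h.folds; omega) hb
  simp only [Function.comp_apply, measureReal_def]
  rw [Measure.map_apply_of_aemeasurable (hD.forall_aemeasurable b) measurableSet_Iic]
  congr 2
  ext ω
  exact (mem_confInterval_iff hn (L b) α _ _).symm

end CrossFitDesign

end Inference

end IDiD

theorem mainTheorem12 {𝒳 Ω : Type*} [MeasurableSpace 𝒳] [MeasurableSpace Ω]
    -- the population: law `P` of an observation `(Y, D, E, T, X)`, cohort `e`, period `t ≥ e`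
    (P : Measure (IDiD.Obs 𝒳)) [IsProbabilityMeasure P]
    (g : IDiD.ControlGroup) (e t : ℕ) (he : 2 ≤ e) (het : e ≤ t)
    -- repeated cross-sections: `(E, X)` is invariant to the sampling period `T`
    (hT : IndepFun (fun o : IDiD.Obs 𝒳 => IDiD.obsT o)
      (fun o : IDiD.Obs 𝒳 => (IDiD.obsE o, IDiD.obsX o)) P)
    (hlam : ∀ s, s = e - 1 ∨ s = t → 0 < P.real (IDiD.period s))
    (hD : ∀ᵐ o ∂P, IDiD.obsD o = 0 ∨ IDiD.obsD o = 1)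
    (hY : MemLp (fun o : IDiD.Obs 𝒳 => IDiD.obsY o) 2 P)
    -- true nuisance functions, overlap, and well-definedness of the identified ratio
    (η : IDiD.Nuisance 𝒳) (hη : IDiD.IsTrueNuisance P g e t η)
    (c : ℝ) (hc : 0 < c) (hexp : c < P.real (IDiD.exposed e))
    (hover : ∀ᵐ x ∂(IDiD.covLaw P g e t), η.p x < 1 - c)
    (hden : IDiD.tauDen P e t η ≠ 0)
    -- the i.i.d. sample
    (Pr : Measure Ω) [IsProbabilityMeasure Pr] (O : ℕ → Ω → IDiD.Obs 𝒳)
    (hOmeas : ∀ i, Measurable (O i)) (hOlaw : ∀ i, Pr.map (O i) = P) (hOindep : iIndepFun O Pr)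
    -- `K` folds of equal size `b` and the cross-fitted nuisance learners
    (K : ℕ) (hK : 2 ≤ K) (fold : (b : ℕ) → Fin (K * b) → Fin K)
    (hfold : ∀ b k, (Finset.univ.filter fun i => fold b i = k).card = b)
    (L : (b : ℕ) → IDiD.Learner 𝒳 (fold b))
    (hL : ∀ b k, IDiD.IsMeasurableLearner (L b k))
    (hcond : IDiD.NuisanceConditions Pr P g e t c η
      (fun b ω => IDiD.fit (fold b) (L b) (IDiD.sample K b O ω))
      (fun b ω => IDiD.fitNormalizers (fold b) (L b) g e t (IDiD.sample K b O ω))) :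
    -- `J₀ ≠ 0` and `E[ψ²] < ∞`
    IDiD.J0 P g e t η ≠ 0 ∧ MemLp (IDiD.psiTrue P g e t η) 2 P ∧
    -- `√n (τ̂ - τ₀) → N(0, σ²)` in distribution
    TendstoInDistribution
      (fun b ω => √((K * b : ℕ) : ℝ) *
        (IDiD.tauHat (fold b) (L b) g e t (IDiD.sample K b O ω) - IDiD.tau P e t η))
      atTop (id : ℝ → ℝ) (fun _ => Pr) (gaussianReal 0 (IDiD.sigmaSq P g e t η).toNNReal) ∧
    -- consistency of the variance estimator
    TendstoInMeasure Pr
      (fun b ω => IDiD.sigmaSqHat (fold b) (L b) g e t (IDiD.sample K b O ω))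
      atTop (fun _ => IDiD.sigmaSq P g e t η) ∧
    -- asymptotic coverage of the confidence interval
    (0 < IDiD.sigmaSq P g e t η → ∀ α : ℝ, 0 < α → α < 1 →
      Tendsto (fun b => Pr.real {ω | IDiD.tau P e t η ∈
          IDiD.confInterval (fold b) (L b) g e t α (IDiD.sample K b O ω)})
        atTop (𝓝 (1 - α))) := by
  have hO : IDiD.OverlapDesign P g e t c η :=
    -- `e - 1` is a truncated subtraction; `2 ≤ e ≤ t` makes it differ from `t`.
    ⟨by omega, hT, hc, hexp, hover, hη.propensity⟩
  have hstudy : IDiD.StudyDesign P g e t c η :=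
    ⟨hO, hη, hD, hY, fun s hs h0 => by simpa [measureReal_def, h0] using hlam s hs⟩
  have h : IDiD.CrossFitDesign P Pr O fold g e t c η L :=
    ⟨hstudy, hden, ⟨hOmeas, hOlaw, hOindep, hfold⟩, hK, hL, hcond⟩
  exact ⟨by rwa [hstudy.J0_eq], hstudy.memLp_psiTrue, h.tendstoInDistribution_tauHat,
    IDiD.negligible_iff_tendstoInMeasure.1 h.negligible_sigmaSqHat_sub,
    fun hσ _ h0 h1 => h.tendsto_coverage hσ h0 h1⟩
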